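/- **Setting.** Let $d\ge 3$ and $p\ge 1$ be integers, and $\Theta=\{\theta\in\mathbb R^{p-1}:\|\theta\|<1\}$, $\beta(\theta)=(\sqrt{1-\|\theta\|^2},\theta^T)^T$, $J(\theta)=\partial\beta(\theta)/\partial\theta$, $U_\theta=X^T\beta(\theta)$, $u_\theta=x^T\beta(\theta)$. The predictor $X$ takes values in a compact set $\mathcal X\subset\mathbb R^p$; for each $\theta\in\Theta$ the law of $U_\theta$ has a density, and $u_\theta$ lies in the support of $U_\theta$ for every $x\in\mathcal X$. Let $\theta_0\in\Theta$, and let $\tilde\mu:\mathbb R\to\mathbb R^d$ be $C^1$ with $\|\tilde\mu(u)\|=1$ for $u$ in the support of $U_{\theta_0}$. An *angular function* is a non-decreasing $f:\mathbb R\to[0,\infty)$, differentiable near $+\infty$, such that $g_f=f'/f$ satisfies $x\,g_f(x)\to\infty$ and, for every $S>0$, $g_f(x-s/g_f(x))/g_f(x)\to1$ as $x\to\infty$, uniformly in $s\in[0,S]$. For $\kappa>0$ let $F_\kappa$ be the law of $(X,Y)$ for which $Y\in\mathbb S^{d-1}$ has, given $X$, the density $c_{d,\kappa,f}\,f(\kappa\,y^T\tilde\mu(U_{\theta_0}))$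 with respect to the surface measure; the law of $X$ does not depend on $\kappa$. Let $\psi_\lambda(u)=1-\exp(-\|u\|^2/\lambda)$ be the exponential squared loss (ESL), and let $\mu_\theta(u)=\mu_{\theta,\kappa}(u)$ be the minimiser over $a\in\mathbb R^d$ of $\mathbb E_{F_\kappa}[\psi_\lambda(Y-a)\mid U_\theta=u]$. Fix $\delta\in(0,1)$ and let $\lambda=\lambda(\kappa)>0$ satisfy $$1-\mathbb E_{F_\kappa}\Big[\exp\{-\|Y-\mu_{\theta_0}(U_{\theta_0})\|^2/\lambda\}\Big]=\delta .$$ Assume that, for all sufficiently large $\kappa$: for each $\theta\in\Theta$ the minimiser $\mu_\theta(u)$ is unique (for almost every value $u$ of $U_\theta$); $(\theta,u)\mapsto\mu_\theta(u)$ is (extends to) a $C^1$ function on $\Theta\times\mathbb R$; $F(u)=\mathbb E[\psi_\lambda''(Y-\mu_{\theta_0}(u))\mid U_{\theta_0}=u]$ is positive definite for almost every $u$; and the matrix $W_0=\mathbb E\big[\mu_{\theta_0}'(U_{\theta_0})^TF(U_{\theta_0})\mu_{\theta_0}'(U_{\theta_0})\,J(\theta_0)^T\Sigma_{X|U_{\theta_0}}J(\theta_0)\big]$,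 where $\Sigma_{X|U_{\theta_0}}$ is the conditional covariance matrix of $X$ given $U_{\theta_0}$, is invertible. For $z\in\mathcal X\times\mathbb S^{d-1}$ the influence function $\mathrm{IF}_\kappa(z)$ of the ESL estimator is the derivative at $\varepsilon=0^+$ of $T_\varepsilon$, where $T_\varepsilon$ minimises $\theta\mapsto\mathbb E_{(1-\varepsilon)F_\kappa+\varepsilon\delta_z}[\psi_\lambda(Y-\mu_\theta(U_\theta))]$ over a fixed neighbourhood of $\theta_0$ in $\Theta$, with $\mu_\theta$ the link functions under $F_\kappa$. The dispersion matrix is $\Sigma_\kappa=\mathbb E_{F_\kappa}[\mathrm{IF}_\kappa(Z)\mathrm{IF}_\kappa(Z)^T]$, assumed invertible for all large $\kappa$, and the standardized gross error sensitivity is $$\gamma^*_\kappa=\sup_{z\in\mathcal X\times\mathbb S^{d-1}}\big(\mathrm{IF}_\kappa(z)^T\Sigma_\kappa^{-1}\mathrm{IF}_\kappa(z)\big)^{1/2}.$$ **Statement.** There is a constant $C>0$, depending only on $d$, $\mathcal X$, the law of $X$, $\theta_0$ and $\tilde\mu$ (in particular neither on $\kappa$ nor on $\delta$), such that for every angular function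 $f$, every $\delta\in(0,1)$ and all $\lambda(\cdot)$ and $\mu_\theta$ as above, for all sufficiently large $\kappa$ the influence function $\mathrm{IF}_\kappa(z)$ exists and is unique for every $z\in\mathcal X\times\mathbb S^{d-1}$, and $$\gamma^*_\kappa\;\le\;C\,\big(K(\delta)-2\big)^{-\frac{d-1}{4}}\big(K(\delta)+2\big)^{\frac{d+1}{4}},\qquad K(\delta)=\frac{2}{1-(1-\delta)^{2/(d-1)}} .$$ -/

import Mathlib

open MeasureTheory ProbabilityTheory Filter Topology Set
open scoped ENNReal Matrix

noncomputable section

/-- Euclidean `n`-space with its Euclidean norm. -/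
abbrev Euc (n : ℕ) : Type := EuclideanSpace ℝ (Fin n)

/-! ### The extrinsic single-index model (predictor dimension `p = q + 1`) -/

/-- The parameter space `Θ`: the open unit ball of `ℝ^{p-1}`. -/
def paramSpace (q : ℕ) : Set (Euc q) := {θ | ‖θ‖ ^ 2 < 1}

/-- `β(θ) = (√(1 - ‖θ‖²), θᵀ)ᵀ`. -/
def betaVec {q : ℕ} (θ : Euc q) : Euc (q + 1) :=
  WithLp.toLp 2 (Fin.cons (√(1 - ‖θ‖ ^ 2)) (fun i => θ i))

/-- The projection index `u_θ = xᵀ β(θ)`. -/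
def projIndex {q : ℕ} (θ : Euc q) (x : Euc (q + 1)) : ℝ := inner ℝ x (betaVec θ)

/-- The `p × (p-1)` Jacobian matrix `J(θ) = ∂β(θ)/∂θ`. -/
def jacobianBeta {q : ℕ} (θ : Euc q) : Matrix (Fin (q + 1)) (Fin q) ℝ :=
  Matrix.of (Fin.cons (fun j => -θ j / √(1 - ‖θ‖ ^ 2)) (fun i j => if i = j then 1 else 0))

/-- The exponential squared loss with tuning parameter `lam`. -/
def eslLoss {d : ℕ} (lam : ℝ) (u : Euc d) : ℝ := 1 - Real.exp (-‖u‖ ^ 2 / lam)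

section Population

variable {q d : ℕ}

/-- The law of the index `U_θ = Xᵀ β(θ)` when `(X, Y)` has law `P`. -/
def indexLaw (P : Measure (Euc (q + 1) × Euc d)) (θ : Euc q) : Measure ℝ :=
  P.map (fun z => projIndex θ z.1)

/-- The regular conditional law of `Y` given `U_θ = u` when `(X, Y)` has law `P`. -/
def condLawY (P : Measure (Euc (q + 1) × Euc d)) [IsFiniteMeasure P] (θ : Euc q) :
    Kernel ℝ (Euc d) :=
  condDistrib (fun z : Euc (q + 1) × Euc d => z.2) (fun z => projIndex θ z.1) P

/-- The regular conditional law of `X` given `U_θ = u` when `(X, Y)` has law `P`. -/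
def condLawX (P : Measure (Euc (q + 1) × Euc d)) [IsFiniteMeasure P] (θ : Euc q) :
    Kernel ℝ (Euc (q + 1)) :=
  condDistrib (fun z : Euc (q + 1) × Euc d => z.1) (fun z => projIndex θ z.1) P

/-- `μ_θ(u)` is, for every `θ ∈ Θ` and almost every value `u` of `U_θ`, the unique minimiser over
`a ∈ ℝ^d` of `𝔼[ψ(Y - a) | U_θ = u]`. -/
def IsLinkFamily (ψ : Euc d → ℝ) (P : Measure (Euc (q + 1) × Euc d)) [IsFiniteMeasure P]
    (μ : Euc q → ℝ → Euc d) : Prop :=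
  ∀ θ ∈ paramSpace q, ∀ᵐ u ∂(indexLaw P θ), ∀ a : Euc d, a ≠ μ θ u →
    ∫ y, ψ (y - μ θ u) ∂(condLawY P θ u) < ∫ y, ψ (y - a) ∂(condLawY P θ u)

/-- `(θ, u) ↦ μ_θ(u)` is continuously differentiable. Only the values at `u` in the support of
`U_θ` carry information; the other ones are a `C¹` extension. -/
def IsSmoothFamily (μ : Euc q → ℝ → Euc d) : Prop :=
  ContDiffOn ℝ 1 (fun w : Euc q × ℝ => μ w.1 w.2) (paramSpace q ×ˢ univ)

/-- The quadratic form `v ↦ vᵀ F(u; θ) v` of `F(u; θ) = 𝔼[ψ''(Y - μ_θ(u)) | U_θ = u]`. -/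
def condHessian (ψ : Euc d → ℝ) (P : Measure (Euc (q + 1) × Euc d)) [IsFiniteMeasure P]
    (μ : Euc q → ℝ → Euc d) (θ : Euc q) (u : ℝ) (v : Euc d) : ℝ :=
  ∫ y, fderiv ℝ (fderiv ℝ ψ) (y - μ θ u) v v ∂(condLawY P θ u)

/-- `Σ_{X|U_θ = u}`, the conditional covariance matrix of `X` given `U_θ = u`. -/
def condCovX (P : Measure (Euc (q + 1) × Euc d)) [IsFiniteMeasure P] (θ : Euc q) (u : ℝ) :
    Matrix (Fin (q + 1)) (Fin (q + 1)) ℝ :=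
  Matrix.of fun i j =>
    ∫ x, (x i - ∫ x', x' i ∂(condLawX P θ u)) * (x j - ∫ x', x' j ∂(condLawX P θ u))
      ∂(condLawX P θ u)

/-- `W = 𝔼[μ_θ'(U_θ)ᵀ F(U_θ; θ) μ_θ'(U_θ) J(θ)ᵀ Σ_{X|U_θ} J(θ)]`. -/
def hessianW (ψ : Euc d → ℝ) (P : Measure (Euc (q + 1) × Euc d)) [IsFiniteMeasure P]
    (μ : Euc q → ℝ → Euc d) (θ : Euc q) : Matrix (Fin q) (Fin q) ℝ :=
  Matrix.of fun i j =>
    ∫ u, condHessian ψ P μ θ u (deriv (μ θ) u) *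
      ((jacobianBeta θ)ᵀ * condCovX P θ u * jacobianBeta θ) i j ∂(indexLaw P θ)

/-! ### Influence functions and gross error sensitivity -/

/-- The criterion `𝔼_Q[ψ(Y - μ_θ(U_θ))]` as a function of `θ`. -/
def risk (ψ : Euc d → ℝ) (μ : Euc q → ℝ → Euc d) (Q : Measure (Euc (q + 1) × Euc d))
    (θ : Euc q) : ℝ :=
  ∫ z, ψ (z.2 - μ θ (projIndex θ z.1)) ∂Q

/-- The contaminated law `(1 - ε) P + ε δ_z`. -/
def contaminated (P : Measure (Euc (q + 1) × Euc d)) (z : Euc (q + 1) × Euc d) (ε : ℝ) :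
    Measure (Euc (q + 1) × Euc d) :=
  ENNReal.ofReal (1 - ε) • P + ENNReal.ofReal ε • Measure.dirac z

/-- `v` is the derivative at `ε = 0+` of the M-functional along `(1 - ε) P + ε δ_z`: over some
fixed neighbourhood of `θ₀` in `Θ`, the criterion under the contaminated law has a minimiser `T ε`
with `(T ε - θ₀) / ε → v`. The link family `μ` is that of the uncontaminated population. -/
def HasInfluence (ψ : Euc d → ℝ) (μ : Euc q → ℝ → Euc d) (P : Measure (Euc (q + 1) × Euc d))
    (θ₀ : Euc q) (z : Euc (q + 1) × Euc d) (v : Euc q) : Prop :=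
  ∃ N ∈ 𝓝 θ₀, N ⊆ paramSpace q ∧ ∃ T : ℝ → Euc q,
    (∀ᶠ ε in 𝓝[>] (0 : ℝ), T ε ∈ N ∧ IsMinOn (risk ψ μ (contaminated P z ε)) N (T ε)) ∧
    Tendsto (fun ε => ε⁻¹ • (T ε - θ₀)) (𝓝[>] (0 : ℝ)) (𝓝 v)

/-- The influence function `IF(z; θ̂, P)`: the vector `v` with `HasInfluence ψ μ P θ₀ z v`. -/
def influenceFunction (ψ : Euc d → ℝ) (μ : Euc q → ℝ → Euc d)
    (P : Measure (Euc (q + 1) × Euc d)) (θ₀ : Euc q) (z : Euc (q + 1) × Euc d) : Euc q :=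
  Classical.epsilon (HasInfluence ψ μ P θ₀ z)

/-- The dispersion matrix `Σ = 𝔼_P[IF(Z) IF(Z)ᵀ]`. -/
def dispersion (ψ : Euc d → ℝ) (μ : Euc q → ℝ → Euc d)
    (P : Measure (Euc (q + 1) × Euc d)) (θ₀ : Euc q) : Matrix (Fin q) (Fin q) ℝ :=
  Matrix.of fun i j =>
    ∫ z, influenceFunction ψ μ P θ₀ z i * influenceFunction ψ μ P θ₀ z j ∂P

/-- The standardized influence function `(IF(z)ᵀ Σ⁻¹ IF(z))^{1/2}`. -/
def standardizedInfluence (ψ : Euc d → ℝ) (μ : Euc q → ℝ → Euc d)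
    (P : Measure (Euc (q + 1) × Euc d)) (θ₀ : Euc q) (z : Euc (q + 1) × Euc d) : ℝ :=
  √((fun i => influenceFunction ψ μ P θ₀ z i) ⬝ᵥ
    ((dispersion ψ μ P θ₀)⁻¹ *ᵥ (fun i => influenceFunction ψ μ P θ₀ z i)))

/-- The standardized gross error sensitivity: the supremum of the standardized influence function
over `𝒳 × S^{d-1}`. -/
def sges (ψ : Euc d → ℝ) (μ : Euc q → ℝ → Euc d)
    (P : Measure (Euc (q + 1) × Euc d)) (θ₀ : Euc q) (𝒳 : Set (Euc (q + 1))) : ℝ≥0∞ :=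
  ⨆ z ∈ 𝒳 ×ˢ Metric.sphere (0 : Euc d) 1,
    ENNReal.ofReal (standardizedInfluence ψ μ P θ₀ z)

/-! ### High concentration -/

/-- The (unnormalised) surface measure of `S^{d-1}`, as a measure on `ℝ^d`. -/
def surfaceMeasure (d : ℕ) : Measure (Euc d) :=
  ((volume : Measure (Euc d)).toSphere).map Subtype.val

/-- The score `g_f = f' / f`. -/
def score (f : ℝ → ℝ) (x : ℝ) : ℝ := deriv f x / f x

/-- The class of angular functions. -/
structure IsAngular (f : ℝ → ℝ) : Prop where
  nonneg : ∀ x, 0 ≤ f x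
  mono : Monotone f
  differentiable : ∀ᶠ x in atTop, DifferentiableAt ℝ f x
  /-- High concentration: `x g_f(x) → ∞`. -/
  concentrates : Tendsto (fun x => x * score f x) atTop atTop
  /-- `g_f` is asymptotically constant on its own scale `1 / g_f(x)`. -/
  stable : ∀ S : ℝ, TendstoUniformlyOn (fun x s => score f (x - s / score f x) / score f x)
    (fun _ => 1) atTop (Icc 0 S)

/-- The density `y ↦ c_{d,κ,f} f(κ yᵀ m)` with respect to the surface measure, where
`1 / c_{d,κ,f} = ∫ f(κ yᵀ m) dy` (which is the same number for all unit vectors `m`). -/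
def angularDensity {d : ℕ} (f : ℝ → ℝ) (κ : ℝ) (m y : Euc d) : ℝ :=
  f (κ * inner ℝ y m) / ∫ y', f (κ * inner ℝ y' m) ∂(surfaceMeasure d)

/-- `P` is the law of `(X, Y)` where `X` has law `PX` and `Y` given `X` has density
`c_{d,κ,f} f(κ yᵀ m(U_{θ₀}))` on `S^{d-1}`. -/
def HasHighConcLaw (PX : Measure (Euc (q + 1))) (θ₀ : Euc q) (m : ℝ → Euc d) (f : ℝ → ℝ) (κ : ℝ)
    (P : Measure (Euc (q + 1) × Euc d)) : Prop :=
  P = (PX.prod (surfaceMeasure d)).withDensity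
    (fun z => ENNReal.ofReal (angularDensity f κ (m (projIndex θ₀ z.1)) z.2))

end Population

/-- `K(δ) = 2 / (1 - (1 - δ)^{2/(d-1)})`. -/
def tuningK (d : ℕ) (δ : ℝ) : ℝ := 2 / (1 - (1 - δ) ^ ((2 : ℝ) / ((d : ℝ) - 1)))

end

/-! ### Polar coordinates and the surface measure of the unit sphere. -/

section Sphere

variable {E : Type*} [NormedAddCommGroup E] [NormedSpace ℝ E] [MeasurableSpace E] [BorelSpace E]
  [FiniteDimensional ℝ E] [Nontrivial E]

/-! The form vᵀ Σ⁻¹ v is unchanged when the influence function is replaced by an invertible linear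
image of itself. The influence function satisfies ⟨IF(z), W k⟩ = s_k(z), where W is `hessianW` and
s_k is the score `fitScore` in direction k. Hence W drops out, and it suffices to bound s_k(z)² by B
· E[s_k²] with B the same for all k and z (`dotProduct_inv_mulVec_le`,
`IsGoodFit.standardizedInfluence_le`).

Two structural facts make s_k explicit. By rotational symmetry and uniqueness of the minimiser, the
link at θ₀ is ρ m on the support of the index, with one scalar ρ (`IsGoodModel.exists_radius`). And
because each μ_θ minimises the conditional risk, moving θ and moving the link are orthogonal for the
second-order form of the risk (`IsGoodFit.cross_term`). This forces the θ-derivative of μ_θ(xᵀβ(θ))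
to be ρ m'(u) times the index derivative centred given the index (`IsGoodFit.ae_linkDeriv_eq`).
Since m' is tangent to the sphere, s_k² = (2ρ/λ)² c² ⟨y, m'⟩² exp(-2‖y - ρ m‖²/λ), with c depending
only on x and k. Rotational averaging replaces ⟨y, m'⟩² by ‖m'‖² (1 - ⟨y, m⟩²)/(d - 1). The
prefactor cancels between s_k(z)² and E[s_k²]. What remains is a constant of the predictor law and
m, times the ratio of the supremum to the mean of `tangentWeight` around one fixed unit vector.

This last ratio is handled by high concentration. With G = κ g_f(κ), the variable w = G(1 - ⟨Y, m⟩)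
has Laplace transform converging to (1 + η)^{-(d-1)/2}, the Gamma one (`IsAngular.tendsto_laplace`).
Let α be given by 1 - δ = (1 + α)^{-(d-1)/2}; then K - 2 = 2/α and K + 2 = 2(1 + 2α)/α. The tuning
equation places s = 2ρ/(λG) between α/2 and 3α/2 (`IsAngular.eventually_tuning`). Up to a common
factor, `tangentWeight` is (2w - w²/G) e^{-2sw}: its supremum is at most 1/s, and its mean is
bounded below by a multiple of (1 + 3α)^{-(d+1)/2}. The quotient is at most a dimensional constant
times (2/α)(1 + 2α)^{(d+1)/2}, which is the square of the required bound
(`IsAngular.eventually_ratio`, `sq_tuning_bound`). -/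

theorem lintegral_volumeIoiPow (n : ℕ) {g : ℝ → ℝ≥0∞} (hg : Measurable g) :
    ∫⁻ r : Ioi (0 : ℝ), g r ∂(Measure.volumeIoiPow n) =
      ∫⁻ r in Ioi (0 : ℝ), ENNReal.ofReal (r ^ n) * g r := by
  rw [Measure.volumeIoiPow, lintegral_withDensity_eq_lintegral_mul _ (by fun_prop) (by fun_prop)]
  exact lintegral_subtype_comap measurableSet_Ioi (fun r : ℝ => ENNReal.ofReal (r ^ n) * g r)

theorem lintegral_polar (μ : Measure E) [μ.IsAddHaarMeasure] {g : E → ℝ≥0∞} (hg : Measurable g) :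
    ∫⁻ x, g x ∂μ = ∫⁻ w : Metric.sphere (0 : E) 1, (∫⁻ r in Ioi (0 : ℝ),
      ENNReal.ofReal (r ^ (Module.finrank ℝ E - 1)) * g (r • (w : E))) ∂μ.toSphere := by
  calc ∫⁻ x, g x ∂μ = ∫⁻ x : ({(0)}ᶜ : Set E), g x ∂(μ.comap (↑)) := by
        rw [lintegral_subtype_comap (measurableSet_singleton _).compl, MeasureTheory.restrict_compl_singleton]
    _ = ∫⁻ x, g ((x.2 : ℝ) • (x.1 : E))
          ∂μ.toSphere.prod (.volumeIoiPow (Module.finrank ℝ E - 1)) := by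
        rw [← (μ.measurePreserving_homeomorphUnitSphereProd).lintegral_comp (by fun_prop)]
        refine lintegral_congr fun x => ?_
        have : ‖(x : E)‖ ≠ 0 := norm_ne_zero_iff.2 x.2
        simp [smul_smul, this]
    _ = _ := by
        rw [lintegral_prod _ (by fun_prop)]
        refine lintegral_congr fun w => ?_
        exact lintegral_volumeIoiPow _ (g := fun r => g (r • (w : E))) (by fun_prop)

theorem lintegral_radial (μ : Measure E) [μ.IsAddHaarMeasure] {g : ℝ → ℝ≥0∞} (hg : Measurable g) :
    ∫⁻ x, g ‖x‖ ∂μ = μ.toSphere univ *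
      ∫⁻ r in Ioi (0 : ℝ), ENNReal.ofReal (r ^ (Module.finrank ℝ E - 1)) * g r := by
  rw [lintegral_polar μ (g := fun x => g ‖x‖) (by fun_prop), mul_comm, ← lintegral_const]
  refine lintegral_congr fun w => setLIntegral_congr_fun measurableSet_Ioi fun r hr => ?_
  have : ‖(w : E)‖ = 1 := by simp
  simp [norm_smul, this, abs_of_pos (show 0 < r from hr)]

theorem lintegral_Ioi_pow_indicator (n : ℕ) :
    ∫⁻ r in Ioi (0 : ℝ), ENNReal.ofReal (r ^ n) * (Iio (1 : ℝ)).indicator 1 r =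
      ENNReal.ofReal (1 / (n + 1)) := by
  have h := Measure.volumeIoiPow_apply_Iio n ⟨1, mem_Ioi.2 one_pos⟩
  rw [← lintegral_volumeIoiPow n (measurable_one.indicator measurableSet_Iio)]
  simp only [one_pow] at h
  rw [← h, ← lintegral_indicator_one measurableSet_Iio]
  rfl

/-- A function that is constant along rays, cut off to the unit ball, has radial integral 1/dim in
polar coordinates. Sphere integrals thus become volume integrals, where isometry invariance is
available. -/
theorem lintegral_toSphere (μ : Measure E) [μ.IsAddHaarMeasure] {h : E → ℝ≥0∞} (hh : Measurable h) :
    ∫⁻ w : Metric.sphere (0 : E) 1, h w ∂μ.toSphere =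
      Module.finrank ℝ E * ∫⁻ x in Metric.ball (0 : E) 1, h (‖x‖⁻¹ • x) ∂μ := by
  have hd : 0 < Module.finrank ℝ E := Module.finrank_pos
  rw [← lintegral_indicator measurableSet_ball]
  have hm : Measurable ((Metric.ball (0 : E) 1).indicator fun x => h (‖x‖⁻¹ • x)) :=
    Measurable.indicator (by fun_prop) measurableSet_ball
  rw [lintegral_polar μ hm]
  have : ∀ w : Metric.sphere (0 : E) 1, ∫⁻ r in Ioi (0 : ℝ),
      ENNReal.ofReal (r ^ (Module.finrank ℝ E - 1)) *
        (Metric.ball (0 : E) 1).indicator (fun x => h (‖x‖⁻¹ • x)) (r • (w : E)) =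
      (Module.finrank ℝ E : ℝ≥0∞)⁻¹ * h w := by
    intro w
    have hw : ‖(w : E)‖ = 1 := by simp
    have : ∀ r ∈ Ioi (0 : ℝ), ENNReal.ofReal (r ^ (Module.finrank ℝ E - 1)) *
        (Metric.ball (0 : E) 1).indicator (fun x => h (‖x‖⁻¹ • x)) (r • (w : E)) =
        ENNReal.ofReal (r ^ (Module.finrank ℝ E - 1)) * (Iio (1 : ℝ)).indicator 1 r * h w := by
      intro r hr
      have hr : 0 < r := hr
      by_cases h1 : r < 1
      · have h2 : r • (w : E) ∈ Metric.ball (0 : E) 1 := by simpa [norm_smul, hw, abs_of_pos hr]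
        rw [indicator_of_mem h2, indicator_of_mem (show r ∈ Iio 1 from h1)]
        simp [norm_smul, hw, abs_of_pos hr, smul_smul, hr.ne']
      · have h2 : r • (w : E) ∉ Metric.ball (0 : E) 1 := by
          simpa [norm_smul, hw, abs_of_pos hr] using h1
        rw [indicator_of_notMem h2, indicator_of_notMem (show r ∉ Iio 1 from h1)]
        simp
    rw [setLIntegral_congr_fun measurableSet_Ioi this, lintegral_mul_const, lintegral_Ioi_pow_indicator]
    · congr 1
      rw [← ENNReal.ofReal_natCast, ← ENNReal.ofReal_inv_of_pos (by exact_mod_cast hd)]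
      congr 1
      rw [one_div, Nat.cast_pred hd]; simp
    · exact Measurable.mul (by fun_prop) (measurable_one.indicator measurableSet_Iio)
  simp_rw [this]
  rw [lintegral_const_mul _ (by fun_prop), ← mul_assoc, ENNReal.mul_inv_cancel, one_mul]
  · exact_mod_cast hd.ne'
  · exact ENNReal.natCast_ne_top _

end Sphere

/-! ### Isometry invariance of the surface measure. -/

section Surface

variable {d : ℕ}

instance : IsFiniteMeasure (surfaceMeasure d) := by
  unfold surfaceMeasure; infer_instance

theorem ae_surfaceMeasure_mem_sphere : ∀ᵐ y ∂(surfaceMeasure d), ‖y‖ = 1 := by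
  unfold surfaceMeasure
  rw [ae_map_iff (by fun_prop) (measurableSet_eq_fun (by fun_prop) (by fun_prop))]
  exact .of_forall fun y => by simp

theorem lintegral_surfaceMeasure [NeZero d] {h : Euc d → ℝ≥0∞} (hh : Measurable h) :
    ∫⁻ y, h y ∂(surfaceMeasure d) =
      d * ∫⁻ x in Metric.ball (0 : Euc d) 1, h (‖x‖⁻¹ • x) := by
  have : Nontrivial (Euc d) := by
    have : Nonempty (Fin d) := ⟨⟨0, NeZero.pos d⟩⟩
    infer_instance
  rw [surfaceMeasure, lintegral_map hh (by fun_prop), lintegral_toSphere _ hh]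
  simp

theorem map_surfaceMeasure [NeZero d] (O : Euc d ≃ₗᵢ[ℝ] Euc d) :
    (surfaceMeasure d).map O = surfaceMeasure d := by
  refine Measure.ext_of_lintegral _ fun h hh => ?_
  have hO : Measurable O := O.continuous.measurable
  rw [lintegral_map hh hO, lintegral_surfaceMeasure hh, lintegral_surfaceMeasure (h := fun x => h (O x)) (by fun_prop)]
  congr 1
  have := O.measurePreserving.setLIntegral_comp_preimage (s := Metric.ball (0 : Euc d) 1)
    measurableSet_ball (f := fun x => h (‖x‖⁻¹ • x)) (by fun_prop)
  rw [← this]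
  have h1 : O ⁻¹' Metric.ball 0 1 = Metric.ball 0 1 := by ext x; simp
  rw [h1]
  simp

theorem integral_surfaceMeasure_comp [NeZero d] {F : Type*} [NormedAddCommGroup F] [NormedSpace ℝ F]
    (O : Euc d ≃ₗᵢ[ℝ] Euc d) (g : Euc d → F) :
    ∫ y, g (O y) ∂(surfaceMeasure d) = ∫ y, g y ∂(surfaceMeasure d) := by
  conv_rhs => rw [← map_surfaceMeasure O]
  exact (integral_map_equiv O.toHomeomorph.toMeasurableEquiv g).symm

end Surface

/-! ### Reduction of zonal integrals to one angle. -/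

theorem lintegral_euc_succ {n : ℕ} {g : ℝ × Euc n → ℝ≥0∞} (hg : Measurable g) :
    ∫⁻ x : Euc (n + 1), g (x 0, WithLp.toLp 2 (fun i => x i.succ)) =
      ∫⁻ a : ℝ, ∫⁻ b : Euc n, g (a, b) := by
  have h1 := PiLp.volume_preserving_ofLp (Fin (n + 1))
  have h2 := volume_preserving_piFinSuccAbove (fun _ : Fin (n + 1) => ℝ) 0
  have h3 := (MeasurePreserving.id (volume : Measure ℝ)).prod (PiLp.volume_preserving_toLp (Fin n))
  have := ((h3.comp h2).comp h1).lintegral_comp hg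
  rw [← lintegral_prod _ hg.aemeasurable]
  rw [← Measure.volume_eq_prod] at this ⊢
  rw [← this]
  rfl

/-- Plane polar coordinates a = r cos x, t = r sin x: the half-plane t > 0 is 0 < x < π, the
Jacobian raises r^n to r^(n+1), and integrating that over (0, 1) gives 1/(n + 2). -/
theorem lintegral_halfPlane_polar {n : ℕ} {H : ℝ → ℝ≥0∞} (hH : Measurable H) :
    ∫⁻ a : ℝ, ∫⁻ t in Ioi (0 : ℝ), ENNReal.ofReal (t ^ n) *
        ((Iio (1 : ℝ)).indicator 1 (√(a ^ 2 + t ^ 2)) * H (a / √(a ^ 2 + t ^ 2))) =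
      ENNReal.ofReal (1 / (n + 2)) *
        ∫⁻ x in Ioo 0 Real.pi, ENNReal.ofReal (Real.sin x ^ n) * H (Real.cos x) := by
  have hI : Measurable ((Iio (1 : ℝ)).indicator (1 : ℝ → ℝ≥0∞)) :=
    measurable_one.indicator measurableSet_Iio
  set F : ℝ × ℝ → ℝ≥0∞ := fun p => (Ioi (0 : ℝ)).indicator (fun t => ENNReal.ofReal (t ^ n) *
        ((Iio (1 : ℝ)).indicator 1 (√(p.1 ^ 2 + t ^ 2)) * H (p.1 / √(p.1 ^ 2 + t ^ 2)))) p.2 with hF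
  have hFm : Measurable F := by
    have : F = (univ ×ˢ Ioi (0 : ℝ)).indicator (fun p => ENNReal.ofReal (p.2 ^ n) *
        ((Iio (1 : ℝ)).indicator 1 (√(p.1 ^ 2 + p.2 ^ 2)) * H (p.1 / √(p.1 ^ 2 + p.2 ^ 2)))) := by
      ext p; simp [hF, indicator]
    rw [this]
    exact Measurable.indicator (by fun_prop) (MeasurableSet.univ.prod measurableSet_Ioi)
  have h1 : ∀ a : ℝ, ∫⁻ t in Ioi (0 : ℝ), ENNReal.ofReal (t ^ n) *
        ((Iio (1 : ℝ)).indicator 1 (√(a ^ 2 + t ^ 2)) * H (a / √(a ^ 2 + t ^ 2))) =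
      ∫⁻ t, F (a, t) := fun a => by rw [← lintegral_indicator measurableSet_Ioi]
  simp_rw [h1]
  rw [← lintegral_prod _ hFm.aemeasurable, ← Measure.volume_eq_prod,
    ← lintegral_comp_polarCoord_symm]
  have hT : polarCoord.target = Ioi (0 : ℝ) ×ˢ Ioo (-Real.pi) Real.pi := rfl
  have h2 : ∀ p ∈ polarCoord.target, ENNReal.ofReal p.1 • F (polarCoord.symm p) =
      (ENNReal.ofReal (p.1 ^ (n + 1)) * (Iio (1 : ℝ)).indicator 1 p.1) *
      (Ioo 0 Real.pi).indicator
        (fun x => ENNReal.ofReal (Real.sin x ^ n) * H (Real.cos x)) p.2 := by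
    rintro ⟨r, x⟩ hp
    rw [hT] at hp
    obtain ⟨hr : 0 < r, hx : -Real.pi < x ∧ x < Real.pi⟩ := hp
    have e : ∀ x, √((r * Real.cos x) ^ 2 + (r * Real.sin x) ^ 2) = r := fun x => by
      rw [mul_pow, mul_pow, ← mul_add, Real.cos_sq_add_sin_sq, mul_one, Real.sqrt_sq hr.le]
    simp only [hF, polarCoord_symm_apply, smul_eq_mul]
    by_cases h0 : 0 < x
    · have hs : 0 < Real.sin x := Real.sin_pos_of_pos_of_lt_pi h0 hx.2
      rw [indicator_of_mem (show r * Real.sin x ∈ Ioi 0 from mul_pos hr hs),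
        indicator_of_mem (show x ∈ Ioo 0 Real.pi from ⟨h0, hx.2⟩), e,
        mul_div_cancel_left₀ _ hr.ne', pow_succ', ENNReal.ofReal_mul hr.le, mul_pow,
        ENNReal.ofReal_mul (by positivity)]
      ring
    · have hs : Real.sin x ≤ 0 := Real.sin_nonpos_of_nonpos_of_neg_pi_le (not_lt.1 h0) hx.1.le
      rw [indicator_of_notMem (show r * Real.sin x ∉ Ioi 0 from
          not_lt.2 (mul_nonpos_of_nonneg_of_nonpos hr.le hs)),
        indicator_of_notMem (show x ∉ Ioo 0 Real.pi from fun h => h0 h.1)]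
      simp
  rw [setLIntegral_congr_fun polarCoord.open_target.measurableSet h2, hT, Measure.volume_eq_prod,
    ← Measure.prod_restrict]
  rw [lintegral_prod_mul (μ := volume.restrict (Ioi (0 : ℝ)))
    (ν := volume.restrict (Ioo (-Real.pi) Real.pi))
    (f := fun r => ENNReal.ofReal (r ^ (n + 1)) * (Iio (1 : ℝ)).indicator 1 r)
    (by fun_prop) (Measurable.indicator (by fun_prop) measurableSet_Ioo).aemeasurable,
    lintegral_Ioi_pow_indicator, lintegral_indicator measurableSet_Ioo,
    Measure.restrict_restrict measurableSet_Ioo]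
  congr 2
  · push_cast; ring
  · congr 1
    rw [inter_eq_left]
    exact Ioo_subset_Ioo (by linarith [Real.pi_pos]) le_rfl

/-- A reflection takes m to the first basis vector. The ball integral is then radial in the other d
- 1 coordinates, which leaves an integral over a half-disc. Only 0 < c < ∞ matters, because c
cancels from every normalised integral. -/
theorem lintegral_surfaceMeasure_zonal {d : ℕ} (hd : 3 ≤ d) : ∃ c : ℝ≥0∞, c ≠ 0 ∧ c ≠ ⊤ ∧
    ∀ m : Euc d, ‖m‖ = 1 → ∀ H : ℝ → ℝ≥0∞, Measurable H →
    ∫⁻ y, H (inner ℝ y m) ∂(surfaceMeasure d) =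
      c * ∫⁻ x in Ioo 0 Real.pi, ENNReal.ofReal (Real.sin x ^ (d - 2)) * H (Real.cos x) := by
  obtain ⟨k, rfl⟩ : ∃ k, d = k + 3 := ⟨d - 3, by omega⟩
  have hI : Measurable ((Iio (1 : ℝ)).indicator (1 : ℝ → ℝ≥0∞)) :=
    measurable_one.indicator measurableSet_Iio
  set σ := (volume : Measure (Euc (k + 2))).toSphere univ with hσ
  have hσ0 : σ ≠ 0 := by
    rw [hσ, Ne, Measure.measure_univ_eq_zero]; exact Measure.toSphere_ne_zero _
  have hσT : σ ≠ ⊤ := measure_ne_top _ _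
  refine ⟨((k + 3 : ℕ) : ℝ≥0∞) * (σ * ENNReal.ofReal (1 / (((k + 1 : ℕ) : ℝ) + 2))), ?_, ?_, ?_⟩
  · refine mul_ne_zero (by simp) (mul_ne_zero hσ0 ?_)
    simp only [ne_eq, ENNReal.ofReal_eq_zero, not_le]; positivity
  · exact ENNReal.mul_ne_top (ENNReal.natCast_ne_top _) (ENNReal.mul_ne_top hσT ENNReal.ofReal_ne_top)
  intro m hm H hH
  have e1 : ∫⁻ y, H (inner ℝ y m) ∂(surfaceMeasure (k + 3)) =
      ∫⁻ y, H (y 0) ∂(surfaceMeasure (k + 3)) := by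
    set e : Euc (k + 3) := EuclideanSpace.single 0 1
    have he : ‖e‖ = 1 := by simp [e]
    set O := (ℝ ∙ (m - e))ᗮ.reflection
    have hO : O m = e := Submodule.reflection_sub (by rw [hm, he])
    have : ∀ y : Euc (k + 3), inner ℝ y m = (O y) 0 := fun y => by
      rw [← O.inner_map_map y m, hO, EuclideanSpace.inner_single_right]; simp
    simp_rw [this]
    conv_rhs => rw [← map_surfaceMeasure O]
    rw [lintegral_map (by fun_prop) O.continuous.measurable]
  rw [e1, lintegral_surfaceMeasure (h := fun y => H (y 0)) (by fun_prop), mul_assoc]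
  congr 1
  rw [mul_assoc, show k + 3 - 2 = k + 1 by omega, ← lintegral_halfPlane_polar hH, ← lintegral_indicator measurableSet_ball]
  have hn : ∀ x : Euc (k + 3), ‖x‖ = √((x 0) ^ 2 + ‖(WithLp.toLp 2 (fun i => x (Fin.succ i)) : Euc (k + 2))‖ ^ 2) := by
    intro x
    rw [EuclideanSpace.norm_eq, EuclideanSpace.norm_eq, Real.sq_sqrt (by positivity), Fin.sum_univ_succ]
    simp
  set G : ℝ × Euc (k + 2) → ℝ≥0∞ := fun p => (Iio (1 : ℝ)).indicator 1 (√(p.1 ^ 2 + ‖p.2‖ ^ 2)) *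
    H (p.1 / √(p.1 ^ 2 + ‖p.2‖ ^ 2)) with hG
  have e2 : ∀ x : Euc (k + 3), (Metric.ball (0 : Euc (k + 3)) 1).indicator (fun x => H ((‖x‖⁻¹ • x) 0)) x =
      G (x 0, WithLp.toLp 2 (fun i => x i.succ)) := by
    intro x
    simp only [hG]
    rw [← hn]
    by_cases hx : ‖x‖ < 1
    · rw [indicator_of_mem (by simpa using hx), indicator_of_mem (show ‖x‖ ∈ Iio 1 from hx)]
      simp [div_eq_inv_mul]
    · rw [indicator_of_notMem (by simpa using hx), indicator_of_notMem (show ‖x‖ ∉ Iio 1 from hx)]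
      simp
  simp_rw [e2]
  rw [lintegral_euc_succ (by fun_prop)]
  have e3 : ∀ a : ℝ, ∫⁻ b : Euc (k + 2), G (a, b) = σ *
      ∫⁻ t in Ioi (0 : ℝ), ENNReal.ofReal (t ^ (k + 1)) *
        ((Iio (1 : ℝ)).indicator 1 (√(a ^ 2 + t ^ 2)) * H (a / √(a ^ 2 + t ^ 2))) := fun a => by
    have := lintegral_radial (volume : Measure (Euc (k + 2)))
      (g := fun t => (Iio (1 : ℝ)).indicator 1 (√(a ^ 2 + t ^ 2)) * H (a / √(a ^ 2 + t ^ 2)))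
      (by fun_prop)
    rw [this, finrank_euclideanSpace, Fintype.card_fin]
    rfl
  simp_rw [e3]
  rw [lintegral_const_mul' _ _ hσT]

/-! ### Growth of an angular function on its own scale. -/

namespace IsAngular

variable {f : ℝ → ℝ}

theorem eventually_pos (hf : IsAngular f) :
    ∀ᶠ x in atTop, 0 < f x ∧ 0 < score f x ∧ DifferentiableAt ℝ f x := by
  filter_upwards [hf.concentrates.eventually_gt_atTop 0, eventually_gt_atTop 0,
    hf.differentiable] with x h1 h2 h3
  have hs : 0 < score f x := (mul_pos_iff_of_pos_left h2).1 h1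
  refine ⟨lt_of_le_of_ne (hf.nonneg x) fun h => ?_, hs, h3⟩
  simp [score, ← h] at hs

theorem tendsto_sub_div_score (hf : IsAngular f) (S : ℝ) :
    Tendsto (fun x => x - S / score f x) atTop atTop := by
  have h : ∀ᶠ x in atTop, x * (1 / 2) ≤ x - S / score f x := by
    filter_upwards [hf.concentrates.eventually_ge_atTop (2 * S), hf.eventually_pos] with x h1 h2
    have : S / score f x ≤ x * (1 / 2) := by
      rw [div_le_iff₀ h2.2.1]; linarith
    linarith
  exact tendsto_atTop_mono' _ h (tendsto_id.atTop_mul_const (by norm_num))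

theorem eventually_score_close (hf : IsAngular f) (S : ℝ) {ε : ℝ} (hε : 0 < ε) :
    ∀ᶠ x in atTop, ∀ s ∈ Icc 0 S, |score f (x - s / score f x) / score f x - 1| < ε := by
  have := Metric.tendstoUniformlyOn_iff.1 (hf.stable S) ε hε
  filter_upwards [this] with x hx s hs
  have := hx s hs
  rwa [dist_comm, Real.dist_eq] at this

/-- The map t ↦ log f(x - t/g) + t, with g the score at x, has derivative 1 - g_f(x - t/g)/g, which
stability makes uniformly small. The mean value inequality integrates this: f decays like e^{-s} at
distance s/g below x. -/
theorem eventually_log_close (hf : IsAngular f) (S : ℝ) {ε : ℝ} (hε : 0 < ε) :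
    ∀ᶠ x in atTop, ∀ s ∈ Icc 0 S, 0 < f (x - s / score f x) ∧
      |Real.log (f (x - s / score f x)) - Real.log (f x) + s| ≤ ε * s := by
  obtain ⟨x₀, hx₀⟩ := eventually_atTop.1 hf.eventually_pos
  filter_upwards [hf.eventually_score_close S hε,
    (hf.tendsto_sub_div_score S).eventually_ge_atTop x₀, hf.eventually_pos] with x hx hxS hxp s hs
  have hge : ∀ t ∈ Icc 0 s, x₀ ≤ x - t / score f x := fun t ht => by
    refine hxS.trans ?_
    gcongr
    · exact hxp.2.1.le
    · exact ht.2.trans hs.2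
  have hd : ∀ t ∈ Icc 0 s, HasDerivWithinAt
      (fun t => Real.log (f (x - t / score f x)) + t)
      (-(score f (x - t / score f x) / score f x) + 1) (Icc 0 s) t := by
    intro t ht
    have h1 := hx₀ _ (hge t ht)
    have h2 : HasDerivAt (fun t => x - t / score f x) (-(1 / score f x)) t := by
      simpa using ((hasDerivAt_id t).div_const (score f x)).const_sub x
    have h3 := (h1.2.2.hasDerivAt.comp t h2).log h1.1.ne'
    refine (HasDerivAt.congr_deriv (h3.add (hasDerivAt_id t)) ?_).hasDerivWithinAt
    simp only [Function.comp, score]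
    ring
  have hb : ∀ t ∈ Icc 0 s, ‖-(score f (x - t / score f x) / score f x) + 1‖ ≤ ε := fun t ht => by
    rw [Real.norm_eq_abs, neg_add_eq_sub, abs_sub_comm]
    exact (hx t ⟨ht.1, ht.2.trans hs.2⟩).le
  have := (convex_Icc (0 : ℝ) s).norm_image_sub_le_of_norm_hasDerivWithin_le hd hb
    (left_mem_Icc.2 hs.1) (right_mem_Icc.2 hs.1)
  refine ⟨(hx₀ _ (hge s (right_mem_Icc.2 hs.1))).1, ?_⟩
  simp only [Real.norm_eq_abs, sub_zero, zero_div, abs_of_nonneg hs.1, add_zero] at this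
  convert this using 2
  ring

/-- Local exponential decay is chained into decay of every polynomial order, to supply a majorant.
One step down from x, of length 1/g_f(x), shrinks f by a factor of at most e^{-1/2}, while B + (x -
y) g_f(x) is at most q times its value after the step. Since q^N ≤ e^{1/2}, the inequality survives
the step. The induction is on the number of half units of log f between y and x. -/
theorem exists_pow_mul_le_of_ge (hf : IsAngular f) (N : ℕ) : ∃ B > 0, ∃ x₀ > 0, ∀ y ≥ x₀, ∀ x ≥ y,
    (B + (x - y) * score f x) ^ N * f y ≤ (B + 1) ^ N * f x := by
  set q : ℝ := Real.exp (1 / (2 * (N + 1))) with hq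
  have hq1 : 1 < q := Real.one_lt_exp_iff.2 (by positivity)
  have hqN : q ^ N ≤ Real.exp (1 / 2) := by
    rw [hq, ← Real.exp_nat_mul]
    refine Real.exp_le_exp.2 ?_
    rw [mul_one_div, div_le_div_iff₀ (by positivity) (by positivity)]
    linarith
  have hqi : q⁻¹ < 1 := inv_lt_one_of_one_lt₀ hq1
  obtain ⟨x₁, hx₁⟩ := eventually_atTop.1 ((hf.eventually_pos.and
    (hf.eventually_score_close 1 (sub_pos.2 hqi))).and
    (hf.eventually_log_close 1 (ε := 1 / 2) (by norm_num)))
  refine ⟨1 / (q - 1), one_div_pos.2 (sub_pos.2 hq1), max x₁ 1, by positivity, fun y hy => ?_⟩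
  have hy1 : x₁ ≤ y := (le_max_left _ _).trans hy
  set B := 1 / (q - 1) with hB
  have hB0 : 0 < B := one_div_pos.2 (sub_pos.2 hq1)
  -- The step subtracts 1 from (x - y) g_f(x); this choice of B is what absorbs that loss.
  have hBq : q * B = B + 1 := by
    rw [hB]; field_simp [(sub_pos.2 hq1).ne']; ring
  have hyp : 0 < f y := (hx₁ y hy1).1.1.1
  have main : ∀ n : ℕ, ∀ x ≥ y, f x ≤ Real.exp (n / 2) * f y →
      (B + (x - y) * score f x) ^ N * f y ≤ (B + 1) ^ N * f x := by
    intro n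
    induction n with
    | zero =>
      intro x hx hfx
      obtain ⟨⟨⟨p1, p2, -⟩, -⟩, p4⟩ := hx₁ x (hy1.trans hx)
      -- If a full step stayed above y, f would strictly increase between y and x, contrary to f x ≤
      -- f y.
      have hw : (x - y) * score f x ≤ 1 := by
        by_contra! h
        have hyx : y ≤ x - 1 / score f x := by
          rw [le_sub_comm, div_le_iff₀ p2]; exact h.le
        obtain ⟨p5, p6⟩ := p4 1 ⟨zero_le_one, le_rfl⟩
        have h7 : Real.log (f (x - 1 / score f x)) < Real.log (f x) := by
          have := (abs_le.1 p6).2; linarith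
        have h8 := (Real.log_lt_log_iff p5 p1).1 h7
        have h9 := hf.mono hyx
        simp at hfx
        linarith
      have h0 : 0 ≤ (x - y) * score f x := mul_nonneg (sub_nonneg.2 hx) p2.le
      have := hf.mono hx
      gcongr
    | succ n ih =>
      intro x hx hfx
      obtain ⟨⟨⟨p1, p2, -⟩, p3⟩, p4⟩ := hx₁ x (hy1.trans hx)
      have h0 : 0 ≤ (x - y) * score f x := mul_nonneg (sub_nonneg.2 hx) p2.le
      rcases le_or_gt ((x - y) * score f x) 1 with h | h
      · have := hf.mono hx
        gcongr
      have hyx : y ≤ x - 1 / score f x := by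
        rw [le_sub_comm, div_le_iff₀ p2]; exact h.le
      obtain ⟨p5, p6⟩ := p4 1 ⟨zero_le_one, le_rfl⟩
      have h7 : f (x - 1 / score f x) ≤ Real.exp (-(1 / 2)) * f x := by
        rw [← Real.log_le_log_iff p5 (by positivity), Real.log_mul (by positivity) p1.ne',
          Real.log_exp]
        have := (abs_le.1 p6).2; linarith
      have h8 := ih _ hyx (h7.trans (by
        calc _ ≤ Real.exp (-(1 / 2)) * (Real.exp ((n + 1 : ℕ) / 2) * f y) := by gcongr
          _ = _ := by
            rw [← mul_assoc, ← Real.exp_add]; congr 2; push_cast; ring))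
      set x' := x - 1 / score f x
      have h9 : q⁻¹ * score f x ≤ score f x' := by
        have := (abs_lt.1 (p3 1 ⟨zero_le_one, le_rfl⟩)).1
        have h' : q⁻¹ ≤ score f x' / score f x := by linarith
        rwa [le_div_iff₀ p2] at h'
      have h10 : B + (x - y) * score f x ≤ q * (B + (x' - y) * score f x') := by
        have e : (x' - y) * (q⁻¹ * score f x) = q⁻¹ * ((x - y) * score f x - 1) := by
          simp only [x']; field_simp; ring
        have h11 := mul_le_mul_of_nonneg_left h9 (sub_nonneg.2 hyx)
        rw [e] at h11
        have h12 := mul_le_mul_of_nonneg_left h11 (by positivity : 0 ≤ q)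
        rw [mul_inv_cancel_left₀ (by positivity)] at h12
        linarith
      have h13 : 0 ≤ B + (x' - y) * score f x' :=
        nonneg_of_mul_nonneg_right ((by positivity : (0:ℝ) ≤ B + (x - y) * score f x).trans h10)
          (by positivity)
      calc (B + (x - y) * score f x) ^ N * f y
          ≤ (q * (B + (x' - y) * score f x')) ^ N * f y := by gcongr
        _ = q ^ N * ((B + (x' - y) * score f x') ^ N * f y) := by rw [mul_pow]; ring
        _ ≤ Real.exp (1 / 2) * ((B + 1) ^ N * (Real.exp (-(1 / 2)) * f x)) := by
          have := h8.trans (mul_le_mul_of_nonneg_left h7 (by positivity))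
          exact mul_le_mul hqN this (mul_nonneg (pow_nonneg h13 _) hyp.le) (by positivity)
        _ = (Real.exp (1 / 2) * Real.exp (-(1 / 2))) * ((B + 1) ^ N * f x) := by ring
        _ = _ := by rw [← Real.exp_add]; simp
  intro x hx
  obtain ⟨n, hn⟩ := exists_nat_ge (2 * Real.log (f x / f y))
  refine main n x hx ?_
  have hxp : 0 < f x := hyp.trans_le (hf.mono hx)
  rw [← div_le_iff₀ hyp, ← Real.log_le_iff_le_exp (div_pos hxp hyp)]
  linarith

/-- The range w ≤ 2 x g_f(x) reaches down to -x, so it covers the whole sphere, where the argument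
κ⟨y, m⟩ runs over [-κ, κ]. Below the threshold x₀ monotonicity replaces the argument by x₀, at the
price of a factor 4^N. -/
theorem exists_pow_mul_le (hf : IsAngular f) (N : ℕ) : ∃ C > 0, ∀ᶠ x in atTop,
    ∀ w ∈ Icc 0 (2 * (x * score f x)), (1 + w) ^ N * f (x - w / score f x) ≤ C * f x := by
  obtain ⟨B, hB, x₀, hx₀, h⟩ := hf.exists_pow_mul_le_of_ge N
  set M := max 1 (1 / B)
  have hM : 1 ≤ M := le_max_left _ _
  have hMB : 1 ≤ M * B := by
    have : 1 / B * B ≤ M * B := by gcongr; exact le_max_right _ _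
    rwa [one_div_mul_cancel hB.ne'] at this
  refine ⟨M ^ N * (4 ^ N * (B + 1) ^ N), by positivity, ?_⟩
  filter_upwards [eventually_ge_atTop (2 * x₀), hf.eventually_pos] with x hx hxp w hw
  have hs := hxp.2.1
  have h1 : 1 + w ≤ M * (B + w) := by nlinarith [mul_le_mul_of_nonneg_right hM hw.1]
  have h2 : (B + w) ^ N * f (x - w / score f x) ≤ 4 ^ N * (B + 1) ^ N * f x := by
    rcases le_or_gt x₀ (x - w / score f x) with h3 | h3
    · have h4 := h _ h3 x (sub_le_self _ (div_nonneg hw.1 hs.le))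
      rw [sub_sub_cancel, div_mul_cancel₀ _ hs.ne'] at h4
      refine h4.trans ?_
      have : (1 : ℝ) ≤ 4 ^ N := one_le_pow₀ (by norm_num)
      have h5 : 0 ≤ (B + 1) ^ N * f x := by have := hxp.1; positivity
      nlinarith
    · have h4 := h x₀ le_rfl x (by linarith)
      have h5 : B + w ≤ 4 * (B + (x - x₀) * score f x) := by
        have : x * score f x ≤ 2 * ((x - x₀) * score f x) := by nlinarith
        linarith [hw.2]
      have h6 : 0 ≤ B + w := by linarith [hw.1]
      calc (B + w) ^ N * f (x - w / score f x) ≤ (4 * (B + (x - x₀) * score f x)) ^ N * f x₀ := by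
            have := hf.mono h3.le
            have := hf.nonneg (x - w / score f x)
            have := pow_nonneg (h6.trans h5) N
            gcongr
        _ = 4 ^ N * ((B + (x - x₀) * score f x) ^ N * f x₀) := by rw [mul_pow]; ring
        _ ≤ 4 ^ N * ((B + 1) ^ N * f x) := by gcongr
        _ = _ := by ring
  calc (1 + w) ^ N * f (x - w / score f x) ≤ (M * (B + w)) ^ N * f (x - w / score f x) := by
        have := hf.nonneg (x - w / score f x)
        have := hw.1
        gcongr
    _ = M ^ N * ((B + w) ^ N * f (x - w / score f x)) := by rw [mul_pow]; ring
    _ ≤ M ^ N * (4 ^ N * (B + 1) ^ N * f x) := by gcongr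
    _ = _ := by ring

end IsAngular

/-! ### Laplace asymptotics of the angular integrals. -/

theorem integral_surfaceMeasure_zonal {d : ℕ} (hd : 3 ≤ d) : ∃ c : ℝ, 0 < c ∧
    ∀ m : Euc d, ‖m‖ = 1 → ∀ H : ℝ → ℝ, Measurable H → (∀ x, 0 ≤ H x) →
    ∫ y, H (inner ℝ y m) ∂(surfaceMeasure d) =
      c * ∫ x in Ioo 0 Real.pi, Real.sin x ^ (d - 2) * H (Real.cos x) := by
  obtain ⟨c, h0, hT, h⟩ := lintegral_surfaceMeasure_zonal hd
  refine ⟨c.toReal, ENNReal.toReal_pos h0 hT, fun m hm H hH hH0 => ?_⟩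
  rw [integral_eq_lintegral_of_nonneg_ae (.of_forall fun y => hH0 _)
    (hH.comp (by fun_prop)).aestronglyMeasurable,
    h m hm (fun x => ENNReal.ofReal (H x)) (by fun_prop), ENNReal.toReal_mul,
    integral_eq_lintegral_of_nonneg_ae _ (by fun_prop)]
  · congr 2
    refine setLIntegral_congr_fun measurableSet_Ioo fun x hx => ?_
    rw [ENNReal.ofReal_mul (pow_nonneg (Real.sin_pos_of_pos_of_lt_pi hx.1 hx.2).le _)]
  · filter_upwards [ae_restrict_mem measurableSet_Ioo] with x hx
    exact mul_nonneg (pow_nonneg (Real.sin_pos_of_pos_of_lt_pi hx.1 hx.2).le _) (hH0 _)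

/-- The half-angle identity written with `Real.sinc`, so that the limit at angle 0 is plain
continuity. -/
theorem one_sub_cos_eq (x : ℝ) : 1 - Real.cos x = x ^ 2 / 2 * Real.sinc (x / 2) ^ 2 := by
  have h1 : Real.cos x = 1 - 2 * Real.sin (x / 2) ^ 2 := by
    have h2 := Real.cos_two_mul (x / 2)
    have h3 := Real.sin_sq_add_cos_sq (x / 2)
    rw [mul_div_cancel₀ x two_ne_zero] at h2
    linarith
  rcases eq_or_ne x 0 with rfl | hx
  · simp
  · rw [Real.sinc_of_ne_zero (by positivity), h1]; field_simp; ring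

theorem mul_sinc (x : ℝ) : x * Real.sinc x = Real.sin x := by
  rcases eq_or_ne x 0 with rfl | hx
  · simp
  · rw [Real.sinc_of_ne_zero hx]; field_simp

theorem integrable_pow_div_one_add_sq (k : ℕ) (C : ℝ) :
    Integrable fun v : ℝ => (Ioi (0 : ℝ)).indicator (fun v => C * (v ^ k / (1 + v ^ 2) ^ (k + 1))) v := by
  refine Integrable.mono' (g := fun v => |C| * (1 + v ^ 2)⁻¹) (integrable_inv_one_add_sq.const_mul _)
    (Measurable.indicator (by fun_prop) measurableSet_Ioi).aestronglyMeasurable (.of_forall fun v => ?_)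
  by_cases hv : v ∈ Ioi (0 : ℝ)
  · rw [indicator_of_mem hv, norm_mul, Real.norm_eq_abs]
    have hv0 : 0 < v := hv
    gcongr
    rw [Real.norm_eq_abs, abs_of_nonneg (by positivity), pow_succ, div_le_iff₀ (by positivity)]
    have : v ^ k ≤ (1 + v ^ 2) ^ k := by gcongr; nlinarith
    have e : (1 + v ^ 2)⁻¹ * ((1 + v ^ 2) ^ k * (1 + v ^ 2)) = (1 + v ^ 2) ^ k := by
      field_simp
    rwa [e]
  · rw [indicator_of_notMem hv]; simp; positivity

namespace IsAngular

variable {f : ℝ → ℝ}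

theorem tendsto_ratio (hf : IsAngular f) {w : ℝ → ℝ} {w₀ : ℝ} (hw : ∀ x, 0 ≤ w x)
    (h : Tendsto w atTop (𝓝 w₀)) :
    Tendsto (fun x => f (x - w x / score f x) / f x) atTop (𝓝 (Real.exp (-w₀))) := by
  have hw₀ : 0 ≤ w₀ := ge_of_tendsto' h hw
  have h1 : ∀ᶠ x in atTop, w x < w₀ + 1 := h.eventually_lt_const (by linarith)
  have h2 : Tendsto (fun x => Real.log (f (x - w x / score f x)) - Real.log (f x) + w x)
      atTop (𝓝 0) := by
    rw [Metric.tendsto_nhds]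
    intro ε hε
    have hε' : 0 < ε / (2 * (w₀ + 1)) := by positivity
    filter_upwards [hf.eventually_log_close (w₀ + 1) hε', h1] with x hx hx1
    have := (hx (w x) ⟨hw x, hx1.le⟩).2
    rw [dist_zero_right, Real.norm_eq_abs]
    refine this.trans_lt ?_
    calc ε / (2 * (w₀ + 1)) * w x ≤ ε / (2 * (w₀ + 1)) * (w₀ + 1) := by gcongr
      _ = ε / 2 := by field_simp
      _ < ε := by linarith
  have h3 := (Real.continuous_exp.tendsto _).comp (h2.sub h)
  rw [zero_sub] at h3
  refine h3.congr' ?_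
  filter_upwards [hf.eventually_log_close (w₀ + 1) one_pos, h1, hf.eventually_pos] with x hx hx1 hx2
  have := (hx (w x) ⟨hw x, hx1.le⟩).1
  simp only [Function.comp, add_sub_cancel_right]
  rw [Real.exp_sub, Real.exp_log this, Real.exp_log hx2.1]

/-- Laplace's method: after the substitution x = v/√(κ g_f(κ)), the exponent κ g_f(κ)(1 - cos x)
tends to v²/2 and the ratio f(κ cos x)/f(κ) to e^{-v²/2}. The tail bound with N = k + 1 dominates
the integrand by a multiple of v^k/(1 + v²)^(k+1). -/
theorem tendsto_laplace_angle (hf : IsAngular f) (k : ℕ) {η : ℝ} (hη : 0 ≤ η) :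
    Tendsto (fun κ => √(κ * score f κ) ^ (k + 1) / f κ * ∫ x in Ioo 0 Real.pi, Real.sin x ^ k *
        (Real.exp (-η * (κ * score f κ * (1 - Real.cos x))) * f (κ * Real.cos x))) atTop
      (𝓝 (∫ v in Ioi (0 : ℝ), v ^ k * Real.exp (-(1 + η) * (v ^ 2 / 2)))) := by
  obtain ⟨C, hC, hCb⟩ := hf.exists_pow_mul_le (k + 1)
  have hfm := hf.mono.measurable
  set R : ℝ → ℝ := fun κ => √(κ * score f κ) with hR
  set w : ℝ → ℝ → ℝ := fun v κ => v ^ 2 / 2 * Real.sinc (v / R κ / 2) ^ 2 with hw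
  set Φ : ℝ → ℝ → ℝ := fun κ v => (Ioo 0 Real.pi).indicator (fun x => (R κ * Real.sin x) ^ k *
        (Real.exp (-η * (R κ ^ 2 * (1 - Real.cos x))) * (f (κ * Real.cos x) / f κ))) (v / R κ) with hΦ
  have hpos : ∀ᶠ κ in atTop, 0 < κ ∧ 0 < f κ ∧ 0 < score f κ ∧ 0 < R κ ∧ R κ ^ 2 = κ * score f κ := by
    filter_upwards [eventually_gt_atTop 0, hf.eventually_pos] with κ h1 h2
    have : 0 < κ * score f κ := mul_pos h1 h2.2.1
    exact ⟨h1, h2.1, h2.2.1, Real.sqrt_pos.2 this, Real.sq_sqrt this.le⟩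
  have hRtop : Tendsto R atTop atTop := Real.tendsto_sqrt_atTop.comp hf.concentrates
  have hlim : ∀ v : ℝ, Tendsto (fun κ => v / R κ) atTop (𝓝 0) := fun v =>
    tendsto_const_nhds.div_atTop hRtop
  have hsinc : ∀ v : ℝ, Tendsto (fun κ => Real.sinc (v / R κ)) atTop (𝓝 1) := fun v => by
    have := (Real.continuous_sinc.tendsto 0).comp (hlim v)
    rwa [Real.sinc_zero] at this
  have hwlim : ∀ v, Tendsto (w v) atTop (𝓝 (v ^ 2 / 2)) := fun v => by
    have h1 : Tendsto (fun κ => Real.sinc (v / R κ / 2)) atTop (𝓝 1) := by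
      refine (hsinc (v / 2)).congr fun κ => ?_
      rw [div_right_comm]
    simpa using (h1.pow 2).const_mul (v ^ 2 / 2)
  have hweq : ∀ κ, 0 < κ ∧ 0 < f κ ∧ 0 < score f κ ∧ 0 < R κ ∧ R κ ^ 2 = κ * score f κ → ∀ v,
      R κ ^ 2 * (1 - Real.cos (v / R κ)) = w v κ ∧
        κ * Real.cos (v / R κ) = κ - w v κ / score f κ := by
    intro κ hκ v
    have e1 : R κ ^ 2 * (1 - Real.cos (v / R κ)) = w v κ := by
      rw [one_sub_cos_eq]; simp only [hw]; have := hκ.2.2.2.1.ne'; field_simp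
    refine ⟨e1, ?_⟩
    rw [← e1, hκ.2.2.2.2]
    have := hκ.2.2.1.ne'
    field_simp
    ring
  have key : ∀ᶠ κ in atTop, R κ ^ (k + 1) / f κ * ∫ x in Ioo 0 Real.pi, Real.sin x ^ k *
        (Real.exp (-η * (κ * score f κ * (1 - Real.cos x))) * f (κ * Real.cos x)) = ∫ v, Φ κ v := by
    filter_upwards [hpos] with κ hκ
    rw [hΦ, Measure.integral_comp_div (fun x => (Ioo 0 Real.pi).indicator
      (fun x => (R κ * Real.sin x) ^ k *
        (Real.exp (-η * (R κ ^ 2 * (1 - Real.cos x))) * (f (κ * Real.cos x) / f κ))) x),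
      integral_indicator measurableSet_Ioo, abs_of_pos hκ.2.2.2.1, smul_eq_mul,
      ← integral_const_mul, ← integral_const_mul]
    congr 1
    ext x
    rw [hκ.2.2.2.2]
    rw [mul_pow, pow_succ]
    ring
  refine Tendsto.congr' (key.mono fun κ h => h.symm) ?_
  rw [← integral_indicator measurableSet_Ioi]
  refine tendsto_integral_filter_of_dominated_convergence
    ((Ioi (0 : ℝ)).indicator (fun v => (C * (Real.pi ^ 2 / 2) ^ (k + 1)) * (v ^ k / (1 + v ^ 2) ^ (k + 1))))
    ?_ ?_ ?_ ?_
  · refine .of_forall fun κ => Measurable.aestronglyMeasurable ?_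
    exact (Measurable.indicator (by fun_prop) measurableSet_Ioo).comp (measurable_id.div_const _)
  · filter_upwards [hpos, hCb] with κ hκ hb
    refine .of_forall fun v => ?_
    have hR0 := hκ.2.2.2.1
    by_cases hv : v / R κ ∈ Ioo 0 Real.pi
    · have hv0 : 0 < v := by have := hv.1; rwa [lt_div_iff₀ hR0, zero_mul] at this
      simp only [hΦ]
      rw [indicator_of_mem hv, indicator_of_mem (show v ∈ Ioi 0 from hv0)]
      have hs := Real.sin_pos_of_pos_of_lt_pi hv.1 hv.2
      have hs2 : R κ * Real.sin (v / R κ) ≤ v := by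
        calc _ ≤ R κ * (v / R κ) := by gcongr; exact Real.sin_le hv.1.le
          _ = v := by field_simp
      obtain ⟨e1, e2⟩ := hweq κ hκ v
      -- The bound 1 - cos x ≥ 2x²/π² on the whole of |x| ≤ π turns polynomial decay in w into decay
      -- in v, uniformly in κ.
      have hcos : 2 / Real.pi ^ 2 * v ^ 2 ≤ w v κ := by
        have := Real.cos_le_one_sub_mul_cos_sq (x := v / R κ) (by rw [abs_of_pos hv.1]; exact hv.2.le)
        have h3 : R κ ^ 2 * (2 / Real.pi ^ 2 * (v / R κ) ^ 2) ≤ w v κ := by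
          rw [← e1]; gcongr; linarith
        calc _ = R κ ^ 2 * (2 / Real.pi ^ 2 * (v / R κ) ^ 2) := by field_simp
          _ ≤ _ := h3
      have hw0 : 0 ≤ w v κ := by positivity
      have hw2 : w v κ ≤ 2 * (κ * score f κ) := by
        rw [← e1, ← hκ.2.2.2.2]
        nlinarith [Real.neg_one_le_cos (v / R κ), sq_nonneg (R κ)]
      rw [e1, e2]
      have hfr : f (κ - w v κ / score f κ) / f κ ≤ C / (1 + w v κ) ^ (k + 1) := by
        rw [div_le_div_iff₀ hκ.2.1 (by positivity), mul_comm]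
        exact hb _ ⟨hw0, hw2⟩
      have hexp : Real.exp (-η * w v κ) ≤ 1 := by
        rw [Real.exp_le_one_iff]; nlinarith [mul_nonneg hη hw0]
      have hf0 : 0 ≤ f (κ - w v κ / score f κ) / f κ := div_nonneg (hf.nonneg _) hκ.2.1.le
      have hpi : 2 / Real.pi ^ 2 ≤ 1 := by
        rw [div_le_one (by positivity)]; nlinarith [Real.pi_gt_three]
      have hlow : 2 / Real.pi ^ 2 * (1 + v ^ 2) ≤ 1 + w v κ := by linarith
      rw [Real.norm_eq_abs, abs_of_nonneg (by positivity)]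
      calc _ ≤ v ^ k * (1 * (C / (1 + w v κ) ^ (k + 1))) := by gcongr
        _ ≤ v ^ k * (1 * (C / (2 / Real.pi ^ 2 * (1 + v ^ 2)) ^ (k + 1))) := by gcongr
        _ = _ := by rw [mul_pow, div_pow, div_pow]; field_simp
    · simp only [hΦ]
      rw [indicator_of_notMem hv, norm_zero]
      exact indicator_nonneg (fun v hv => by have : 0 < v := hv; positivity) _
  · exact integrable_pow_div_one_add_sq k _
  · refine .of_forall fun v => ?_
    by_cases hv : 0 < v
    · rw [indicator_of_mem (show v ∈ Ioi 0 from hv)]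
      have h1 : Tendsto (fun κ => (v * Real.sinc (v / R κ)) ^ k * (Real.exp (-η * w v κ) *
          (f (κ - w v κ / score f κ) / f κ))) atTop
          (𝓝 ((v * 1) ^ k * (Real.exp (-η * (v ^ 2 / 2)) * Real.exp (-(v ^ 2 / 2))))) :=
        ((hsinc v).const_mul v |>.pow k).mul
          (((Real.continuous_exp.tendsto _).comp ((hwlim v).const_mul (-η))).mul
            (hf.tendsto_ratio (fun κ => by positivity) (hwlim v)))
      rw [mul_one, ← Real.exp_add] at h1
      rw [show -(1 + η) * (v ^ 2 / 2) = -η * (v ^ 2 / 2) + -(v ^ 2 / 2) by ring]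
      refine h1.congr' ?_
      filter_upwards [hpos, (hlim v).eventually_lt_const Real.pi_pos] with κ hκ hlt
      obtain ⟨e1, e2⟩ := hweq κ hκ v
      simp only [hΦ]
      rw [indicator_of_mem (show v / R κ ∈ Ioo 0 Real.pi from ⟨div_pos hv hκ.2.2.2.1, hlt⟩),
        e1, e2, ← mul_sinc]
      have := hκ.2.2.2.1.ne'
      congr 2
      field_simp
    · rw [indicator_of_notMem (show v ∉ Ioi 0 from hv)]
      refine tendsto_const_nhds.congr' ?_
      filter_upwards [hpos] with κ hκ
      simp only [hΦ]
      rw [indicator_of_notMem]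
      intro h
      exact hv (by have := h.1; rwa [lt_div_iff₀ hκ.2.2.2.1, zero_mul] at this)

end IsAngular

/-- Scaling v by √(1 + η). The form 1 + 0 on the right is the η = 0 instance, the limit of the
normalising integral, so the quotient of the two limits is a power of √(1 + η). -/
theorem integral_pow_mul_exp_scale (k : ℕ) {η : ℝ} (hη : 0 ≤ η) :
    ∫ v in Ioi (0 : ℝ), v ^ k * Real.exp (-(1 + η) * (v ^ 2 / 2)) =
      (√(1 + η) ^ (k + 1))⁻¹ * ∫ v in Ioi (0 : ℝ), v ^ k * Real.exp (-(1 + 0) * (v ^ 2 / 2)) := by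
  have hs : 0 < √(1 + η) := Real.sqrt_pos.2 (by linarith)
  have h := integral_comp_mul_left_Ioi (fun v : ℝ => v ^ k * Real.exp (-(1 + 0) * (v ^ 2 / 2))) 0 hs
  rw [mul_zero, smul_eq_mul] at h
  have h2 : ∀ v : ℝ, (√(1 + η) * v) ^ k * Real.exp (-(1 + 0) * ((√(1 + η) * v) ^ 2 / 2)) =
      √(1 + η) ^ k * (v ^ k * Real.exp (-(1 + η) * (v ^ 2 / 2))) := fun v => by
    rw [mul_pow, mul_pow _ _ 2, Real.sq_sqrt (by linarith), mul_assoc]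
    congr 3; ring
  simp_rw [h2] at h
  rw [integral_const_mul] at h
  rw [pow_succ, mul_inv, mul_assoc, ← h, inv_mul_cancel_left₀ (by positivity)]

theorem integral_pow_mul_exp_pos (k : ℕ) :
    0 < ∫ v in Ioi (0 : ℝ), v ^ k * Real.exp (-(1 + 0) * (v ^ 2 / 2)) := by
  have hint : IntegrableOn (fun v : ℝ => v ^ k * Real.exp (-(1 + 0) * (v ^ 2 / 2))) (Ioi 0) := by
    have := integrableOn_rpow_mul_exp_neg_mul_sq (b := 1 / 2) (by norm_num) (s := k)
      (by have : (0 : ℝ) ≤ k := by positivity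
          linarith)
    refine this.congr_fun (fun v hv => ?_) measurableSet_Ioi
    simp only [Real.rpow_natCast]
    congr 2; ring
  refine (setIntegral_pos_iff_support_of_nonneg_ae ?_ hint).2 ?_
  · filter_upwards [ae_restrict_mem measurableSet_Ioi] with v hv
    have : 0 < v := hv
    positivity
  · have : Function.support (fun v : ℝ => v ^ k * Real.exp (-(1 + 0) * (v ^ 2 / 2))) ∩ Ioi 0 = Ioi 0 := by
      rw [inter_eq_right]
      intro v hv
      have : 0 < v := hv
      simp only [Function.mem_support]; positivity
    rw [this]; simp

/-- The angular Laplace transform converges to that of the Gamma law of shape `(d - 1) / 2`. -/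
theorem IsAngular.tendsto_laplace {f : ℝ → ℝ} (hf : IsAngular f) {d : ℕ} (hd : 3 ≤ d)
    {m : Euc d} (hm : ‖m‖ = 1) {η : ℝ} (hη : 0 ≤ η) :
    Tendsto (fun κ => (∫ y, Real.exp (-η * (κ * score f κ * (1 - inner ℝ y m))) *
        f (κ * inner ℝ y m) ∂(surfaceMeasure d)) / ∫ y, f (κ * inner ℝ y m) ∂(surfaceMeasure d))
      atTop (𝓝 ((√(1 + η) ^ (d - 1))⁻¹)) := by
  obtain ⟨k, rfl⟩ : ∃ k, d = k + 2 := ⟨d - 2, by omega⟩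
  obtain ⟨c, hc, h⟩ := integral_surfaceMeasure_zonal hd
  have hfm := hf.mono.measurable
  have h1 := hf.tendsto_laplace_angle k hη
  have h0 := hf.tendsto_laplace_angle k le_rfl
  have hA := integral_pow_mul_exp_pos k
  have h2 := h1.div h0 hA.ne'
  rw [integral_pow_mul_exp_scale k hη, mul_div_cancel_right₀ _ hA.ne'] at h2
  refine h2.congr' ?_
  filter_upwards [eventually_gt_atTop 0, hf.eventually_pos] with κ h3 h4
  have h5 : 0 < κ * score f κ := mul_pos h3 h4.2.1
  have e1 := h m hm (fun t => Real.exp (-η * (κ * score f κ * (1 - t))) * f (κ * t)) (by fun_prop)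
    (fun t => mul_nonneg (Real.exp_nonneg _) (hf.nonneg _))
  have e2 := h m hm (fun t => f (κ * t)) (by fun_prop) (fun t => hf.nonneg _)
  have h6 : √(κ * score f κ) ^ (k + 1) / f κ ≠ 0 :=
    div_ne_zero (pow_ne_zero _ (Real.sqrt_pos.2 h5).ne') h4.1.ne'
  rw [e1, e2, Pi.div_apply, mul_div_mul_left _ _ h6, mul_div_mul_left _ _ hc.ne']
  simp

/-- The normalised transform at η = 0 tends to 1, whereas a vanishing denominator would make the
quotient 0 by convention. -/
theorem IsAngular.eventually_integral_pos {f : ℝ → ℝ} (hf : IsAngular f) {d : ℕ} (hd : 3 ≤ d)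
    {m : Euc d} (hm : ‖m‖ = 1) :
    ∀ᶠ κ in atTop, 0 < ∫ y, f (κ * inner ℝ y m) ∂(surfaceMeasure d) := by
  have h := hf.tendsto_laplace hd hm le_rfl
  have : (0 : ℝ) < (√(1 + 0) ^ (d - 1))⁻¹ := by simp
  filter_upwards [h.eventually_const_lt this] with κ hκ
  refine lt_of_le_of_ne (integral_nonneg fun y => hf.nonneg _) fun h0 => ?_
  rw [← h0] at hκ
  simp at hκ

/-! ### The angular laws and their rotational equivariance. -/

/-- The law on `S^{d-1}` with density `c_{d,κ,f} f(κ yᵀ m)`. -/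
noncomputable def angularLaw {d : ℕ} (f : ℝ → ℝ) (κ : ℝ) (m : Euc d) : Measure (Euc d) :=
  (surfaceMeasure d).withDensity fun y => ENNReal.ofReal (angularDensity f κ m y)

section AngularLaw

variable {d : ℕ} {f : ℝ → ℝ} {κ : ℝ} {m : Euc d}

theorem ae_angularLaw_norm : ∀ᵐ y ∂(angularLaw f κ m), ‖y‖ = 1 :=
  (withDensity_absolutelyContinuous _ _).ae_le ae_surfaceMeasure_mem_sphere

theorem measurable_angularDensity (hf : Monotone f) : Measurable (angularDensity f κ m) := by
  unfold angularDensity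
  have := hf.measurable
  fun_prop

theorem angularDensity_nonneg (hf0 : ∀ x, 0 ≤ f x) (y : Euc d) : 0 ≤ angularDensity f κ m y :=
  div_nonneg (hf0 _) (integral_nonneg fun _ => hf0 _)

theorem integral_angularLaw (hf0 : ∀ x, 0 ≤ f x) (hf : Monotone f) {F : Type*}
    [NormedAddCommGroup F] [NormedSpace ℝ F] (g : Euc d → F) :
    ∫ y, g y ∂(angularLaw f κ m) = ∫ y, angularDensity f κ m y • g y ∂(surfaceMeasure d) := by
  have hm : Measurable (angularDensity f κ m) := measurable_angularDensity hf
  rw [angularLaw, integral_withDensity_eq_integral_toReal_smul (by fun_prop) (by simp)]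
  simp_rw [ENNReal.toReal_ofReal (angularDensity_nonneg hf0 _)]

theorem integral_angularLaw_real (hf0 : ∀ x, 0 ≤ f x) (hf : Monotone f) (g : Euc d → ℝ) :
    ∫ y, g y ∂(angularLaw f κ m) =
      (∫ y, g y * f (κ * inner ℝ y m) ∂(surfaceMeasure d)) /
        ∫ y, f (κ * inner ℝ y m) ∂(surfaceMeasure d) := by
  rw [integral_angularLaw hf0 hf, ← integral_div]
  refine integral_congr_ae (.of_forall fun y => ?_)
  simp only [angularDensity, smul_eq_mul]
  ring

theorem isProbabilityMeasure_angularLaw (hf0 : ∀ x, 0 ≤ f x)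
    (h : 0 < ∫ y, f (κ * inner ℝ y m) ∂(surfaceMeasure d)) :
    IsProbabilityMeasure (angularLaw f κ m) := by
  have hint : Integrable (fun y => f (κ * inner ℝ y m)) (surfaceMeasure d) := by
    by_contra hi
    rw [integral_undef hi] at h
    exact lt_irrefl _ h
  have hint' : Integrable (angularDensity f κ m) (surfaceMeasure d) := hint.div_const _
  constructor
  rw [angularLaw, withDensity_apply _ .univ, Measure.restrict_univ,
    ← ofReal_integral_eq_lintegral_ofReal hint'
      (.of_forall fun y => angularDensity_nonneg hf0 y)]
  simp only [angularDensity]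
  rw [integral_div, div_self h.ne', ENNReal.ofReal_one]

theorem integral_comp_inner_isometry [NeZero d] (O : Euc d ≃ₗᵢ[ℝ] Euc d) :
    ∫ y, f (κ * inner ℝ y (O m)) ∂(surfaceMeasure d) =
      ∫ y, f (κ * inner ℝ y m) ∂(surfaceMeasure d) := by
  rw [← integral_surfaceMeasure_comp O fun y => f (κ * inner ℝ y (O m))]
  simp

theorem integral_angularLaw_isometry [NeZero d] (hf0 : ∀ x, 0 ≤ f x) (hf : Monotone f) {F : Type*}
    [NormedAddCommGroup F] [NormedSpace ℝ F] (O : Euc d ≃ₗᵢ[ℝ] Euc d) (g : Euc d → F) :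
    ∫ y, g y ∂(angularLaw f κ (O m)) = ∫ y, g (O y) ∂(angularLaw f κ m) := by
  rw [integral_angularLaw hf0 hf, integral_angularLaw hf0 hf,
    ← integral_surfaceMeasure_comp O fun y => angularDensity f κ (O m) y • g y]
  simp only [angularDensity, integral_comp_inner_isometry, LinearIsometryEquiv.inner_map_map]

/-- Reflection in the hyperplane orthogonal to v - w. That it fixes everything orthogonal to both
vectors allows tangent directions at a point of the sphere to be exchanged while the point stays
put. -/
theorem exists_isometry_map {v w : Euc d} (h : ‖v‖ = ‖w‖) :
    ∃ O : Euc d ≃ₗᵢ[ℝ] Euc d, O v = w ∧ ∀ m, inner ℝ m v = 0 → inner ℝ m w = 0 → O m = m := by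
  refine ⟨(ℝ ∙ (v - w))ᗮ.reflection, Submodule.reflection_sub h, fun m h1 h2 => ?_⟩
  refine Submodule.reflection_mem_subspace_eq_self ?_
  rw [Submodule.mem_orthogonal_singleton_iff_inner_left, inner_sub_right, h1, h2, sub_zero]

theorem integrable_angularLaw [IsProbabilityMeasure (angularLaw f κ m)] {F : Type*}
    [NormedAddCommGroup F] {g : Euc d → F} (hg : Continuous g) :
    Integrable g (angularLaw f κ m) := by
  obtain ⟨C, hC⟩ := (isCompact_sphere (0 : Euc d) 1).exists_bound_of_continuousOn hg.continuousOn
  refine Integrable.of_bound hg.aestronglyMeasurable C ?_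
  filter_upwards [ae_angularLaw_norm] with y hy
  exact hC y (by simpa using hy)

end AngularLaw

theorem norm_sub_smul_sq {d : ℕ} {y m : Euc d} (hy : ‖y‖ = 1) (hm : ‖m‖ = 1) (ρ : ℝ) :
    ‖y - ρ • m‖ ^ 2 = (1 - ρ) ^ 2 + 2 * ρ * (1 - inner ℝ y m) := by
  rw [norm_sub_sq_real, inner_smul_right, norm_smul, hy, hm, Real.norm_eq_abs, mul_one, sq_abs]
  ring

/-! ### The tuning constant in terms of the Gamma parameter α. -/

section Tuning

/-- With α = (1 - δ)^{-2/(d-1)} - 1 one gets K - 2 = 2/α and K + 2 = (2/α)(1 + 2α). The two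
exponents add up to 1, so a single factor 2/α survives. -/
theorem tuningK_eq {d : ℕ} (hd : 3 ≤ d) {δ : ℝ} (hδ : δ ∈ Ioo (0 : ℝ) 1) :
    ∃ α : ℝ, 0 < α ∧ 1 - δ = (√(1 + α) ^ (d - 1))⁻¹ ∧
      (tuningK d δ - 2) ^ (-((d : ℝ) - 1) / 2) * (tuningK d δ + 2) ^ (((d : ℝ) + 1) / 2) =
        2 / α * √(1 + 2 * α) ^ (d + 1) := by
  have hd' : (0 : ℝ) < d - 1 := by
    have : (3 : ℝ) ≤ d := by exact_mod_cast hd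
    linarith
  have h0 : 0 < 1 - δ := by linarith [hδ.2]
  set t := (1 - δ) ^ ((2 : ℝ) / ((d : ℝ) - 1)) with ht
  have ht0 : 0 < t := Real.rpow_pos_of_pos h0 _
  have ht1 : t < 1 := Real.rpow_lt_one h0.le (by linarith [hδ.1]) (by positivity)
  refine ⟨t⁻¹ - 1, by rw [sub_pos]; exact (one_lt_inv₀ ht0).2 ht1, ?_, ?_⟩
  · rw [add_sub_cancel, Real.sqrt_inv, inv_pow, inv_inv, Real.sqrt_eq_rpow, ht,
      ← Real.rpow_mul h0.le, ← Real.rpow_natCast, ← Real.rpow_mul h0.le,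
      Nat.cast_sub (by omega), Nat.cast_one]
    rw [show 2 / ((d : ℝ) - 1) * (1 / 2) * (d - 1) = 1 by field_simp, Real.rpow_one]
  · set α := t⁻¹ - 1 with hα
    have hα0 : 0 < α := by rw [hα, sub_pos]; exact (one_lt_inv₀ ht0).2 ht1
    have htα : t = (1 + α)⁻¹ := by rw [hα]; simp
    have e1 : tuningK d δ - 2 = 2 / α := by
      rw [tuningK, ← ht, htα]
      have h1 : (1 + α) ≠ 0 := by positivity
      have : 1 - (1 + α)⁻¹ = α / (1 + α) := by field_simp; ring
      rw [this]; field_simp; ring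
    have e2 : tuningK d δ + 2 = 2 / α * (1 + 2 * α) := by
      have : tuningK d δ = 2 / α + 2 := by linarith
      rw [this]; field_simp; ring
    have hp : 0 < 2 / α := by positivity
    rw [e1, e2, Real.mul_rpow hp.le (by positivity), ← mul_assoc, ← Real.rpow_add hp,
      show -((d : ℝ) - 1) / 2 + ((d : ℝ) + 1) / 2 = 1 by ring, Real.rpow_one, Real.sqrt_eq_rpow,
      ← Real.rpow_natCast, ← Real.rpow_mul (by positivity)]
    congr 2
    push_cast; ring

end Tuning

/-! ### Elementary estimates for the limiting Laplace transform. -/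

section LaplaceLimit

/-- The Laplace transform of the Gamma law of shape `(d - 1) / 2`. -/
noncomputable def gammaLaplace (d : ℕ) (η : ℝ) : ℝ := (√(1 + η) ^ (d - 1))⁻¹

theorem gammaLaplace_pos (d : ℕ) {η : ℝ} (hη : 0 ≤ η) : 0 < gammaLaplace d η := by
  unfold gammaLaplace
  have := Real.sqrt_pos.2 (show 0 < 1 + η by linarith)
  positivity

theorem gammaLaplace_strictAnti {d : ℕ} (hd : 3 ≤ d) {η η' : ℝ} (hη : 0 ≤ η) (h : η < η') :
    gammaLaplace d η' < gammaLaplace d η := by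
  unfold gammaLaplace
  have h1 := Real.sqrt_pos.2 (show 0 < 1 + η by linarith)
  have h2 : √(1 + η) < √(1 + η') := Real.sqrt_lt_sqrt (by linarith) (by linarith)
  exact inv_strictAnti₀ (by positivity) (pow_lt_pow_left₀ h2 h1.le (by omega))

theorem exists_gammaLaplace_gt (d : ℕ) {c : ℝ} (hc : c < 1) : ∃ η > 0, c < gammaLaplace d η := by
  have h : ContinuousAt (gammaLaplace d) 0 := by
    unfold gammaLaplace
    refine ContinuousAt.inv₀ (by fun_prop) (by simp)
  have h0 : c < gammaLaplace d 0 := by simpa [gammaLaplace] using hc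
  obtain ⟨η, h1, h2⟩ := (((h.eventually_const_lt h0).filter_mono nhdsWithin_le_nhds).and
    (self_mem_nhdsWithin : Ioi (0 : ℝ) ∈ 𝓝[>] 0)).exists
  exact ⟨η, h2, h1⟩

/-- A secant in place of minus the derivative, so that only pointwise convergence of the transforms
is needed later. The second node is 1 + 2η because 1 + (1 + 2η) = 2(1 + η), which makes both values
powers of √(1 + η) up to a factor depending on d. -/
theorem gammaLaplace_sub_ge {d : ℕ} (hd : 3 ≤ d) {η : ℝ} (hη : 0 ≤ η) :
    (√(1 + η) ^ (d + 1))⁻¹ ≤ 2 * (gammaLaplace d η - gammaLaplace d (1 + 2 * η)) / (1 + η) := by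
  have hp : 0 < 1 + η := by linarith
  have h1 := Real.sqrt_pos.2 hp
  have e : √(1 + (1 + 2 * η)) = √2 * √(1 + η) := by
    rw [← Real.sqrt_mul (by norm_num)]; congr 1; ring
  have h2 : 2 ≤ √2 ^ (d - 1) := by
    have hs : 1 ≤ √2 := Real.one_le_sqrt.2 (by norm_num)
    calc (2 : ℝ) = √2 ^ 2 := (Real.sq_sqrt (by norm_num)).symm
      _ ≤ √2 ^ (d - 1) := pow_le_pow_right₀ hs (by omega)
  have h3 : (√2 ^ (d - 1))⁻¹ ≤ 1 / 2 := by
    rw [one_div]; exact inv_anti₀ (by norm_num) h2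
  unfold gammaLaplace
  rw [e, mul_pow, mul_inv, show d + 1 = (d - 1) + 2 by omega, pow_add, Real.sq_sqrt hp.le, mul_inv,
    div_eq_mul_inv]
  have h4 : 0 < (√(1 + η) ^ (d - 1))⁻¹ := by positivity
  gcongr
  nlinarith

/-- From 1 + x ≤ e^x. Taking expectations, a difference of Laplace transforms bounds the mean of w
e^{-ηw} from below. -/
theorem exp_neg_sub_exp_neg_le (η η' w : ℝ) :
    Real.exp (-η * w) - Real.exp (-η' * w) ≤ (η' - η) * (w * Real.exp (-η * w)) := by
  have h : Real.exp (-η' * w) = Real.exp (-(η' - η) * w) * Real.exp (-η * w) := by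
    rw [← Real.exp_add]; congr 1; ring
  have h2 := Real.add_one_le_exp (-(η' - η) * w)
  rw [h]
  nlinarith [Real.exp_pos (-η * w)]

theorem sq_mul_exp_neg_le {η w : ℝ} (hη : 0 < η) (hw : 0 ≤ w) :
    w ^ 2 * Real.exp (-η * w) ≤ 4 / η ^ 2 := by
  have h1 : η * w / 2 ≤ Real.exp (η * w / 2) := by linarith [Real.add_one_le_exp (η * w / 2)]
  have h2 : (η * w / 2) ^ 2 ≤ Real.exp (η * w) := by
    calc _ ≤ Real.exp (η * w / 2) ^ 2 := by gcongr
      _ = Real.exp (η * w) := by rw [← Real.exp_nat_mul]; congr 1; push_cast; ring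
  rw [le_div_iff₀ (by positivity)]
  have h3 : Real.exp (-η * w) * Real.exp (η * w) = 1 := by rw [← Real.exp_add]; simp
  nlinarith [mul_le_mul_of_nonneg_left h2 (Real.exp_pos (-η * w)).le]

theorem mul_exp_neg_le_one (x : ℝ) : x * Real.exp (-x) ≤ 1 := by
  have h1 := Real.add_one_le_exp x
  have h3 : Real.exp (-x) * Real.exp x = 1 := by rw [← Real.exp_add]; simp
  nlinarith [Real.exp_pos (-x)]

end LaplaceLimit

/-! ### Consequences of the tuning equation at high concentration. -/

section Ratio

variable {d : ℕ} {f : ℝ → ℝ} {m : Euc d}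

theorem IsAngular.tendsto_angularLaw_laplace (hf : IsAngular f) (hd : 3 ≤ d) (hm : ‖m‖ = 1) {η : ℝ}
    (hη : 0 ≤ η) :
    Tendsto (fun κ => ∫ y, Real.exp (-η * (κ * score f κ * (1 - inner ℝ y m))) ∂(angularLaw f κ m))
      atTop (𝓝 (gammaLaplace d η)) := by
  refine (hf.tendsto_laplace hd hm hη).congr fun κ => ?_
  rw [integral_angularLaw_real hf.nonneg hf.mono]

theorem one_sub_inner_nonneg {y : Euc d} (hy : ‖y‖ = 1) (hm : ‖m‖ = 1) :
    0 ≤ 1 - inner ℝ y m ∧ 1 - inner ℝ y m ≤ 2 := by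
  have h := abs_real_inner_le_norm y m
  rw [hy, hm, mul_one, abs_le] at h
  constructor <;> linarith

theorem integral_laplace_antitone {κ : ℝ} [IsProbabilityMeasure (angularLaw f κ m)]
    (hm : ‖m‖ = 1) {G η η' : ℝ} (hG : 0 ≤ G) (h : η ≤ η') :
    ∫ y, Real.exp (-η' * (G * (1 - inner ℝ y m))) ∂(angularLaw f κ m) ≤
      ∫ y, Real.exp (-η * (G * (1 - inner ℝ y m))) ∂(angularLaw f κ m) := by
  refine integral_mono_ae (integrable_angularLaw (by fun_prop)) (integrable_angularLaw (by fun_prop)) ?_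
  filter_upwards [ae_angularLaw_norm] with y hy
  refine Real.exp_le_exp.2 ?_
  have := mul_nonneg hG (one_sub_inner_nonneg hy hm).1
  nlinarith

/-- On the sphere ‖y - ρm‖² = (1 - ρ)² + 2ρ(1 - ⟨y, m⟩), so the mean weight is a deterministic
factor times the Laplace transform at 2ρ/(λG). -/
theorem integral_exp_center {κ : ℝ} (hm : ‖m‖ = 1) {G lam ρ : ℝ} (hG : 0 < G) :
    ∫ y, Real.exp (-‖y - ρ • m‖ ^ 2 / lam) ∂(angularLaw f κ m) = Real.exp (-(1 - ρ) ^ 2 / lam) *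
      ∫ y, Real.exp (-(ρ * (2 / (lam * G))) * (G * (1 - inner ℝ y m))) ∂(angularLaw f κ m) := by
  rw [← integral_const_mul]
  refine integral_congr_ae ?_
  filter_upwards [ae_angularLaw_norm] with y hy
  rw [norm_sub_smul_sq hy hm, ← Real.exp_add]
  congr 1
  field_simp
  ring

-- The mean weight is 1 - δ at the optimal centre ρm and no larger at m. The comparison at m bounds
-- λG from above; the equation at ρm keeps ρ away from 0 and bounds 2ρ/(λG) from above. A bracket
-- around α is enough: the deterministic factor cancels later, so the limit of ρ is not needed.
set_option maxHeartbeats 800000 in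
theorem IsAngular.eventually_tuning (hf : IsAngular f) (hd : 3 ≤ d) (hm : ‖m‖ = 1) {δ α : ℝ}
    (hα : 0 < α) (hδα : 1 - δ = gammaLaplace d α) {lam ρ : ℝ → ℝ}
    (h : ∀ᶠ κ in atTop, 0 < lam κ ∧
      ∫ y, Real.exp (-‖y - ρ κ • m‖ ^ 2 / lam κ) ∂(angularLaw f κ m) = 1 - δ ∧
      ∫ y, Real.exp (-‖y - m‖ ^ 2 / lam κ) ∂(angularLaw f κ m) ≤ 1 - δ) :
    ∀ᶠ κ in atTop, 0 < ρ κ ∧ α / 2 ≤ ρ κ * (2 / (lam κ * (κ * score f κ))) ∧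
      ρ κ * (2 / (lam κ * (κ * score f κ))) ≤ 3 * α / 2 := by
  have hL1 : 0 < 1 - δ := by rw [hδα]; exact gammaLaplace_pos d hα.le
  have hpr := hf.eventually_integral_pos hd hm
  have hlow : gammaLaplace d α < gammaLaplace d (3 * α / 4) :=
    gammaLaplace_strictAnti hd (by linarith) (by linarith)
  have hupp : gammaLaplace d (3 * α / 2) < gammaLaplace d α :=
    gammaLaplace_strictAnti hd (by linarith) (by linarith)
  have hlim := fun η (hη : 0 ≤ η) => hf.tendsto_angularLaw_laplace hd hm (η := η) hη
  -- This η serves a Markov inequality: the mass of the far hemisphere is asymptotically at most 1 -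
  -- `gammaLaplace d η`, which is below 1 - δ.
  obtain ⟨η, hη, hηδ⟩ := exists_gammaLaplace_gt d (c := δ) (by linarith)
  have hG := hf.concentrates
  have hfar : Tendsto (fun κ => Real.exp (-(3 * α / 8) * (κ * score f κ)) +
      (1 - ∫ y, Real.exp (-η * (κ * score f κ * (1 - inner ℝ y m))) ∂(angularLaw f κ m)) /
        (1 - Real.exp (-η * (κ * score f κ)))) atTop (𝓝 (0 + (1 - gammaLaplace d η) / (1 - 0))) := by
    refine Tendsto.add ?_ (((hlim η hη.le).const_sub 1).div (Tendsto.const_sub 1 ?_) (by norm_num))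
    · exact Real.tendsto_exp_atBot.comp (hG.const_mul_atTop_of_neg (by linarith))
    · exact Real.tendsto_exp_atBot.comp (hG.const_mul_atTop_of_neg (by linarith))
  have hfar' := hfar.eventually_lt_const (u := 1 - δ) (by rw [zero_add, sub_zero, div_one]; linarith)
  have hclose : Tendsto (fun κ => (8 / (3 * α)) * -Real.log (1 - δ) / (κ * score f κ)) atTop (𝓝 0) :=
    tendsto_const_nhds.div_atTop hG
  filter_upwards [h, hpr, (hlim _ (by linarith : 0 ≤ 3 * α / 4)).eventually_const_lt hlow,
    (hlim _ (by linarith : 0 ≤ 3 * α / 2)).eventually_lt_const hupp, hfar', hG.eventually_gt_atTop 0,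
    hclose.eventually_lt_const (u := 1 / 9) (by norm_num)] with κ ⟨h1, h2, h3⟩ h4 h5 h6 h7 h8 h9
  have := isProbabilityMeasure_angularLaw hf.nonneg h4
  set G := κ * score f κ with hGdef
  have e1 : 3 * α / 4 ≤ 2 / (lam κ * G) := by
    by_contra! hc
    have h10 := integral_exp_center (f := f) (κ := κ) (lam := lam κ) (ρ := 1) hm h8
    have h11 := integral_laplace_antitone (f := f) (κ := κ) hm h8.le hc.le
    simp only [one_smul, sub_self, one_mul] at h10
    norm_num at h10
    rw [h10] at h3
    norm_num at h11
    norm_num at h5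
    linarith
  have hlamG : 1 / lam κ ≥ 3 * α / 8 * G := by
    have : 2 / (lam κ * G) = 2 * (1 / lam κ) / G := by field_simp
    rw [this, le_div_iff₀ h8] at e1
    linarith
  -- If ρ ≤ 0, every y in the hemisphere around m is at distance at least 1 from ρm and has
  -- exponentially small weight. The far hemisphere alone cannot then supply 1 - δ.
  have e2 : 0 < ρ κ := by
    by_contra! hρ
    have hden : 0 < 1 - Real.exp (-η * G) := by
      rw [sub_pos, Real.exp_lt_one_iff]; nlinarith [mul_pos hη h8]
    have h10 : ∫ y, Real.exp (-‖y - ρ κ • m‖ ^ 2 / lam κ) ∂(angularLaw f κ m) ≤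
        ∫ y, (Real.exp (-(3 * α / 8) * G) + (1 - Real.exp (-η * (G * (1 - inner ℝ y m)))) /
          (1 - Real.exp (-η * G))) ∂(angularLaw f κ m) := by
      refine integral_mono_ae (integrable_angularLaw (by fun_prop))
        (integrable_angularLaw (by fun_prop)) ?_
      filter_upwards [ae_angularLaw_norm] with y hy
      have hr := one_sub_inner_nonneg hy hm
      rcases le_or_gt (1 - inner ℝ y m) 1 with hr1 | hr1
      · have h11 : (1 : ℝ) ≤ ‖y - ρ κ • m‖ ^ 2 := by
          rw [norm_sub_smul_sq hy hm]
          nlinarith [mul_nonneg (neg_nonneg.2 hρ) (sub_nonneg.2 hr1), sq_nonneg (ρ κ)]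
        have h12 : Real.exp (-‖y - ρ κ • m‖ ^ 2 / lam κ) ≤ Real.exp (-(3 * α / 8) * G) := by
          refine Real.exp_le_exp.2 ?_
          rw [neg_div, neg_mul, neg_le_neg_iff]
          refine (ge_iff_le.1 hlamG).trans ?_
          gcongr
        have h13 : 0 ≤ (1 - Real.exp (-η * (G * (1 - inner ℝ y m)))) / (1 - Real.exp (-η * G)) := by
          refine div_nonneg ?_ hden.le
          rw [sub_nonneg, Real.exp_le_one_iff]
          have := mul_nonneg hη.le (mul_nonneg h8.le hr.1)
          linarith
        linarith
      · have h12 : Real.exp (-‖y - ρ κ • m‖ ^ 2 / lam κ) ≤ 1 := by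
          rw [Real.exp_le_one_iff, neg_div]
          have : 0 ≤ ‖y - ρ κ • m‖ ^ 2 / lam κ := by positivity
          linarith
        have h13 : 1 ≤ (1 - Real.exp (-η * (G * (1 - inner ℝ y m)))) / (1 - Real.exp (-η * G)) := by
          rw [le_div_iff₀ hden, one_mul]
          have : Real.exp (-η * (G * (1 - inner ℝ y m))) ≤ Real.exp (-η * G) := by
            refine Real.exp_le_exp.2 ?_
            have := mul_lt_mul_of_pos_left hr1 (mul_pos hη h8)
            nlinarith
          linarith
        have := Real.exp_pos (-(3 * α / 8) * G)
        linarith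
    rw [h2, integral_add (integrable_const _) (integrable_angularLaw (by fun_prop)), integral_const,
      integral_div, integral_sub (integrable_const _) (integrable_angularLaw (by fun_prop)),
      integral_const] at h10
    simp only [probReal_univ, one_smul] at h10
    linarith
  have hexp1 : 1 - δ ≤ Real.exp (-(1 - ρ κ) ^ 2 / lam κ) ∧ 1 - δ ≤
      ∫ y, Real.exp (-(ρ κ * (2 / (lam κ * G))) * (G * (1 - inner ℝ y m))) ∂(angularLaw f κ m) := by
    have h10 := integral_exp_center (f := f) (κ := κ) (lam := lam κ) (ρ := ρ κ) hm h8
    rw [h2] at h10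
    have h11 := integral_laplace_antitone (f := f) (κ := κ) (η := 0)
      (η' := ρ κ * (2 / (lam κ * G))) hm h8.le (by positivity)
    simp only [neg_zero, zero_mul, Real.exp_zero, integral_const, probReal_univ, one_smul] at h11
    have h12 : Real.exp (-(1 - ρ κ) ^ 2 / lam κ) ≤ 1 := by
      rw [Real.exp_le_one_iff, neg_div]
      have : 0 ≤ (1 - ρ κ) ^ 2 / lam κ := by positivity
      exact neg_nonpos.2 this
    have h13 := Real.exp_pos (-(1 - ρ κ) ^ 2 / lam κ)
    have h14 : 0 ≤ ∫ y, Real.exp (-(ρ κ * (2 / (lam κ * G))) * (G * (1 - inner ℝ y m)))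
        ∂(angularLaw f κ m) := integral_nonneg fun _ => (Real.exp_pos _).le
    constructor
    · rw [h10]; exact mul_le_of_le_one_right h13.le h11
    · rw [h10]; exact mul_le_of_le_one_left h14 h12
  -- The factor exp(-(1 - ρ)²/λ) is at least 1 - δ while 1/λ is at least of order G, so (1 - ρ)² is
  -- of order 1/G. Together with 2/(λG) ≥ 3α/4, the value 2/3 gives the lower end α/2.
  have e3 : 2 / 3 ≤ ρ κ := by
    have h10 := (Real.log_le_iff_le_exp hL1).2 hexp1.1
    rw [neg_div, le_neg, div_eq_mul_one_div] at h10
    have h11 : (1 - ρ κ) ^ 2 < 1 / 9 := by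
      refine lt_of_le_of_lt ?_ h9
      rw [le_div_iff₀ h8, div_mul_eq_mul_div, le_div_iff₀ (by positivity)]
      nlinarith [mul_le_mul_of_nonneg_left (ge_iff_le.1 hlamG) (sq_nonneg (1 - ρ κ))]
    by_contra! hc
    have h12 : (1 / 3 : ℝ) ^ 2 < (1 - ρ κ) ^ 2 :=
      pow_lt_pow_left₀ (by linarith) (by norm_num) two_ne_zero
    norm_num at h12 h11
    linarith
  refine ⟨e2, ?_, ?_⟩
  · calc α / 2 = 2 / 3 * (3 * α / 4) := by ring
      _ ≤ _ := mul_le_mul e3 e1 (by positivity) e2.le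
  · by_contra! hc
    have h11 := integral_laplace_antitone (f := f) (κ := κ) hm h8.le hc.le
    linarith [hexp1.2]

-- Both sides carry the factor E = exp(-2(1 - ρ)²/λ) and a factor 1/G, which cancel. The rest
-- compares sup 2w e^{-2sw} with the mean of (2w - w²/G) e^{-2sw}; the w² term costs O(1/G) in the
-- mean and may be dropped in the supremum.
set_option maxHeartbeats 800000 in
theorem IsAngular.eventually_ratio (hf : IsAngular f) (hd : 3 ≤ d) (hm : ‖m‖ = 1) {δ : ℝ}
    (hδ : δ ∈ Ioo (0 : ℝ) 1) {lam ρ : ℝ → ℝ}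
    (h : ∀ᶠ κ in atTop, 0 < lam κ ∧
      ∫ y, Real.exp (-‖y - ρ κ • m‖ ^ 2 / lam κ) ∂(angularLaw f κ m) = 1 - δ ∧
      ∫ y, Real.exp (-‖y - m‖ ^ 2 / lam κ) ∂(angularLaw f κ m) ≤ 1 - δ) :
    ∀ᶠ κ in atTop, 0 < ρ κ ∧ ∀ y : Euc d, ‖y‖ = 1 →
      (1 - inner ℝ y m ^ 2) * Real.exp (-2 * ‖y - ρ κ • m‖ ^ 2 / lam κ) ≤
      2 ^ (d + 2) * ((tuningK d δ - 2) ^ (-((d : ℝ) - 1) / 2) *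
          (tuningK d δ + 2) ^ (((d : ℝ) + 1) / 2)) *
        ∫ y, (1 - inner ℝ y m ^ 2) * Real.exp (-2 * ‖y - ρ κ • m‖ ^ 2 / lam κ)
          ∂(angularLaw f κ m) := by
  obtain ⟨α, hα, hδα, hK⟩ := tuningK_eq hd hδ
  rw [hK]
  have hG := hf.concentrates
  -- The bracket on s gives 2s ≤ 3α, so e^{-ηw} is a κ-independent lower bound for e^{-2sw}.
  set η := 3 * α with hη
  have hη0 : 0 < η := by positivity
  have hdiff : Tendsto (fun κ =>
      2 * ((∫ y, Real.exp (-η * (κ * score f κ * (1 - inner ℝ y m))) ∂(angularLaw f κ m)) -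
        ∫ y, Real.exp (-(1 + 2 * η) * (κ * score f κ * (1 - inner ℝ y m))) ∂(angularLaw f κ m)) /
        (1 + η) - 4 / η ^ 2 / (κ * score f κ)) atTop
      (𝓝 (2 * (gammaLaplace d η - gammaLaplace d (1 + 2 * η)) / (1 + η) - 0)) :=
    ((((hf.tendsto_angularLaw_laplace hd hm hη0.le).sub
      (hf.tendsto_angularLaw_laplace hd hm (by positivity))).const_mul 2).div_const _).sub
      (tendsto_const_nhds.div_atTop hG)
  have hsq : 0 < √(1 + η) := Real.sqrt_pos.2 (by positivity)
  -- Half of the limiting lower bound; the strict gap lets the inequality hold at finite κ.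
  set b := (√(1 + η) ^ (d + 1))⁻¹ / 2 with hb
  have hb0 : 0 < b := by positivity
  have hb' : b < 2 * (gammaLaplace d η - gammaLaplace d (1 + 2 * η)) / (1 + η) - 0 := by
    rw [sub_zero]
    refine lt_of_lt_of_le ?_ (gammaLaplace_sub_ge hd hη0.le)
    rw [hb]; exact half_lt_self (by positivity)
  filter_upwards [hf.eventually_tuning hd hm hα hδα h, hf.eventually_integral_pos hd hm,
    hdiff.eventually_const_lt hb', hG.eventually_gt_atTop 0, h] with κ ⟨h1, h2, h3⟩ h4 h5 h6 ⟨h7, _, _⟩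
  refine ⟨h1, fun y hy => ?_⟩
  have := isProbabilityMeasure_angularLaw hf.nonneg h4
  set G := κ * score f κ with hGdef
  set s := ρ κ * (2 / (lam κ * G)) with hs
  have hs0 : 0 < s := by linarith
  set E := Real.exp (-2 * (1 - ρ κ) ^ 2 / lam κ) with hE
  have hE0 : 0 < E := Real.exp_pos _
  have hfac : ∀ z : Euc d, ‖z‖ = 1 → (1 - inner ℝ z m ^ 2) * Real.exp (-2 * ‖z - ρ κ • m‖ ^ 2 / lam κ) =
      E * ((2 * (G * (1 - inner ℝ z m)) - (G * (1 - inner ℝ z m)) ^ 2 / G) / G *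
        Real.exp (-(2 * s) * (G * (1 - inner ℝ z m)))) := by
    intro z hz
    have e1 : Real.exp (-2 * ‖z - ρ κ • m‖ ^ 2 / lam κ) =
        E * Real.exp (-(2 * s) * (G * (1 - inner ℝ z m))) := by
      rw [norm_sub_smul_sq hz hm, hE, ← Real.exp_add, hs]
      congr 1
      field_simp
      ring
    rw [e1]
    field_simp
    ring
  have hD : E * (b / G) ≤ ∫ y, (1 - inner ℝ y m ^ 2) * Real.exp (-2 * ‖y - ρ κ • m‖ ^ 2 / lam κ)
          ∂(angularLaw f κ m) := by
    calc E * (b / G) ≤ E * ((2 * ((∫ y, Real.exp (-η * (G * (1 - inner ℝ y m))) ∂(angularLaw f κ m)) -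
        ∫ y, Real.exp (-(1 + 2 * η) * (G * (1 - inner ℝ y m))) ∂(angularLaw f κ m)) /
        (1 + η) - 4 / η ^ 2 / G) / G) := by gcongr
      _ = ∫ y, E * ((2 * (Real.exp (-η * (G * (1 - inner ℝ y m))) -
          Real.exp (-(1 + 2 * η) * (G * (1 - inner ℝ y m)))) / (1 + η) - 4 / η ^ 2 / G) / G)
          ∂(angularLaw f κ m) := by
        rw [integral_const_mul, integral_div, integral_sub (integrable_angularLaw (by fun_prop))
          (integrable_const _), integral_div, integral_const_mul,
          integral_sub (integrable_angularLaw (by fun_prop)) (integrable_angularLaw (by fun_prop)),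
          integral_const]
        simp
      _ ≤ _ := by
        refine integral_mono_ae (integrable_angularLaw (by fun_prop))
          (integrable_angularLaw (by fun_prop)) ?_
        filter_upwards [ae_angularLaw_norm] with z hz
        rw [hfac z hz]
        have hr := one_sub_inner_nonneg hz hm
        set w := G * (1 - inner ℝ z m) with hw
        have hw0 : 0 ≤ w := mul_nonneg h6.le hr.1
        have hwG : w ^ 2 / G ≤ 2 * w := by
          rw [div_le_iff₀ h6]; nlinarith [mul_le_mul_of_nonneg_left hr.2 h6.le]
        rw [div_mul_eq_mul_div]
        gcongr
        have i1 := exp_neg_sub_exp_neg_le η (1 + 2 * η) w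
        have i2 := sq_mul_exp_neg_le hη0 hw0
        have i3 : (2 * w - w ^ 2 / G) * Real.exp (-η * w) ≤
            (2 * w - w ^ 2 / G) * Real.exp (-(2 * s) * w) := by
          have : 0 ≤ 2 * w - w ^ 2 / G := by linarith
          gcongr
          linarith
        refine le_trans ?_ i3
        have i4 : (Real.exp (-η * w) - Real.exp (-(1 + 2 * η) * w)) / (1 + η) ≤
            w * Real.exp (-η * w) := by
          rw [div_le_iff₀ (by positivity)]; linarith
        have i5 : w ^ 2 / G * Real.exp (-η * w) ≤ 4 / η ^ 2 / G := by
          rw [div_mul_eq_mul_div]; gcongr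
        rw [mul_div_assoc]
        nlinarith
  have hN : (1 - inner ℝ y m ^ 2) * Real.exp (-2 * ‖y - ρ κ • m‖ ^ 2 / lam κ) ≤ E * (1 / s / G) := by
    rw [hfac y hy]
    have hr := one_sub_inner_nonneg hy hm
    set w := G * (1 - inner ℝ y m) with hw
    have hw0 : 0 ≤ w := mul_nonneg h6.le hr.1
    rw [div_mul_eq_mul_div]
    gcongr
    rw [le_div_iff₀ hs0]
    have i1 := mul_exp_neg_le_one (2 * s * w)
    rw [neg_mul]
    have i2 : 0 ≤ w ^ 2 / G * Real.exp (-(2 * s * w)) := by positivity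
    nlinarith
  refine hN.trans ?_
  have hsq2 : √(1 + η) ≤ 2 * √(1 + 2 * α) := by
    rw [Real.sqrt_le_left (by positivity), mul_pow, Real.sq_sqrt (by positivity), hη]
    linarith
  calc E * (1 / s / G) ≤ (2 ^ (d + 2) * (2 / α * √(1 + 2 * α) ^ (d + 1))) * (E * (b / G)) := by
        have i1 : 1 / s ≤ (2 ^ (d + 2) * (2 / α * √(1 + 2 * α) ^ (d + 1))) * b := by
          have i2 : 1 / s ≤ 2 / α := by
            rw [div_le_div_iff₀ hs0 hα]; linarith
          have i3 : 1 ≤ 2 ^ (d + 1) * √(1 + 2 * α) ^ (d + 1) * (√(1 + η) ^ (d + 1))⁻¹ := by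
            rw [← div_eq_mul_inv, le_div_iff₀ (by positivity), one_mul, ← mul_pow]
            gcongr
          calc 1 / s ≤ 2 / α * 1 := by linarith
            _ ≤ 2 / α * (2 ^ (d + 1) * √(1 + 2 * α) ^ (d + 1) * (√(1 + η) ^ (d + 1))⁻¹) := by gcongr
            _ = _ := by rw [hb]; ring
        calc E * (1 / s / G) ≤ E * ((2 ^ (d + 2) * (2 / α * √(1 + 2 * α) ^ (d + 1))) * b / G) := by gcongr
          _ = _ := by ring
    _ ≤ _ := by gcongr

end Ratio

/-! ### Disintegration of the population law over the predictor and the index. -/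

section Model

variable {q d : ℕ} {f : ℝ → ℝ} {κ : ℝ}

theorem measurable_angularDensity_prod (hf : Monotone f) :
    Measurable fun p : Euc d × Euc d => angularDensity f κ p.1 p.2 := by
  have hfm := hf.measurable
  unfold angularDensity
  refine Measurable.div (by fun_prop) ?_
  have : Measurable fun p : Euc d × Euc d => f (κ * inner ℝ p.2 p.1) := by fun_prop
  exact (this.stronglyMeasurable.integral_prod_right' (ν := surfaceMeasure d)).measurable.comp
    measurable_fst

/-- The mass is 1, or 0 when the normalising integral vanishes and division by zero makes the
density 0. The bound holds for every vector, so the angular laws form a finite kernel even off the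
unit sphere. -/
theorem angularLaw_univ_le (hf0 : ∀ x, 0 ≤ f x) (m : Euc d) : angularLaw f κ m univ ≤ 1 := by
  rcases (show 0 ≤ ∫ y, f (κ * inner ℝ y m) ∂(surfaceMeasure d) from
    integral_nonneg fun y => hf0 _).lt_or_eq with h | h
  · have := isProbabilityMeasure_angularLaw hf0 h
    exact prob_le_one
  · have : ∀ y, angularDensity f κ m y = 0 := fun y => by
      unfold angularDensity; rw [← h]; simp
    simp [angularLaw, this]

/-- The angular laws as a kernel in the location parameter. -/
noncomputable def angularKernel (d : ℕ) (hf : Monotone f) (κ : ℝ) : Kernel (Euc d) (Euc d) where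
  toFun m := angularLaw f κ m
  measurable' := by
    refine Measure.measurable_of_measurable_coe _ fun s hs => ?_
    have : ∀ m : Euc d, angularLaw f κ m s =
        ∫⁻ y, s.indicator (fun y => ENNReal.ofReal (angularDensity f κ m y)) y
          ∂(surfaceMeasure d) := fun m => by
      rw [angularLaw, withDensity_apply _ hs, lintegral_indicator hs]
    simp_rw [this]
    refine Measurable.lintegral_prod_right' (f := fun p : Euc d × Euc d =>
      s.indicator (fun y => ENNReal.ofReal (angularDensity f κ p.1 y)) p.2) ?_
    have h2 : (fun p : Euc d × Euc d =>
      s.indicator (fun y => ENNReal.ofReal (angularDensity f κ p.1 y)) p.2) =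
      (univ ×ˢ s).indicator fun p => ENNReal.ofReal (angularDensity f κ p.1 p.2) := by
      ext p
      by_cases hp : p.2 ∈ s <;> simp [indicator, hp, mem_prod]
    rw [h2]
    exact ((measurable_angularDensity_prod hf).ennreal_ofReal).indicator (MeasurableSet.univ.prod hs)

theorem isFiniteKernel_angularKernel (hf0 : ∀ x, 0 ≤ f x) (hf : Monotone f) :
    IsFiniteKernel (angularKernel d hf κ) :=
  ⟨1, ENNReal.one_lt_top, fun m => angularLaw_univ_le hf0 m⟩

theorem continuous_projIndex (θ : Euc q) : Continuous (projIndex θ) := by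
  unfold projIndex; fun_prop

variable {PX : Measure (Euc (q + 1))} {θ₀ : Euc q} {m : ℝ → Euc d}
  {P : Measure (Euc (q + 1) × Euc d)}

theorem HasHighConcLaw.lintegral [SFinite PX] (hf : Monotone f) (hm : Measurable m)
    (hP : HasHighConcLaw PX θ₀ m f κ P) {g : Euc (q + 1) × Euc d → ℝ≥0∞} (hg : Measurable g) :
    ∫⁻ z, g z ∂P = ∫⁻ x, ∫⁻ y, g (x, y) ∂(angularLaw f κ (m (projIndex θ₀ x))) ∂PX := by
  have hc := (continuous_projIndex θ₀).measurable
  have hmeas : Measurable fun z : Euc (q + 1) × Euc d =>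
      ENNReal.ofReal (angularDensity f κ (m (projIndex θ₀ z.1)) z.2) :=
    ((measurable_angularDensity_prod hf).comp
      ((hm.comp (hc.comp measurable_fst)).prodMk measurable_snd)).ennreal_ofReal
  rw [hP, lintegral_withDensity_eq_lintegral_mul _ hmeas hg, lintegral_prod _ (by fun_prop)]
  refine lintegral_congr fun x => ?_
  rw [angularLaw, lintegral_withDensity_eq_lintegral_mul _
    (measurable_angularDensity hf).ennreal_ofReal (by fun_prop)]
  rfl

/-- The standing assumptions on a population at a fixed concentration. -/
structure IsGoodModel (PX : Measure (Euc (q + 1))) (𝒳 : Set (Euc (q + 1))) (θ₀ : Euc q)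
    (m : ℝ → Euc d) (f : ℝ → ℝ) (κ : ℝ) (P : Measure (Euc (q + 1) × Euc d)) : Prop where
  nonneg : ∀ x, 0 ≤ f x
  mono : Monotone f
  norm_pos : ∀ v : Euc d, ‖v‖ = 1 → 0 < ∫ y, f (κ * inner ℝ y v) ∂(surfaceMeasure d)
  law : HasHighConcLaw PX θ₀ m f κ P
  contDiff : ContDiff ℝ 1 m
  compact : IsCompact 𝒳
  mem_ae : ∀ᵐ x ∂PX, x ∈ 𝒳
  mem_support : ∀ x ∈ 𝒳, projIndex θ₀ x ∈ (PX.map (projIndex θ₀)).support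
  unit : ∀ u ∈ (PX.map (projIndex θ₀)).support, ‖m u‖ = 1
  noAtoms : NullSingletonClass (PX.map (projIndex θ₀))

namespace IsGoodModel

variable {𝒳 : Set (Euc (q + 1))}

theorem isProb (h : IsGoodModel PX 𝒳 θ₀ m f κ P) {v : Euc d} (hv : ‖v‖ = 1) :
    IsProbabilityMeasure (angularLaw f κ v) :=
  isProbabilityMeasure_angularLaw h.nonneg (h.norm_pos v hv)

theorem unit_of_mem (h : IsGoodModel PX 𝒳 θ₀ m f κ P) {x : Euc (q + 1)} (hx : x ∈ 𝒳) :
    ‖m (projIndex θ₀ x)‖ = 1 := h.unit _ (h.mem_support x hx)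

variable [IsProbabilityMeasure PX]

theorem lintegral (h : IsGoodModel PX 𝒳 θ₀ m f κ P) {g : Euc (q + 1) × Euc d → ℝ≥0∞}
    (hg : Measurable g) :
    ∫⁻ z, g z ∂P = ∫⁻ x, ∫⁻ y, g (x, y) ∂(angularLaw f κ (m (projIndex θ₀ x))) ∂PX :=
  h.law.lintegral h.mono h.contDiff.continuous.measurable hg

theorem map_fst (h : IsGoodModel PX 𝒳 θ₀ m f κ P) : P.map Prod.fst = PX := by
  refine Measure.ext_of_lintegral _ fun g hg => ?_
  rw [lintegral_map hg measurable_fst, h.lintegral (g := fun z => g z.1) (by fun_prop)]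
  refine lintegral_congr_ae ?_
  filter_upwards [h.mem_ae] with x hx
  have := h.isProb (h.unit_of_mem hx)
  simp

theorem indexLaw_eq (h : IsGoodModel PX 𝒳 θ₀ m f κ P) (θ : Euc q) :
    indexLaw P θ = PX.map (projIndex θ) := by
  have hc := (continuous_projIndex θ).measurable
  rw [← h.map_fst, Measure.map_map hc measurable_fst]
  rfl

theorem eq_compProd (h : IsGoodModel PX 𝒳 θ₀ m f κ P) :
    P = PX ⊗ₘ ((angularKernel d h.mono κ).comap (fun x => m (projIndex θ₀ x))
      (h.contDiff.continuous.comp (continuous_projIndex θ₀)).measurable) := by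
  have := isFiniteKernel_angularKernel (d := d) (κ := κ) h.nonneg h.mono
  refine Measure.ext_of_lintegral _ fun g hg => ?_
  rw [h.lintegral hg, Measure.lintegral_compProd hg]
  rfl

theorem integral (h : IsGoodModel PX 𝒳 θ₀ m f κ P) {F : Type*} [NormedAddCommGroup F]
    [NormedSpace ℝ F] {g : Euc (q + 1) × Euc d → F} (hg : Integrable g P) :
    ∫ z, g z ∂P = ∫ x, ∫ y, g (x, y) ∂(angularLaw f κ (m (projIndex θ₀ x))) ∂PX := by
  have := isFiniteKernel_angularKernel (d := d) (κ := κ) h.nonneg h.mono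
  have hg' := hg
  rw [h.eq_compProd] at hg'
  conv_lhs => rw [h.eq_compProd]
  rw [Measure.integral_compProd hg']
  rfl

theorem ae_mem (h : IsGoodModel PX 𝒳 θ₀ m f κ P) : ∀ᵐ z ∂P, z.1 ∈ 𝒳 ∧ ‖z.2‖ = 1 := by
  have h1 : ∀ᵐ z ∂P, z.1 ∈ 𝒳 := by
    have := h.mem_ae
    rw [← h.map_fst] at this
    exact ae_of_ae_map measurable_fst.aemeasurable this
  have h2 : ∀ᵐ z ∂P, ‖z.2‖ = 1 := by
    have hac : P ≪ PX.prod (surfaceMeasure d) := by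
      conv_lhs => rw [h.law]
      exact withDensity_absolutelyContinuous _ _
    refine hac.ae_le ?_
    have : Measure.QuasiMeasurePreserving Prod.snd (PX.prod (surfaceMeasure d)) (surfaceMeasure d) :=
      Measure.quasiMeasurePreserving_snd
    exact this.ae ae_surfaceMeasure_mem_sphere
  filter_upwards [h1, h2] with z h1 h2 using ⟨h1, h2⟩

variable [IsProbabilityMeasure P]

/-- At θ₀ the law of Y given X depends on X through the index only, so conditioning on the index
gives the same angular law; uniqueness of disintegrations finishes. For other θ the conditional law
is not explicit, and later arguments avoid it. -/
theorem condLawY_eq (h : IsGoodModel PX 𝒳 θ₀ m f κ P) :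
    ∀ᵐ u ∂(PX.map (projIndex θ₀)), condLawY P θ₀ u = angularLaw f κ (m u) := by
  have hc := (continuous_projIndex θ₀).measurable
  have := isFiniteKernel_angularKernel (d := d) (κ := κ) h.nonneg h.mono
  have key : P.map (fun z : Euc (q + 1) × Euc d => (projIndex θ₀ z.1, z.2)) =
      P.map (fun z : Euc (q + 1) × Euc d => projIndex θ₀ z.1) ⊗ₘ
        ((angularKernel d h.mono κ).comap m h.contDiff.continuous.measurable) := by
    refine Measure.ext_of_lintegral _ fun g hg => ?_
    rw [lintegral_map hg (by fun_prop), Measure.lintegral_compProd hg]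
    have : P.map (fun z : Euc (q + 1) × Euc d => projIndex θ₀ z.1) = _ := h.indexLaw_eq θ₀
    rw [this, lintegral_map _ hc, h.lintegral (g := fun z => g (projIndex θ₀ z.1, z.2)) (by fun_prop)]
    · rfl
    · exact Measurable.lintegral_kernel_prod_right' hg
  have := condDistrib_ae_eq_of_measure_eq_compProd (μ := P)
    (fun z : Euc (q + 1) × Euc d => projIndex θ₀ z.1) (Y := fun z => z.2) (by fun_prop) key
  have e : P.map (fun z : Euc (q + 1) × Euc d => projIndex θ₀ z.1) = _ := h.indexLaw_eq θ₀
  rw [e] at this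
  filter_upwards [this] with u hu
  rw [condLawY, hu]
  rfl

theorem condLawX_eq (h : IsGoodModel PX 𝒳 θ₀ m f κ P) :
    ∀ᵐ u ∂(PX.map (projIndex θ₀)), condLawX P θ₀ u = condDistrib id (projIndex θ₀) PX u := by
  have hc := (continuous_projIndex θ₀).measurable
  have e : P.map (fun z : Euc (q + 1) × Euc d => projIndex θ₀ z.1) = _ := h.indexLaw_eq θ₀
  have key : P.map (fun z : Euc (q + 1) × Euc d => (projIndex θ₀ z.1, z.1)) =
      P.map (fun z : Euc (q + 1) × Euc d => projIndex θ₀ z.1) ⊗ₘ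
        condDistrib id (projIndex θ₀) PX := by
    rw [e, compProd_map_condDistrib aemeasurable_id, ← h.map_fst,
      Measure.map_map (by fun_prop) measurable_fst]
    rfl
  have := condDistrib_ae_eq_of_measure_eq_compProd (μ := P)
    (fun z : Euc (q + 1) × Euc d => projIndex θ₀ z.1) (Y := fun z => z.1) (by fun_prop) key
  rw [e] at this
  filter_upwards [this] with u hu
  rw [condLawX, hu]

end IsGoodModel

end Model

/-! ### Differentiating identities that hold on the support only. -/

section Support

variable {ν : Measure ℝ}

/-- An isolated point of the support would have to be an atom. Hence difference quotients can be
taken inside the support, and identities valid there can be differentiated. -/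
theorem accPt_support [NullSingletonClass ν] {u : ℝ} (hu : u ∈ ν.support) : (𝓝[ν.support \ {u}] u).NeBot := by
  rw [nhdsWithin_neBot]
  intro t ht
  have h1 := (Measure.mem_support_iff_forall u).1 hu _ ht
  by_contra hne
  rw [Set.not_nonempty_iff_eq_empty] at hne
  have h2 : t ⊆ ν.supportᶜ ∪ {u} := by
    intro x hx
    by_contra hc
    simp only [mem_union, mem_compl_iff, mem_singleton_iff, not_or, not_not] at hc
    have : x ∈ t ∩ (ν.support \ {u}) := ⟨hx, hc.1, hc.2⟩
    rw [hne] at this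
    exact this
  have h3 : ν (ν.supportᶜ ∪ {u}) = 0 := by
    rw [measure_union_null_iff]
    exact ⟨Measure.measure_compl_support, measure_singleton _⟩
  exact h1.ne' (measure_mono_null h2 h3)

theorem deriv_eq_zero_of_eqOn_support [NullSingletonClass ν] {F : Type*} [NormedAddCommGroup F] [NormedSpace ℝ F]
    {g : ℝ → F} {g' : F} (hg : ∀ u ∈ ν.support, g u = 0) {u : ℝ} (hu : u ∈ ν.support)
    (hd : HasDerivAt g g' u) : g' = 0 := by
  have := accPt_support hu
  have h1 := hasDerivWithinAt_iff_tendsto_slope.1 (hd.hasDerivWithinAt (s := ν.support))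
  have h2 : Tendsto (slope g u) (𝓝[ν.support \ {u}] u) (𝓝 0) := by
    refine tendsto_const_nhds.congr' ?_
    filter_upwards [self_mem_nhdsWithin] with x hx
    rw [slope_def_module, hg x hx.1, hg u hu]; simp
  exact tendsto_nhds_unique h1 h2

end Support

/-! ### Derivatives and a uniform Taylor bound for the loss. -/

section Loss

variable {d : ℕ} {lam : ℝ}

/-- The weight `exp(-‖w‖² / λ)` of the exponential squared loss. -/
noncomputable def eslWeight (lam : ℝ) (w : Euc d) : ℝ := Real.exp (-‖w‖ ^ 2 / lam)

/-- The second derivative of the exponential squared loss, as a bilinear form. -/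
noncomputable def eslHess (lam : ℝ) (w a b : Euc d) : ℝ :=
  eslWeight lam w * (2 / lam * inner ℝ a b - 4 / lam ^ 2 * (inner ℝ w a * inner ℝ w b))

theorem eslLoss_eq (w : Euc d) : eslLoss lam w = 1 - eslWeight lam w := rfl

theorem continuous_eslWeight : Continuous (eslWeight (d := d) lam) := by
  unfold eslWeight; fun_prop

theorem continuous_eslLoss : Continuous (eslLoss (d := d) lam) := by
  unfold eslLoss; fun_prop

theorem eslWeight_pos (w : Euc d) : 0 < eslWeight lam w := Real.exp_pos _

theorem eslWeight_le_one (hl : 0 < lam) (w : Euc d) : eslWeight lam w ≤ 1 := by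
  rw [eslWeight, Real.exp_le_one_iff, neg_div]
  have : 0 ≤ ‖w‖ ^ 2 / lam := by positivity
  linarith

theorem abs_eslLoss_le_one (hl : 0 < lam) (w : Euc d) : |eslLoss lam w| ≤ 1 := by
  rw [eslLoss_eq, abs_le]
  constructor <;> linarith [eslWeight_le_one hl w, eslWeight_pos (lam := lam) w]

theorem hasFDerivAt_eslWeight (w : Euc d) :
    HasFDerivAt (eslWeight lam) (-(2 / lam * eslWeight lam w) • innerSL ℝ w) w := by
  have h := (((hasStrictFDerivAt_norm_sq w).hasFDerivAt.neg).mul_const (lam⁻¹)).exp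
  refine (h.congr_fderiv ?_).congr_of_eventuallyEq (.of_forall fun x => ?_)
  · ext v
    simp [eslWeight, div_eq_mul_inv]
    ring
  · simp [eslWeight, div_eq_mul_inv]

theorem hasFDerivAt_eslLoss (w : Euc d) :
    HasFDerivAt (eslLoss lam) ((2 / lam * eslWeight lam w) • innerSL ℝ w) w := by
  have := (hasFDerivAt_eslWeight (lam := lam) w).const_sub 1
  refine this.congr_fderiv ?_
  rw [neg_smul, neg_neg]

theorem fderiv_fderiv_eslLoss (w a b : Euc d) :
    fderiv ℝ (fderiv ℝ (eslLoss lam)) w a b = eslHess lam w a b := by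
  have h1 : fderiv ℝ (eslLoss (d := d) lam) = fun w => (2 / lam * eslWeight lam w) • innerSL ℝ w := by
    ext1 w; exact (hasFDerivAt_eslLoss w).fderiv
  have h2 := ((hasFDerivAt_eslWeight (lam := lam) w).const_mul (2 / lam)).smul
    (innerSL ℝ : Euc d →L[ℝ] Euc d →L[ℝ] ℝ).hasFDerivAt
  have h3 : HasFDerivAt (fun w : Euc d => (2 / lam * eslWeight lam w) • innerSL ℝ w) _ w := h2
  have e : ∀ a b : Euc d, (innerSL ℝ : Euc d →L[ℝ] Euc d →L[ℝ] ℝ) a b = inner ℝ a b :=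
    fun _ _ => rfl
  rw [h1, h3.fderiv]
  simp [eslHess, e]
  ring

theorem eslHess_add_left (w a a' b : Euc d) :
    eslHess lam w (a + a') b = eslHess lam w a b + eslHess lam w a' b := by
  simp only [eslHess, inner_add_left, inner_add_right]; ring

theorem eslHess_smul_left (w a b : Euc d) (c : ℝ) :
    eslHess lam w (c • a) b = c * eslHess lam w a b := by
  simp only [eslHess, real_inner_smul_left, real_inner_smul_right]; ring

theorem eslHess_comm (w a b : Euc d) : eslHess lam w a b = eslHess lam w b a := by
  simp only [eslHess, real_inner_comm a b]; ring

theorem eslHess_add_right (w a b b' : Euc d) :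
    eslHess lam w a (b + b') = eslHess lam w a b + eslHess lam w a b' := by
  rw [eslHess_comm, eslHess_add_left, eslHess_comm, eslHess_comm w b' a]

theorem eslHess_smul_right (w a b : Euc d) (c : ℝ) :
    eslHess lam w a (c • b) = c * eslHess lam w a b := by
  rw [eslHess_comm, eslHess_smul_left, eslHess_comm]

theorem continuous_eslHess :
    Continuous fun p : Euc d × Euc d × Euc d => eslHess lam p.1 p.2.1 p.2.2 := by
  unfold eslHess eslWeight; fun_prop

theorem abs_eslHess_le (hl : 0 < lam) {M : ℝ} {w : Euc d} (hw : ‖w‖ ≤ M) (a b : Euc d) :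
    |eslHess lam w a b| ≤ (2 / lam + 4 / lam ^ 2 * M ^ 2) * (‖a‖ * ‖b‖) := by
  have hM : 0 ≤ M := (norm_nonneg w).trans hw
  rw [eslHess, abs_mul, abs_of_pos (eslWeight_pos w)]
  have h1 := abs_real_inner_le_norm a b
  have h2 := abs_real_inner_le_norm w a
  have h3 := abs_real_inner_le_norm w b
  have h4 : |2 / lam * inner ℝ a b - 4 / lam ^ 2 * (inner ℝ w a * inner ℝ w b)| ≤
      2 / lam * (‖a‖ * ‖b‖) + 4 / lam ^ 2 * ((M * ‖a‖) * (M * ‖b‖)) := by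
    refine (abs_sub _ _).trans ?_
    rw [abs_mul, abs_mul, abs_mul, abs_of_pos (show 0 < 2 / lam by positivity),
      abs_of_pos (show 0 < 4 / lam ^ 2 by positivity)]
    gcongr
    · exact h2.trans (by gcongr)
    · exact h3.trans (by gcongr)
  calc _ ≤ 1 * (2 / lam * (‖a‖ * ‖b‖) + 4 / lam ^ 2 * ((M * ‖a‖) * (M * ‖b‖))) := by
        gcongr
        exact eslWeight_le_one hl w
    _ = _ := by ring

theorem abs_exp_sub_quadratic_le {p : ℝ} (hp : |p| ≤ 1) :
    |Real.exp p - 1 - p - p ^ 2 / 2| ≤ |p| ^ 3 := by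
  have h := Real.exp_bound hp (n := 3) (by norm_num)
  simp only [Finset.sum_range_succ, Finset.sum_range_zero] at h
  norm_num [Nat.factorial] at h
  have e : Real.exp p - 1 - p - p ^ 2 / 2 = Real.exp p - (1 + p + p ^ 2 / 2) := by ring
  rw [e]
  refine h.trans ?_
  have : 0 ≤ |p| ^ 3 := by positivity
  linarith

/-- Expanding ‖w - Δ‖² gives weight(w - Δ) = weight(w) e^p with p = (2⟨w, Δ⟩ - ‖Δ‖²)/λ. The
quadratic Taylor polynomial of e^p yields the gradient and Hessian terms plus cubic errors.
Uniformity over ‖w‖ ≤ M allows integration in y. -/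
theorem eslLoss_taylor (hl : 0 < lam) {M : ℝ} (hM : 0 ≤ M) : ∃ C ≥ 0, ∃ r > 0, ∀ w Δ : Euc d,
    ‖w‖ ≤ M → ‖Δ‖ ≤ r →
    |eslLoss lam (w - Δ) - eslLoss lam w + 2 / lam * (eslWeight lam w * inner ℝ w Δ) -
      eslHess lam w Δ Δ / 2| ≤ C * ‖Δ‖ ^ 3 := by
  set c : ℝ := (2 * M + 1) / lam with hc
  have hc0 : 0 < c := by positivity
  refine ⟨(4 * M + 1) / (2 * lam ^ 2) + c ^ 3, by positivity, min 1 c⁻¹, by positivity,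
    fun w Δ hw hΔ => ?_⟩
  have hΔ1 : ‖Δ‖ ≤ 1 := hΔ.trans (min_le_left _ _)
  have hΔ2 : ‖Δ‖ ≤ c⁻¹ := hΔ.trans (min_le_right _ _)
  have hΔ0 := norm_nonneg Δ
  set s := inner ℝ w Δ with hs
  set t := ‖Δ‖ with ht
  have hs1 : |s| ≤ M * t := (abs_real_inner_le_norm w Δ).trans (by gcongr)
  set p := (2 * s - t ^ 2) / lam with hp
  have hpc : |p| ≤ c * t := by
    rw [hp, abs_div, abs_of_pos hl, hc, div_mul_eq_mul_div]
    gcongr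
    refine (abs_sub _ _).trans ?_
    rw [abs_mul, abs_two, abs_of_nonneg (by positivity : 0 ≤ t ^ 2)]
    nlinarith
  have hp1 : |p| ≤ 1 := hpc.trans (by
    calc c * t ≤ c * c⁻¹ := by gcongr
      _ = 1 := mul_inv_cancel₀ hc0.ne')
  have hexp := abs_exp_sub_quadratic_le hp1
  have e1 : eslWeight lam (w - Δ) = eslWeight lam w * Real.exp p := by
    rw [eslWeight, eslWeight, ← Real.exp_add, norm_sub_sq_real, hp]
    congr 1; field_simp; ring
  have e2 : eslLoss lam (w - Δ) - eslLoss lam w + 2 / lam * (eslWeight lam w * s) -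
      eslHess lam w Δ Δ / 2 = eslWeight lam w * ((4 * s * t ^ 2 - t ^ 4) / (2 * lam ^ 2) -
        (Real.exp p - 1 - p - p ^ 2 / 2)) := by
    rw [eslLoss_eq, eslLoss_eq, e1, eslHess, real_inner_self_eq_norm_sq, ← hs, ← ht, hp]
    field_simp
    ring
  rw [e2, abs_mul, abs_of_pos (eslWeight_pos w)]
  have h3 : |(4 * s * t ^ 2 - t ^ 4) / (2 * lam ^ 2)| ≤ (4 * M + 1) / (2 * lam ^ 2) * t ^ 3 := by
    rw [abs_div, abs_of_pos (show 0 < 2 * lam ^ 2 by positivity), div_mul_eq_mul_div]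
    gcongr
    refine (abs_sub _ _).trans ?_
    rw [abs_mul, abs_mul, abs_of_nonneg (by positivity : 0 ≤ t ^ 2),
      abs_of_nonneg (by positivity : 0 ≤ t ^ 4), abs_of_pos (by norm_num : (0 : ℝ) < 4)]
    have : t ^ 4 ≤ t ^ 3 := pow_le_pow_of_le_one hΔ0 hΔ1 (by norm_num)
    have : |s| * t ^ 2 ≤ M * t * t ^ 2 := by gcongr
    nlinarith
  calc _ ≤ 1 * (|(4 * s * t ^ 2 - t ^ 4) / (2 * lam ^ 2)| + |Real.exp p - 1 - p - p ^ 2 / 2|) := by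
        gcongr
        · exact eslWeight_le_one hl w
        · exact abs_sub _ _
    _ ≤ 1 * ((4 * M + 1) / (2 * lam ^ 2) * t ^ 3 + (c * t) ^ 3) := by
        gcongr
        exact hexp.trans (by gcongr)
    _ = _ := by ring

end Loss

/-- The first-order condition in the form used twice: a linear term of either sign cannot be
dominated by a quadratic one near 0. -/
theorem eq_zero_of_mul_le_sq {L K r : ℝ} (hr : 0 < r) (h : ∀ t, |t| ≤ r → t * L ≤ K * t ^ 2) :
    L = 0 := by
  by_contra hL
  have hK : 0 < |K| + 1 := by positivity
  have hLp : 0 < |L| := abs_pos.2 hL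
  set t := min r (|L| / (2 * (|K| + 1))) with ht
  have ht0 : 0 < t := lt_min hr (by positivity)
  have h1 : t * |L| ≤ K * t ^ 2 := by
    rcases abs_cases L with ⟨e, -⟩ | ⟨e, -⟩
    · rw [e]; exact h t (by rw [abs_of_pos ht0]; exact min_le_left _ _)
    · have := h (-t) (by rw [abs_neg, abs_of_pos ht0]; exact min_le_left _ _)
      rw [e]; linarith [neg_sq t, this]
  have h2 : t * (|K| + 1) ≤ |L| / 2 := by
    calc _ ≤ |L| / (2 * (|K| + 1)) * (|K| + 1) := by gcongr; exact min_le_right _ _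
      _ = |L| / 2 := by field_simp
  have h3 : |L| ≤ K * t := by
    rw [pow_two, ← mul_assoc] at h1
    exact le_of_mul_le_mul_right (by linarith) ht0
  have h4 : K * t ≤ t * (|K| + 1) := by nlinarith [le_abs_self K]
  linarith

/-! ### The link at the true parameter is a multiple of the mean curve. -/

section Radius

variable {d : ℕ} {f : ℝ → ℝ} {κ lam : ℝ}

/-- `ρ` is the signed length of the unique minimiser of the expected loss under the angular laws. -/
def IsLocationRadius (d : ℕ) (f : ℝ → ℝ) (κ lam ρ : ℝ) : Prop :=
  ∀ v : Euc d, ‖v‖ = 1 → ∀ a, a ≠ ρ • v →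
    ∫ y, eslLoss lam (y - ρ • v) ∂(angularLaw f κ v) < ∫ y, eslLoss lam (y - a) ∂(angularLaw f κ v)

theorem integral_eslLoss_isometry [NeZero d] (hf0 : ∀ x, 0 ≤ f x) (hf : Monotone f)
    (O : Euc d ≃ₗᵢ[ℝ] Euc d) (v a : Euc d) :
    ∫ y, eslLoss lam (y - O a) ∂(angularLaw f κ (O v)) =
      ∫ y, eslLoss lam (y - a) ∂(angularLaw f κ v) := by
  rw [integral_angularLaw_isometry hf0 hf]
  simp_rw [← map_sub, eslLoss, LinearIsometryEquiv.norm_map]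

/-- Reflection in the line ℝv preserves the law and hence the risk, so by uniqueness it fixes a₀,
which therefore lies on that line. Isometries carry v to every other unit vector with the same
scalar ρ. -/
theorem exists_isLocationRadius [NeZero d] (hf0 : ∀ x, 0 ≤ f x) (hf : Monotone f) {v a₀ : Euc d}
    (hv : ‖v‖ = 1) (h : ∀ a, a ≠ a₀ → ∫ y, eslLoss lam (y - a₀) ∂(angularLaw f κ v) <
      ∫ y, eslLoss lam (y - a) ∂(angularLaw f κ v)) :
    ∃ ρ : ℝ, a₀ = ρ • v ∧ IsLocationRadius d f κ lam ρ := by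
  have h1 : (ℝ ∙ v).reflection a₀ = a₀ := by
    by_contra hne
    have h2 := h _ hne
    have hOv : (ℝ ∙ v).reflection v = v :=
      Submodule.reflection_mem_subspace_eq_self (Submodule.mem_span_singleton_self v)
    have h3 := integral_eslLoss_isometry (lam := lam) (κ := κ) hf0 hf (ℝ ∙ v).reflection v a₀
    rw [hOv] at h3
    exact h2.ne' h3
  rw [Submodule.reflection_eq_self_iff, Submodule.mem_span_singleton] at h1
  obtain ⟨ρ, rfl⟩ := h1
  refine ⟨ρ, rfl, fun w hw a ha => ?_⟩
  obtain ⟨O, hO, -⟩ := exists_isometry_map (hv.trans hw.symm)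
  have h4 : O.symm a ≠ ρ • v := fun h5 => ha (by
    rw [← O.apply_symm_apply a, h5, map_smul, hO])
  have h6 := h _ h4
  rw [← integral_eslLoss_isometry hf0 hf O, ← integral_eslLoss_isometry hf0 hf O v (O.symm a)] at h6
  rwa [map_smul, hO, O.apply_symm_apply] at h6

theorem IsLocationRadius.le {ρ : ℝ} (h : IsLocationRadius d f κ lam ρ) {v : Euc d} (hv : ‖v‖ = 1)
    (a : Euc d) : ∫ y, eslLoss lam (y - ρ • v) ∂(angularLaw f κ v) ≤
      ∫ y, eslLoss lam (y - a) ∂(angularLaw f κ v) := by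
  rcases eq_or_ne a (ρ • v) with rfl | ha
  · exact le_rfl
  · exact (h v hv a ha).le

theorem norm_sub_le_of_unit {y v : Euc d} (hy : ‖y‖ = 1) (hv : ‖v‖ = 1) (ρ : ℝ) :
    ‖y - ρ • v‖ ≤ 1 + |ρ| := by
  refine (norm_sub_le _ _).trans ?_
  rw [hy, norm_smul, hv, mul_one, Real.norm_eq_abs]

theorem IsLocationRadius.stationary {ρ : ℝ} (h : IsLocationRadius d f κ lam ρ) (hl : 0 < lam)
    {v : Euc d} (hv : ‖v‖ = 1) [IsProbabilityMeasure (angularLaw f κ v)] (a : Euc d) :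
    ∫ y, eslWeight lam (y - ρ • v) * inner ℝ (y - ρ • v) a ∂(angularLaw f κ v) = 0 := by
  obtain ⟨C, hC, r, hr, hT⟩ := eslLoss_taylor (d := d) hl (M := 1 + |ρ|) (by positivity)
  set H := (2 / lam + 4 / lam ^ 2 * (1 + |ρ|) ^ 2) with hH
  have hH0 : 0 ≤ H := by positivity
  set r' := min 1 (r / (‖a‖ + 1)) with hr'
  have hcw := continuous_eslWeight (d := d) (lam := lam)
  have hcl := continuous_eslLoss (d := d) (lam := lam)
  have key : ∀ t, |t| ≤ r' → t * (2 / lam *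
      ∫ y, eslWeight lam (y - ρ • v) * inner ℝ (y - ρ • v) a ∂(angularLaw f κ v)) ≤
      (C * ‖a‖ ^ 3 + H * ‖a‖ ^ 2) * t ^ 2 := by
    intro t ht
    have ht1 : |t| ≤ 1 := ht.trans (min_le_left _ _)
    have htr : ‖t • a‖ ≤ r := by
      rw [norm_smul, Real.norm_eq_abs]
      calc |t| * ‖a‖ ≤ r / (‖a‖ + 1) * (‖a‖ + 1) := by
            gcongr
            · exact ht.trans (min_le_right _ _)
            · linarith
        _ = r := by field_simp
    have h1 : ∫ y, (eslLoss lam (y - (ρ • v + t • a)) - eslLoss lam (y - ρ • v) +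
        t * (2 / lam * (eslWeight lam (y - ρ • v) * inner ℝ (y - ρ • v) a)))
          ∂(angularLaw f κ v) ≤ ∫ y, (C * ‖a‖ ^ 3 + H * ‖a‖ ^ 2) * t ^ 2 ∂(angularLaw f κ v) := by
      refine integral_mono_ae (integrable_angularLaw (by fun_prop)) (integrable_const _) ?_
      filter_upwards [ae_angularLaw_norm] with y hy
      have hw := norm_sub_le_of_unit hy hv ρ
      have h2 := hT (y - ρ • v) (t • a) hw htr
      have h3 := abs_eslHess_le hl hw (t • a) (t • a)
      rw [← hH, norm_smul, Real.norm_eq_abs] at h3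
      rw [norm_smul, Real.norm_eq_abs, inner_smul_right, sub_sub] at h2
      have h4 := (abs_le.1 h2).2
      have h5 := (abs_le.1 h3).2
      have h6 : C * (|t| * ‖a‖) ^ 3 ≤ C * ‖a‖ ^ 3 * t ^ 2 := by
        have : |t| ^ 3 ≤ |t| ^ 2 := pow_le_pow_of_le_one (abs_nonneg t) ht1 (by norm_num)
        rw [sq_abs] at this
        calc C * (|t| * ‖a‖) ^ 3 = C * ‖a‖ ^ 3 * |t| ^ 3 := by ring
          _ ≤ _ := by gcongr
      have h7 : H * (|t| * ‖a‖ * (|t| * ‖a‖)) = H * ‖a‖ ^ 2 * t ^ 2 := by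
        rw [← sq_abs t]; ring
      have h8 : 0 ≤ H * ‖a‖ ^ 2 * t ^ 2 := by positivity
      linarith
    rw [integral_add (integrable_angularLaw (by fun_prop)) (integrable_angularLaw (by fun_prop)),
      integral_sub (integrable_angularLaw (by fun_prop)) (integrable_angularLaw (by fun_prop)),
      integral_const_mul, integral_const_mul, integral_const] at h1
    simp only [probReal_univ, one_smul] at h1
    linarith [h.le hv (ρ • v + t • a)]
  have := eq_zero_of_mul_le_sq (lt_min one_pos (by positivity)) key
  exact (mul_eq_zero.1 this).resolve_left (by positivity)

variable {q : ℕ} {PX : Measure (Euc (q + 1))} [IsProbabilityMeasure PX] {θ₀ : Euc q} {m : ℝ → Euc d}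
  {P : Measure (Euc (q + 1) × Euc d)} [IsProbabilityMeasure P] {𝒳 : Set (Euc (q + 1))}
  {μ : Euc q → ℝ → Euc d}

theorem IsSmoothFamily.contDiff_link (hμ : IsSmoothFamily μ) {θ : Euc q} (hθ : θ ∈ paramSpace q) :
    ContDiff ℝ 1 (μ θ) := by
  have : ContDiffOn ℝ 1 (fun u : ℝ => μ θ u) univ := by
    refine ContDiffOn.comp (t := paramSpace q ×ˢ univ) (g := fun w : Euc q × ℝ => μ w.1 w.2)
      (f := fun u => (θ, u)) hμ (by fun_prop) ?_
    intro u _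
    exact ⟨hθ, mem_univ _⟩
  exact contDiffOn_univ.1 this

/-- One typical index value determines ρ. The identity then holds almost everywhere by uniqueness of
minimisers, and on all of the support because it defines a closed set of full measure. -/
theorem IsGoodModel.exists_radius [NeZero d] (h : IsGoodModel PX 𝒳 θ₀ m f κ P)
    (hlink : IsLinkFamily (eslLoss lam) P μ) (hμ : IsSmoothFamily μ) (hθ₀ : θ₀ ∈ paramSpace q) :
    ∃ ρ : ℝ, IsLocationRadius d f κ lam ρ ∧
      ∀ u ∈ (PX.map (projIndex θ₀)).support, μ θ₀ u = ρ • m u := by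
  have hc := (continuous_projIndex θ₀).measurable
  have : IsProbabilityMeasure (PX.map (projIndex θ₀)) :=
    Measure.isProbabilityMeasure_map hc.aemeasurable
  have h1 := hlink θ₀ hθ₀
  rw [h.indexLaw_eq] at h1
  have h2 : ∀ᵐ u ∂(PX.map (projIndex θ₀)), u ∈ (PX.map (projIndex θ₀)).support :=
    Measure.support_mem_ae
  have h3 : ∀ᵐ u ∂(PX.map (projIndex θ₀)), ‖m u‖ = 1 ∧ ∀ a, a ≠ μ θ₀ u →
      ∫ y, eslLoss lam (y - μ θ₀ u) ∂(angularLaw f κ (m u)) <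
        ∫ y, eslLoss lam (y - a) ∂(angularLaw f κ (m u)) := by
    filter_upwards [h1, h2, h.condLawY_eq] with u h1 h2 h4
    rw [h4] at h1
    exact ⟨h.unit u h2, h1⟩
  obtain ⟨u₀, hu₀, hmin⟩ := h3.exists
  obtain ⟨ρ, -, hρ⟩ := exists_isLocationRadius h.nonneg h.mono hu₀ hmin
  refine ⟨ρ, hρ, fun u hu => ?_⟩
  have hcl : IsClosed {u | μ θ₀ u = ρ • m u} :=
    isClosed_eq (hμ.contDiff_link hθ₀).continuous (h.contDiff.continuous.const_smul ρ)
  refine Measure.support_subset_of_isClosed hcl ?_ hu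
  filter_upwards [h3] with u h5
  by_contra hne
  exact lt_asymm (hρ (m u) h5.1 (μ θ₀ u) hne) (h5.2 (ρ • m u) (Ne.symm hne))

end Radius

/-! ### First-order expansion uniform over a compact set of covariates. -/

section UniformDifferentiability

variable {V X F : Type*} [NormedAddCommGroup V] [NormedSpace ℝ V] [NormedAddCommGroup X]
  [NormedSpace ℝ X] [NormedAddCommGroup F] [NormedSpace ℝ F]

/-- The partial derivative in the first variable. -/
noncomputable def fderivFst (A : V × X → F) (e : V) (x : X) : V →L[ℝ] F :=
  (fderiv ℝ A (e, x)).comp (ContinuousLinearMap.inl ℝ V X)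

theorem continuousOn_fderivFst {A : V × X → F} {O : Set V} (hO : IsOpen O)
    (hA : ContDiffOn ℝ 1 A (O ×ˢ univ)) :
    ContinuousOn (fun p : V × X => fderivFst A p.1 p.2) (O ×ˢ univ) :=
  (hA.continuousOn_fderiv_of_isOpen (hO.prod isOpen_univ) le_rfl).clm_comp continuousOn_const

theorem continuous_fderivFst {A : V × X → F} {O : Set V} (hO : IsOpen O) {e : V} (he : e ∈ O)
    (hA : ContDiffOn ℝ 1 A (O ×ˢ univ)) : Continuous (fderivFst A e) :=
  (continuousOn_fderivFst hO hA).comp_continuous (f := fun x => (e, x)) (by fun_prop)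
    fun _ => ⟨he, mem_univ _⟩

theorem hasFDerivAt_fderivFst {A : V × X → F} {O : Set V} (hO : IsOpen O) {e : V} (he : e ∈ O)
    (hA : ContDiffOn ℝ 1 A (O ×ˢ univ)) (x : X) :
    HasFDerivAt (fun e => A (e, x)) (fderivFst A e x) e := by
  have h1 : DifferentiableAt ℝ A (e, x) :=
    (hA.differentiableOn one_ne_zero).differentiableAt ((hO.prod isOpen_univ).mem_nhds ⟨he, mem_univ _⟩)
  exact h1.hasFDerivAt.comp e (hasFDerivAt_prodMk_left e x)

/-- Joint continuity of the partial derivative and compactness of K make it uniformly close to its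
value at e₀; the mean value inequality on a ball integrates this. -/
theorem eventually_forall_norm_sub_fderivFst_le {A : V × X → F} {O : Set V} (hO : IsOpen O) {e₀ : V}
    (he₀ : e₀ ∈ O) (hA : ContDiffOn ℝ 1 A (O ×ˢ univ)) {K : Set X} (hK : IsCompact K) {η : ℝ}
    (hη : 0 < η) :
    ∀ᶠ e in 𝓝 e₀, ∀ x ∈ K, ‖A (e, x) - A (e₀, x) - fderivFst A e₀ x (e - e₀)‖ ≤ η * ‖e - e₀‖ := by
  have h1 : ∀ᶠ e in 𝓝 e₀, ∀ x ∈ K, ‖fderivFst A e x - fderivFst A e₀ x‖ < η := by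
    refine hK.eventually_forall_of_forall_eventually
      (P := fun e x => ‖fderivFst A e x - fderivFst A e₀ x‖ < η) fun x _ => ?_
    have hc : ContinuousAt (fun p : V × X => ‖fderivFst A p.1 p.2 - fderivFst A e₀ p.2‖) (e₀, x) := by
      refine ContinuousAt.norm (ContinuousAt.sub ?_ ?_)
      · exact (continuousOn_fderivFst hO hA).continuousAt
          ((hO.prod isOpen_univ).mem_nhds ⟨he₀, mem_univ _⟩)
      · exact ((continuous_fderivFst hO he₀ hA).comp continuous_snd).continuousAt
    exact hc.eventually_lt continuousAt_const (by simpa using hη)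
  obtain ⟨r, hr, hball⟩ := Metric.eventually_nhds_iff_ball.1 (h1.and (hO.mem_nhds he₀))
  filter_upwards [Metric.ball_mem_nhds e₀ hr] with e he x hx
  have h2 := (convex_ball e₀ r).norm_image_sub_le_of_norm_hasFDerivWithin_le
    (f := fun e => A (e, x) - fderivFst A e₀ x e) (f' := fun e => fderivFst A e x - fderivFst A e₀ x)
    (C := η) (x := e₀) (y := e)
    (fun e he => ((hasFDerivAt_fderivFst hO (hball e he).2 hA x).sub
      (fderivFst A e₀ x).hasFDerivAt).hasFDerivWithinAt)
    (fun e he => ((hball e he).1 x hx).le) (Metric.mem_ball_self hr) he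
  rw [map_sub]
  convert h2 using 2
  abel

end UniformDifferentiability

/-! ### Second-order expansion of the risk for a merely C¹ family. -/

section Expansion

variable {q d : ℕ} {f : ℝ → ℝ} {κ lam ρ : ℝ} {PX : Measure (Euc (q + 1))} [IsProbabilityMeasure PX]
  {θ₀ : Euc q} {m : ℝ → Euc d} {P : Measure (Euc (q + 1) × Euc d)} [IsProbabilityMeasure P]
  {𝒳 : Set (Euc (q + 1))}

theorem IsGoodModel.integrable (h : IsGoodModel PX 𝒳 θ₀ m f κ P) {F : Type*} [NormedAddCommGroup F]
    {g : Euc (q + 1) × Euc d → F} (hg : Continuous g) : Integrable g P := by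
  obtain ⟨C, hC⟩ := (h.compact.prod (isCompact_sphere (0 : Euc d) 1)).exists_bound_of_continuousOn
    hg.continuousOn
  refine Integrable.of_bound hg.aestronglyMeasurable C ?_
  filter_upwards [h.ae_mem] with z hz
  exact hC z ⟨hz.1, by simpa using hz.2⟩

variable {V : Type*} [NormedAddCommGroup V] [NormedSpace ℝ V] {A : V → Euc (q + 1) → Euc d} {e₀ : V}
  {L : Euc (q + 1) → V →L[ℝ] Euc d}

theorem IsGoodModel.integral_stationary (h : IsGoodModel PX 𝒳 θ₀ m f κ P) (hl : 0 < lam)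
    (hρ : IsLocationRadius d f κ lam ρ) {a b : Euc (q + 1) → Euc d} (ha : Continuous a)
    (hb : Continuous b) (ha0 : ∀ x ∈ 𝒳, a x = ρ • m (projIndex θ₀ x)) :
    ∫ z, eslWeight lam (z.2 - a z.1) * inner ℝ (z.2 - a z.1) (b z.1) ∂P = 0 := by
  have hcw := continuous_eslWeight (d := d) (lam := lam)
  rw [h.integral (h.integrable (by fun_prop))]
  rw [integral_congr_ae (g := fun _ => (0 : ℝ)), integral_zero]
  filter_upwards [h.mem_ae] with x hx
  have hu := h.unit_of_mem hx
  have := h.isProb hu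
  simp only [ha0 x hx]
  exact hρ.stationary hl hu (b x)

/-- The family is only C¹, so the risk is not differentiated twice under the integral. Instead the
loss is expanded in the true increment Δ = A(e, x) - A(e₀, x). Its gradient term integrates to
exactly 0 by conditional stationarity, and only the quadratic term is linearised, which needs one
derivative of A. -/
theorem IsGoodModel.risk_expansion (h : IsGoodModel PX 𝒳 θ₀ m f κ P) (hl : 0 < lam)
    (hρ : IsLocationRadius d f κ lam ρ) (hA0 : ∀ x ∈ 𝒳, A e₀ x = ρ • m (projIndex θ₀ x))
    (hA : ∀ᶠ e in 𝓝 e₀, Continuous (A e)) (hL : Continuous L)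
    (hu : ∀ η > 0, ∀ᶠ e in 𝓝 e₀, ∀ x ∈ 𝒳, ‖A e x - A e₀ x - L x (e - e₀)‖ ≤ η * ‖e - e₀‖) :
    (fun e => (∫ z, eslLoss lam (z.2 - A e z.1) ∂P) - (∫ z, eslLoss lam (z.2 - A e₀ z.1) ∂P) -
      (∫ z, eslHess lam (z.2 - A e₀ z.1) (L z.1 (e - e₀)) (L z.1 (e - e₀)) ∂P) / 2)
      =o[𝓝 e₀] fun e => ‖e - e₀‖ ^ 2 := by
  have hcw := continuous_eslWeight (d := d) (lam := lam)
  have hcl := continuous_eslLoss (d := d) (lam := lam)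
  have hA0c := hA.self_of_nhds
  obtain ⟨B, hB⟩ := h.compact.exists_bound_of_continuousOn hL.continuousOn
  set B' := |B| with hB'
  have hLB : ∀ x ∈ 𝒳, ∀ k, ‖L x k‖ ≤ B' * ‖k‖ := fun x hx k =>
    ((L x).le_opNorm k).trans (by gcongr; exact (hB x hx).trans (le_abs_self B))
  have hB0 : 0 ≤ B' := abs_nonneg B
  set M := 1 + |ρ| with hM
  obtain ⟨C, hC, r, hr, hT⟩ := eslLoss_taylor (d := d) hl (M := M) (by positivity)
  set H := 2 / lam + 4 / lam ^ 2 * M ^ 2 with hH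
  have hH0 : 0 ≤ H := by positivity
  rw [Asymptotics.isLittleO_iff]
  intro c hc
  have hη : 0 < min 1 (c / (2 * H * (B' + 1) + 1)) := by positivity
  have hs : 0 < min (r / (B' + 1)) (c / (2 * (C * (B' + 1) ^ 3) + 1)) := by positivity
  filter_upwards [hA, hu _ hη, Metric.ball_mem_nhds e₀ hs] with e heA he heb
  set k := e - e₀ with hk
  have hks : ‖k‖ < min (r / (B' + 1)) (c / (2 * (C * (B' + 1) ^ 3) + 1)) := by
    rwa [hk, ← dist_eq_norm]
  have hk1 : (B' + 1) * ‖k‖ ≤ r := by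
    have := hks.le.trans (min_le_left _ _)
    rw [le_div_iff₀ (by positivity)] at this
    linarith
  have hk2 : C * (B' + 1) ^ 3 * ‖k‖ ≤ c / 2 := by
    have := hks.le.trans (min_le_right _ _)
    rw [le_div_iff₀ (by positivity)] at this
    nlinarith [norm_nonneg k]
  set η := min 1 (c / (2 * H * (B' + 1) + 1)) with hηdef
  have hη1 : η ≤ 1 := min_le_left _ _
  have hη2 : H * (B' + 1) * η ≤ c / 2 := by
    have := min_le_right 1 (c / (2 * H * (B' + 1) + 1))
    rw [← hηdef, le_div_iff₀ (by positivity)] at this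
    nlinarith
  have hcont2 : Continuous fun z : Euc (q + 1) × Euc d =>
      eslHess lam (z.2 - A e₀ z.1) (L z.1 k) (L z.1 k) :=
    continuous_eslHess.comp (f := fun z : Euc (q + 1) × Euc d => (z.2 - A e₀ z.1, L z.1 k, L z.1 k))
      (by fun_prop)
  -- Stationarity is tested against the full increment: it holds for any continuous function of x,
  -- linear in e - e₀ or not.
  have hst := h.integral_stationary hl hρ hA0c (b := fun x => A e x - A e₀ x) (by fun_prop) hA0
  have i1 : Integrable (fun z => eslLoss lam (z.2 - A e z.1)) P := h.integrable (by fun_prop)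
  have i2 : Integrable (fun z => eslLoss lam (z.2 - A e₀ z.1)) P := h.integrable (by fun_prop)
  have i3 : Integrable (fun z => 2 / lam * (eslWeight lam (z.2 - A e₀ z.1) *
      inner ℝ (z.2 - A e₀ z.1) (A e z.1 - A e₀ z.1))) P := h.integrable (by fun_prop)
  have i4 : Integrable (fun z : Euc (q + 1) × Euc d =>
      eslHess lam (z.2 - A e₀ z.1) (L z.1 k) (L z.1 k) / 2) P :=
    (h.integrable hcont2).div_const 2
  have e1 : (∫ z, eslLoss lam (z.2 - A e z.1) ∂P) - (∫ z, eslLoss lam (z.2 - A e₀ z.1) ∂P) -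
      (∫ z, eslHess lam (z.2 - A e₀ z.1) (L z.1 k) (L z.1 k) ∂P) / 2 =
      ∫ z, (eslLoss lam (z.2 - A e z.1) - eslLoss lam (z.2 - A e₀ z.1) +
        2 / lam * (eslWeight lam (z.2 - A e₀ z.1) *
          inner ℝ (z.2 - A e₀ z.1) (A e z.1 - A e₀ z.1)) -
        eslHess lam (z.2 - A e₀ z.1) (L z.1 k) (L z.1 k) / 2) ∂P := by
    have i12 : Integrable (fun z => eslLoss lam (z.2 - A e z.1) - eslLoss lam (z.2 - A e₀ z.1)) P :=
      i1.sub i2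
    have i123 : Integrable (fun z => eslLoss lam (z.2 - A e z.1) - eslLoss lam (z.2 - A e₀ z.1) +
        2 / lam * (eslWeight lam (z.2 - A e₀ z.1) *
          inner ℝ (z.2 - A e₀ z.1) (A e z.1 - A e₀ z.1))) P := i12.add i3
    rw [integral_sub i123 i4, integral_add i12 i3, integral_sub i1 i2,
      integral_const_mul, hst, integral_div]
    ring
  rw [e1]
  have hb : ∀ᵐ z ∂P, ‖eslLoss lam (z.2 - A e z.1) - eslLoss lam (z.2 - A e₀ z.1) +
        2 / lam * (eslWeight lam (z.2 - A e₀ z.1) *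
          inner ℝ (z.2 - A e₀ z.1) (A e z.1 - A e₀ z.1)) -
        eslHess lam (z.2 - A e₀ z.1) (L z.1 k) (L z.1 k) / 2‖ ≤ c * ‖k‖ ^ 2 := by
    filter_upwards [h.ae_mem] with z hz
    have hun := h.unit_of_mem hz.1
    have hw : ‖z.2 - A e₀ z.1‖ ≤ M := by
      rw [hA0 _ hz.1]; exact norm_sub_le_of_unit hz.2 hun ρ
    set w := z.2 - A e₀ z.1 with hwdef
    set Δ := A e z.1 - A e₀ z.1 with hΔ
    set Λ := L z.1 k with hΛ
    have hd := he z.1 hz.1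
    have hΛn := hLB z.1 hz.1 k
    have hΔn : ‖Δ‖ ≤ (B' + 1) * ‖k‖ := by
      have : Δ = Λ + (Δ - Λ) := by abel
      rw [this]
      refine (norm_add_le _ _).trans ?_
      have : ‖Δ - Λ‖ ≤ 1 * ‖k‖ := hd.trans (by gcongr)
      linarith
    have hΔr := hΔn.trans hk1
    have t1 := hT w Δ hw hΔr
    have e2 : w - Δ = z.2 - A e z.1 := by rw [hwdef, hΔ]; abel
    rw [e2] at t1
    have e3 : eslHess lam w Δ Δ - eslHess lam w Λ Λ =
        eslHess lam w (Δ - Λ) Δ + eslHess lam w Λ (Δ - Λ) := by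
      have h1 : eslHess lam w Δ Δ = eslHess lam w (Δ - Λ) Δ + eslHess lam w Λ Δ := by
        rw [← eslHess_add_left, sub_add_cancel]
      have h2 : eslHess lam w Λ Δ = eslHess lam w Λ (Δ - Λ) + eslHess lam w Λ Λ := by
        rw [← eslHess_add_right, sub_add_cancel]
      rw [h1, h2]; ring
    have t2 : |eslHess lam w Δ Δ - eslHess lam w Λ Λ| ≤ c * ‖k‖ ^ 2 := by
      rw [e3]
      refine (abs_add_le _ _).trans ?_
      have s1 := abs_eslHess_le hl hw (Δ - Λ) Δ
      have s2 := abs_eslHess_le hl hw Λ (Δ - Λ)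
      rw [← hH] at s1 s2
      have s3 : ‖Δ - Λ‖ * ‖Δ‖ ≤ η * ‖k‖ * ((B' + 1) * ‖k‖) := by gcongr
      have s4 : ‖Λ‖ * ‖Δ - Λ‖ ≤ (B' + 1) * ‖k‖ * (η * ‖k‖) := by
        gcongr
        exact hΛn.trans (by gcongr; linarith)
      calc _ ≤ H * (η * ‖k‖ * ((B' + 1) * ‖k‖)) + H * ((B' + 1) * ‖k‖ * (η * ‖k‖)) :=
            add_le_add (s1.trans (by gcongr)) (s2.trans (by gcongr))
        _ = 2 * (H * (B' + 1) * η) * ‖k‖ ^ 2 := by ring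
        _ ≤ 2 * (c / 2) * ‖k‖ ^ 2 := by gcongr
        _ = _ := by ring
    have t3 : C * ‖Δ‖ ^ 3 ≤ c / 2 * ‖k‖ ^ 2 := by
      calc C * ‖Δ‖ ^ 3 ≤ C * ((B' + 1) * ‖k‖) ^ 3 := by gcongr
        _ = C * (B' + 1) ^ 3 * ‖k‖ * ‖k‖ ^ 2 := by ring
        _ ≤ _ := by gcongr
    rw [Real.norm_eq_abs]
    rw [abs_le] at t1 t2 ⊢
    constructor <;> linarith [t1.1, t1.2, t2.1, t2.2]
  refine (norm_integral_le_of_norm_le_const hb).trans ?_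
  simp

end Expansion

/-! ### Derivatives of the index and of the link along the index. -/

section Parametrization

variable {q d : ℕ}

theorem isOpen_paramSpace : IsOpen (paramSpace q) :=
  isOpen_lt (by fun_prop) continuous_const

theorem contDiffOn_betaVec : ContDiffOn ℝ 1 (betaVec (q := q)) (paramSpace q) := by
  rw [contDiffOn_piLp]
  intro i
  refine Fin.cases ?_ (fun i => ?_) i
  · have : ContDiffOn ℝ 1 (fun θ : Euc q => √(1 - ‖θ‖ ^ 2)) (paramSpace q) := by
      refine ContDiffOn.sqrt ?_ fun θ hθ => ?_
      · exact (contDiff_const.sub (contDiff_norm_sq ℝ)).contDiffOn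
      · have : ‖θ‖ ^ 2 < 1 := hθ
        linarith
    exact this
  · have : ContDiff ℝ 1 (fun θ : Euc q => θ i) := by fun_prop
    exact this.contDiffOn

theorem fderiv_betaVec_apply {θ : Euc q} (hθ : θ ∈ paramSpace q) (k : Euc q) (i : Fin (q + 1)) :
    fderiv ℝ betaVec θ k i = (jacobianBeta θ *ᵥ (fun j => k j)) i := by
  have hd : DifferentiableAt ℝ betaVec θ :=
    (contDiffOn_betaVec.differentiableOn one_ne_zero).differentiableAt (isOpen_paramSpace.mem_nhds hθ)
  have h1 : HasFDerivAt (fun θ : Euc q => betaVec θ i)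
      ((EuclideanSpace.proj i).comp (fderiv ℝ betaVec θ)) θ :=
    (EuclideanSpace.proj (𝕜 := ℝ) i).hasFDerivAt.comp θ hd.hasFDerivAt
  have h2 : fderiv ℝ betaVec θ k i = ((EuclideanSpace.proj i).comp (fderiv ℝ betaVec θ)) k := rfl
  rw [h2]
  have hpos : 0 < 1 - ‖θ‖ ^ 2 := sub_pos.2 hθ
  refine Fin.cases (fun h1 => ?_) (fun i h1 => ?_) i h1
  · have h3 : HasFDerivAt (fun θ : Euc q => √(1 - ‖θ‖ ^ 2)) _ θ :=
      ((hasStrictFDerivAt_norm_sq θ).hasFDerivAt.const_sub 1).sqrt hpos.ne'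
    have h4 : HasFDerivAt (fun θ : Euc q => betaVec θ 0) _ θ := h3
    rw [h1.unique h4]
    have hs : 0 < √(1 - ‖θ‖ ^ 2) := Real.sqrt_pos.2 hpos
    simp [jacobianBeta, Matrix.mulVec, dotProduct, PiLp.inner_apply, Finset.mul_sum]
    rw [← Finset.sum_neg_distrib]
    refine Finset.sum_congr rfl fun j _ => ?_
    field_simp
  · have h3 : HasFDerivAt (fun θ : Euc q => θ i) (EuclideanSpace.proj i : Euc q →L[ℝ] ℝ) θ :=
      (EuclideanSpace.proj (𝕜 := ℝ) i).hasFDerivAt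
    have h4 : HasFDerivAt (F := ℝ) (fun θ : Euc q => betaVec θ i.succ)
      (EuclideanSpace.proj i : Euc q →L[ℝ] ℝ) θ := h3
    rw [h1.unique h4]
    simp [jacobianBeta, Matrix.mulVec, dotProduct]

theorem contDiffOn_projIndex :
    ContDiffOn ℝ 1 (fun p : Euc q × Euc (q + 1) => projIndex p.1 p.2) (paramSpace q ×ˢ univ) := by
  unfold projIndex
  refine ContDiffOn.inner ℝ contDiff_snd.contDiffOn ?_
  exact contDiffOn_betaVec.comp contDiff_fst.contDiffOn fun p hp => hp.1

/-- The derivative `k ↦ xᵀ J(θ) k` of the index in the parameter. -/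
noncomputable def indexDeriv (θ : Euc q) (x : Euc (q + 1)) : Euc q →L[ℝ] ℝ :=
  (innerSL ℝ x).comp (fderiv ℝ betaVec θ)

theorem indexDeriv_apply (θ : Euc q) (x : Euc (q + 1)) (k : Euc q) :
    indexDeriv θ x k = inner ℝ x (fderiv ℝ betaVec θ k) := rfl

theorem continuous_indexDeriv (θ : Euc q) : Continuous (indexDeriv θ) := by
  unfold indexDeriv; fun_prop

theorem hasFDerivAt_projIndex {θ : Euc q} (hθ : θ ∈ paramSpace q) (x : Euc (q + 1)) :
    HasFDerivAt (fun θ => projIndex θ x) (indexDeriv θ x) θ := by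
  have hd : DifferentiableAt ℝ betaVec θ :=
    (contDiffOn_betaVec.differentiableOn one_ne_zero).differentiableAt (isOpen_paramSpace.mem_nhds hθ)
  exact (innerSL ℝ x).hasFDerivAt.comp θ hd.hasFDerivAt

/-- The derivative in the parameter of `θ ↦ μ_θ(xᵀ β(θ))`. -/
noncomputable def linkDeriv (μ : Euc q → ℝ → Euc d) (θ : Euc q) (x : Euc (q + 1)) :
    Euc q →L[ℝ] Euc d :=
  (fderiv ℝ (fun w : Euc q × ℝ => μ w.1 w.2) (θ, projIndex θ x)).comp
    ((ContinuousLinearMap.id ℝ (Euc q)).prod (indexDeriv θ x))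

variable {μ : Euc q → ℝ → Euc d} {θ₀ : Euc q}

theorem IsSmoothFamily.continuous_fderiv (hμ : IsSmoothFamily μ) (hθ₀ : θ₀ ∈ paramSpace q) :
    Continuous fun u : ℝ => fderiv ℝ (fun w : Euc q × ℝ => μ w.1 w.2) (θ₀, u) :=
  (hμ.continuousOn_fderiv_of_isOpen (isOpen_paramSpace.prod isOpen_univ) le_rfl).comp_continuous
    (f := fun u => (θ₀, u)) (by fun_prop) fun _ => ⟨hθ₀, mem_univ _⟩

theorem IsSmoothFamily.continuous_linkDeriv (hμ : IsSmoothFamily μ) (hθ₀ : θ₀ ∈ paramSpace q) :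
    Continuous (linkDeriv μ θ₀) := by
  have h1 := (hμ.continuous_fderiv hθ₀).comp (continuous_projIndex θ₀)
  have h2 := continuous_indexDeriv θ₀
  have h3 : linkDeriv μ θ₀ = fun x => (fderiv ℝ (fun w : Euc q × ℝ => μ w.1 w.2)
      (θ₀, projIndex θ₀ x)).comp (ContinuousLinearMap.inl ℝ (Euc q) ℝ +
        (ContinuousLinearMap.inr ℝ (Euc q) ℝ).comp (indexDeriv θ₀ x)) := by
    ext1 x
    refine ContinuousLinearMap.ext fun k => ?_
    simp only [linkDeriv, ContinuousLinearMap.comp_apply, ContinuousLinearMap.add_apply]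
    congr 1
    simp
  rw [h3]
  exact h1.clm_comp (continuous_const.add (continuous_const.clm_comp h2))

theorem IsSmoothFamily.hasFDerivAt (hμ : IsSmoothFamily μ) (hθ₀ : θ₀ ∈ paramSpace q) (u : ℝ) :
    HasFDerivAt (fun w : Euc q × ℝ => μ w.1 w.2)
      (fderiv ℝ (fun w : Euc q × ℝ => μ w.1 w.2) (θ₀, u)) (θ₀, u) := by
  have hO : paramSpace q ×ˢ univ ∈ 𝓝 (θ₀, u) :=
    (isOpen_paramSpace.prod isOpen_univ).mem_nhds ⟨hθ₀, mem_univ _⟩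
  exact ((ContDiffOn.differentiableOn hμ one_ne_zero).differentiableAt hO).hasFDerivAt

theorem IsSmoothFamily.hasFDerivAt_link (hμ : IsSmoothFamily μ) (hθ₀ : θ₀ ∈ paramSpace q)
    (x : Euc (q + 1)) :
    HasFDerivAt (fun θ => μ θ (projIndex θ x)) (linkDeriv μ θ₀ x) θ₀ :=
  (hμ.hasFDerivAt hθ₀ (projIndex θ₀ x)).comp (f := fun θ => (θ, projIndex θ x)) θ₀
    ((hasFDerivAt_id θ₀).prodMk (hasFDerivAt_projIndex hθ₀ x))

theorem IsSmoothFamily.linkDeriv_apply (hμ : IsSmoothFamily μ) (hθ₀ : θ₀ ∈ paramSpace q)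
    (x : Euc (q + 1)) (k : Euc q) :
    linkDeriv μ θ₀ x k =
      fderiv ℝ (fun w : Euc q × ℝ => μ w.1 w.2) (θ₀, projIndex θ₀ x) (k, 0) +
        indexDeriv θ₀ x k • deriv (μ θ₀) (projIndex θ₀ x) := by
  have h1 : HasDerivAt (μ θ₀) (fderiv ℝ (fun w : Euc q × ℝ => μ w.1 w.2) (θ₀, projIndex θ₀ x) (0, 1))
      (projIndex θ₀ x) :=
    (hμ.hasFDerivAt hθ₀ (projIndex θ₀ x)).comp_hasDerivAt (f := fun u => (θ₀, u)) _
      ((hasDerivAt_const _ _).prodMk (hasDerivAt_id _))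
  rw [h1.deriv, ← map_smul, ← map_add]
  simp [linkDeriv]

/-- The link family along the index, perturbed in direction `φ(U_θ) v`. -/
noncomputable def perturbedLink (μ : Euc q → ℝ → Euc d) (φ : ℝ → ℝ) (v : Euc d) (e : Euc q × ℝ)
    (x : Euc (q + 1)) : Euc d :=
  μ e.1 (projIndex e.1 x) + e.2 • φ (projIndex e.1 x) • v

/-- The derivative of the perturbed link family. -/
noncomputable def perturbedDeriv (μ : Euc q → ℝ → Euc d) (φ : ℝ → ℝ) (v : Euc d) (θ : Euc q)
    (x : Euc (q + 1)) : Euc q × ℝ →L[ℝ] Euc d :=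
  (linkDeriv μ θ x).comp (ContinuousLinearMap.fst ℝ _ _) +
    (ContinuousLinearMap.snd ℝ (Euc q) ℝ).smulRight (φ (projIndex θ x) • v)

theorem contDiffOn_perturbedLink (hμ : IsSmoothFamily μ) {φ : ℝ → ℝ} (hφ : ContDiff ℝ 1 φ)
    (v : Euc d) : ContDiffOn ℝ 1 (fun p : (Euc q × ℝ) × Euc (q + 1) => perturbedLink μ φ v p.1 p.2)
      ((paramSpace q ×ˢ univ) ×ˢ univ) := by
  have h1 : ContDiffOn ℝ 1 (fun p : (Euc q × ℝ) × Euc (q + 1) => projIndex p.1.1 p.2)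
      ((paramSpace q ×ˢ univ) ×ˢ univ) :=
    contDiffOn_projIndex.comp (f := fun p : (Euc q × ℝ) × Euc (q + 1) => (p.1.1, p.2))
      (by fun_prop) fun p hp => ⟨hp.1.1, mem_univ _⟩
  have h2 : ContDiffOn ℝ 1 (fun p : (Euc q × ℝ) × Euc (q + 1) => μ p.1.1 (projIndex p.1.1 p.2))
      ((paramSpace q ×ˢ univ) ×ˢ univ) :=
    ContDiffOn.comp (g := fun w : Euc q × ℝ => μ w.1 w.2)
      (f := fun p : (Euc q × ℝ) × Euc (q + 1) => (p.1.1, projIndex p.1.1 p.2)) hμ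
      (ContDiffOn.prodMk (by fun_prop) h1) fun p hp => ⟨hp.1.1, mem_univ _⟩
  have h3 : ContDiffOn ℝ 1 (fun p : (Euc q × ℝ) × Euc (q + 1) => φ (projIndex p.1.1 p.2) • v)
      ((paramSpace q ×ˢ univ) ×ˢ univ) :=
    ContDiffOn.smul (hφ.comp_contDiffOn h1) contDiffOn_const
  have h4 : ContDiffOn ℝ 1 (fun p : (Euc q × ℝ) × Euc (q + 1) => p.1.2)
      ((paramSpace q ×ˢ univ) ×ˢ univ) := by fun_prop
  exact h2.add (h4.smul h3)

theorem fderivFst_perturbedLink (hμ : IsSmoothFamily μ) (hθ₀ : θ₀ ∈ paramSpace q) {φ : ℝ → ℝ}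
    (hφ : ContDiff ℝ 1 φ) (v : Euc d) (x : Euc (q + 1)) :
    fderivFst (fun p : (Euc q × ℝ) × Euc (q + 1) => perturbedLink μ φ v p.1 p.2) (θ₀, 0) x =
      perturbedDeriv μ φ v θ₀ x := by
  have h1 := hasFDerivAt_fderivFst (isOpen_paramSpace.prod isOpen_univ) (e := (θ₀, (0 : ℝ)))
    (mk_mem_prod hθ₀ (mem_univ _)) (contDiffOn_perturbedLink hμ hφ v) x
  refine h1.unique ?_
  have h2 : HasFDerivAt (fun e : Euc q × ℝ => μ e.1 (projIndex e.1 x))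
      ((linkDeriv μ θ₀ x).comp (ContinuousLinearMap.fst ℝ _ _)) (θ₀, (0 : ℝ)) :=
    HasFDerivAt.comp (f := Prod.fst) (g := fun θ => μ θ (projIndex θ x)) (θ₀, (0 : ℝ))
      (hμ.hasFDerivAt_link hθ₀ x) hasFDerivAt_fst
  have h3 : HasFDerivAt (fun e : Euc q × ℝ => φ (projIndex e.1 x) • v) _ (θ₀, (0 : ℝ)) :=
    ((((hφ.differentiable one_ne_zero) _).hasFDerivAt.comp (θ₀, (0 : ℝ))
      (HasFDerivAt.comp (f := Prod.fst) (g := fun θ => projIndex θ x) (θ₀, (0 : ℝ))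
        (hasFDerivAt_projIndex hθ₀ x) hasFDerivAt_fst)).smul_const v)
  have h4 : HasFDerivAt (fun e : Euc q × ℝ => e.2 • φ (projIndex e.1 x) • v) _ (θ₀, (0 : ℝ)) :=
    (hasFDerivAt_snd (𝕜 := ℝ)).smul h3
  refine (h2.add h4).congr_fderiv ?_
  refine ContinuousLinearMap.ext fun w => ?_
  simp [perturbedDeriv]

end Parametrization

theorem tendsto_div_sq_of_expansion {V : Type*} [NormedAddCommGroup V] [NormedSpace ℝ V]
    {g Q : V → ℝ} {e₀ : V} (hQ : ∀ (τ : ℝ) h, Q (τ • h) = τ ^ 2 * Q h)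
    (hg : (fun e => g e - g e₀ - Q (e - e₀) / 2) =o[𝓝 e₀] fun e => ‖e - e₀‖ ^ 2) (h : V) :
    Tendsto (fun τ : ℝ => (g (e₀ + τ • h) - g e₀) / τ ^ 2) (𝓝[>] 0) (𝓝 (Q h / 2)) := by
  have hc : Tendsto (fun τ : ℝ => e₀ + τ • h) (𝓝[>] 0) (𝓝 e₀) := by
    have : Continuous fun τ : ℝ => e₀ + τ • h := by fun_prop
    have h2 := (this.tendsto 0).mono_left (nhdsWithin_le_nhds (s := Ioi (0 : ℝ)))
    simpa using h2
  have h1 := hg.comp_tendsto hc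
  have h2 : (fun τ : ℝ => g (e₀ + τ • h) - g e₀ - τ ^ 2 * Q h / 2) =o[𝓝[>] 0]
      fun τ => τ ^ 2 := by
    refine (h1.congr_left fun τ => ?_).trans_isBigO ?_
    · simp [hQ]
    · refine Asymptotics.IsBigO.of_bound (‖h‖ ^ 2) (.of_forall fun τ => ?_)
      simp [norm_smul, mul_pow, mul_comm]
  have h3 := h2.tendsto_div_nhds_zero
  have h4 := h3.add_const (Q h / 2)
  rw [zero_add] at h4
  refine h4.congr' ?_
  filter_upwards [self_mem_nhdsWithin] with τ hτ
  have : τ ≠ 0 := (show (0 : ℝ) < τ from hτ).ne'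
  field_simp
  ring

/-! ### Orthogonality of parameter and link perturbations. -/

section Fit

variable {q d : ℕ} {f : ℝ → ℝ} {κ lam ρ : ℝ} {PX : Measure (Euc (q + 1))} [IsProbabilityMeasure PX]
  {θ₀ : Euc q} {m : ℝ → Euc d} {P : Measure (Euc (q + 1) × Euc d)} [IsProbabilityMeasure P]
  {𝒳 : Set (Euc (q + 1))} {μ : Euc q → ℝ → Euc d}

/-- A population at a fixed concentration, together with its link family. -/
structure IsGoodFit (PX : Measure (Euc (q + 1))) (𝒳 : Set (Euc (q + 1))) (θ₀ : Euc q)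
    (m : ℝ → Euc d) (f : ℝ → ℝ) (κ : ℝ) (P : Measure (Euc (q + 1) × Euc d))
    [IsProbabilityMeasure P] (lam ρ : ℝ) (μ : Euc q → ℝ → Euc d) : Prop
    extends IsGoodModel PX 𝒳 θ₀ m f κ P where
  lam_pos : 0 < lam
  radius : IsLocationRadius d f κ lam ρ
  link : IsLinkFamily (eslLoss lam) P μ
  smooth : IsSmoothFamily μ
  mem_param : θ₀ ∈ paramSpace q
  link_eq : ∀ u ∈ (PX.map (projIndex θ₀)).support, μ θ₀ u = ρ • m u
  posDef : ∀ᵐ u ∂(indexLaw P θ₀), ∀ v : Euc d, v ≠ 0 → 0 < condHessian (eslLoss lam) P μ θ₀ u v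

namespace IsGoodFit

theorem perturbed_expansion (h : IsGoodFit PX 𝒳 θ₀ m f κ P lam ρ μ) {φ : ℝ → ℝ}
    (hφ : ContDiff ℝ 1 φ) (v : Euc d) :
    (fun e => (∫ z, eslLoss lam (z.2 - perturbedLink μ φ v e z.1) ∂P) -
      (∫ z, eslLoss lam (z.2 - perturbedLink μ φ v (θ₀, 0) z.1) ∂P) -
      (∫ z, eslHess lam (z.2 - perturbedLink μ φ v (θ₀, 0) z.1)
        (perturbedDeriv μ φ v θ₀ z.1 (e - (θ₀, 0)))
        (perturbedDeriv μ φ v θ₀ z.1 (e - (θ₀, 0))) ∂P) / 2)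
      =o[𝓝 (θ₀, 0)] fun e => ‖e - (θ₀, 0)‖ ^ 2 := by
  have hO : IsOpen (paramSpace q ×ˢ (univ : Set ℝ)) := isOpen_paramSpace.prod isOpen_univ
  have he₀ : (θ₀, (0 : ℝ)) ∈ paramSpace q ×ˢ (univ : Set ℝ) := ⟨h.mem_param, mem_univ _⟩
  have hA := contDiffOn_perturbedLink h.smooth hφ v
  have hfd := fderivFst_perturbedLink h.smooth h.mem_param hφ v
  refine h.toIsGoodModel.risk_expansion h.lam_pos h.radius ?_ ?_ ?_ ?_
  · intro x hx
    simp [perturbedLink, h.link_eq _ (h.mem_support x hx)]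
  · filter_upwards [hO.mem_nhds he₀] with e he
    exact hA.continuousOn.comp_continuous (f := fun x => (e, x)) (by fun_prop)
      fun x => ⟨he, mem_univ _⟩
  · have := continuous_fderivFst hO he₀ hA
    simpa only [funext hfd] using this
  · intro η hη
    have := eventually_forall_norm_sub_fderivFst_le hO he₀ hA h.compact hη
    simpa only [hfd] using this

/-- The perturbation is a function of U_θ, hence a legitimate competitor in the conditional
minimisation defining μ_θ. This is available at every θ in the parameter space, not only at θ₀. -/
theorem risk_le_perturbed (h : IsGoodFit PX 𝒳 θ₀ m f κ P lam ρ μ) {φ : ℝ → ℝ} (hφ : Continuous φ)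
    (v : Euc d) {θ : Euc q} (hθ : θ ∈ paramSpace q) (t : ℝ) :
    ∫ z, eslLoss lam (z.2 - perturbedLink μ φ v (θ, 0) z.1) ∂P ≤
      ∫ z, eslLoss lam (z.2 - perturbedLink μ φ v (θ, t) z.1) ∂P := by
  have hc := continuous_projIndex (q := q) θ
  have hμc := (h.smooth.contDiff_link hθ).continuous
  have hcl := continuous_eslLoss (d := d) (lam := lam)
  have hmeas : AEMeasurable (fun z : Euc (q + 1) × Euc d => (projIndex θ z.1, z.2)) P := by fun_prop
  have key : ∀ t : ℝ, Integrable (fun w : ℝ × Euc d => eslLoss lam (w.2 - (μ θ w.1 + t • φ w.1 • v)))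
      (indexLaw P θ ⊗ₘ condLawY P θ) ∧
      ∫ z, eslLoss lam (z.2 - perturbedLink μ φ v (θ, t) z.1) ∂P =
        ∫ u, ∫ y, eslLoss lam (y - (μ θ u + t • φ u • v)) ∂(condLawY P θ u) ∂(indexLaw P θ) := by
    intro t
    have hcont : Continuous fun w : ℝ × Euc d => eslLoss lam (w.2 - (μ θ w.1 + t • φ w.1 • v)) := by
      fun_prop
    have hmap : indexLaw P θ ⊗ₘ condLawY P θ =
        P.map (fun z : Euc (q + 1) × Euc d => (projIndex θ z.1, z.2)) :=
      compProd_map_condDistrib measurable_snd.aemeasurable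
    have hint : Integrable (fun w : ℝ × Euc d => eslLoss lam (w.2 - (μ θ w.1 + t • φ w.1 • v)))
        (indexLaw P θ ⊗ₘ condLawY P θ) := by
      rw [hmap, integrable_map_measure hcont.aestronglyMeasurable hmeas]
      exact h.toIsGoodModel.integrable (hcont.comp (by fun_prop))
    have : IsFiniteMeasure (indexLaw P θ) := by unfold indexLaw; infer_instance
    have : IsMarkovKernel (condLawY P θ) := by unfold condLawY; infer_instance
    refine ⟨hint, ?_⟩
    rw [← Measure.integral_compProd hint, hmap, integral_map hmeas hcont.aestronglyMeasurable]
    rfl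
  have : IsFiniteMeasure (indexLaw P θ) := by unfold indexLaw; infer_instance
  have : IsMarkovKernel (condLawY P θ) := by unfold condLawY; infer_instance
  rw [(key 0).2, (key t).2]
  refine integral_mono_ae (key 0).1.integral_compProd (key t).1.integral_compProd ?_
  filter_upwards [h.link θ hθ] with u hu
  simp only [zero_smul, add_zero]
  by_cases ht : μ θ u + t • φ u • v = μ θ u
  · rw [ht]
  · exact (hu _ ht).le

/-- The population Hessian form is orthogonal to perturbations of the link. -/
theorem cross_term (h : IsGoodFit PX 𝒳 θ₀ m f κ P lam ρ μ) {φ : ℝ → ℝ} (hφ : ContDiff ℝ 1 φ)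
    (v : Euc d) (k : Euc q) :
    ∫ z, eslHess lam (z.2 - μ θ₀ (projIndex θ₀ z.1)) (linkDeriv μ θ₀ z.1 k)
      (φ (projIndex θ₀ z.1) • v) ∂P = 0 := by
  have hμ0 : ∀ x, perturbedLink μ φ v (θ₀, 0) x = μ θ₀ (projIndex θ₀ x) := fun x => by
    simp [perturbedLink]
  have hexp := h.perturbed_expansion hφ v
  simp only [hμ0] at hexp
  set Q : Euc q × ℝ → ℝ := fun e => ∫ z, eslHess lam (z.2 - μ θ₀ (projIndex θ₀ z.1))
        (perturbedDeriv μ φ v θ₀ z.1 e) (perturbedDeriv μ φ v θ₀ z.1 e) ∂P with hQdef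
  have hQ : ∀ (τ : ℝ) e, Q (τ • e) = τ ^ 2 * Q e := fun τ e => by
    simp only [hQdef, map_smul, eslHess_smul_left, eslHess_smul_right]
    rw [← integral_const_mul]
    congr 1; ext z; ring
  have hlim := tendsto_div_sq_of_expansion hQ (e₀ := (θ₀, 0)) (g := fun e =>
    ∫ z, eslLoss lam (z.2 - perturbedLink μ φ v e z.1) ∂P) (by simpa only [hμ0] using hexp)
  -- Minimality of μ_θ is compared along θ = θ₀ + τk at order τ². This uses only the expansion at θ₀
  -- and avoids differentiating the first-order condition of μ_θ in θ. As s ↦ Q(k, s) is a quadratic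
  -- polynomial minimised at s = 0, its linear coefficient vanishes.
  have hmono : ∀ s, Q (k, 0) ≤ Q (k, s) := by
    intro s
    have h1 := hlim (k, 0)
    have h2 := hlim (k, s)
    have h3 := le_of_tendsto_of_tendsto h1 h2 ?_
    · linarith
    have hc : Tendsto (fun τ : ℝ => θ₀ + τ • k) (𝓝[>] 0) (𝓝 θ₀) := by
      have : Continuous fun τ : ℝ => θ₀ + τ • k := by fun_prop
      have h2 := (this.tendsto 0).mono_left (nhdsWithin_le_nhds (s := Ioi (0 : ℝ)))
      simpa using h2
    filter_upwards [hc (isOpen_paramSpace.mem_nhds h.mem_param)] with τ hτ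
    -- The link is moved by τs, so that it contributes at the same order as the parameter increment
    -- τk.
    have h4 := h.risk_le_perturbed hφ.continuous v hτ (τ * s)
    simp only [Prod.smul_mk, Prod.mk_add_mk, smul_eq_mul, mul_zero, zero_add]
    gcongr
  have hcμ := (h.smooth.contDiff_link h.mem_param).continuous
  have hcp := continuous_projIndex θ₀
  have hcd := h.smooth.continuous_linkDeriv h.mem_param
  have hcφ := hφ.continuous
  have hint : ∀ a b : Euc (q + 1) → Euc d, Continuous a → Continuous b →
      Integrable (fun z : Euc (q + 1) × Euc d => eslHess lam (z.2 - μ θ₀ (projIndex θ₀ z.1))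
        (a z.1) (b z.1)) P := fun a b ha hb =>
    h.toIsGoodModel.integrable (continuous_eslHess.comp
      (f := fun z : Euc (q + 1) × Euc d => (z.2 - μ θ₀ (projIndex θ₀ z.1), a z.1, b z.1))
      (by fun_prop))
  set X := ∫ z, eslHess lam (z.2 - μ θ₀ (projIndex θ₀ z.1)) (linkDeriv μ θ₀ z.1 k)
      (φ (projIndex θ₀ z.1) • v) ∂P with hX
  set Z := ∫ z, eslHess lam (z.2 - μ θ₀ (projIndex θ₀ z.1)) (φ (projIndex θ₀ z.1) • v)
      (φ (projIndex θ₀ z.1) • v) ∂P with hZ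
  have hquad : ∀ s, Q (k, s) = Q (k, 0) + 2 * s * X + s ^ 2 * Z := by
    intro s
    have i1 := hint (fun x => linkDeriv μ θ₀ x k) (fun x => linkDeriv μ θ₀ x k)
      (by fun_prop) (by fun_prop)
    have i2 := hint (fun x => linkDeriv μ θ₀ x k) (fun x => φ (projIndex θ₀ x) • v)
      (by fun_prop) (by fun_prop)
    have i3 := hint (fun x => φ (projIndex θ₀ x) • v) (fun x => φ (projIndex θ₀ x) • v)
      (by fun_prop) (by fun_prop)
    have e : ∀ (x : Euc (q + 1)) (s : ℝ), perturbedDeriv μ φ v θ₀ x (k, s) =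
        linkDeriv μ θ₀ x k + s • φ (projIndex θ₀ x) • v := fun x s => by simp [perturbedDeriv]
    simp only [hQdef, e, zero_smul, add_zero]
    rw [hX, hZ, ← integral_const_mul, ← integral_const_mul, ← integral_add i1 (i2.const_mul _)]
    refine Eq.trans ?_ (integral_add (i1.add (i2.const_mul _)) (i3.const_mul _))
    congr 1; ext z
    simp only [eslHess_add_left, eslHess_add_right, eslHess_smul_left, eslHess_smul_right]
    simp only [eslHess_comm _ v]
    ring
  have := eq_zero_of_mul_le_sq (L := -2 * X) (K := Z) one_pos fun t _ => by
    have h1 := hmono t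
    rw [hquad t] at h1
    linarith
  linarith

end IsGoodFit

end Fit

/-! ### Hessian forms conditioned on the index. -/

section Disintegration

variable {q d : ℕ} {f : ℝ → ℝ} {κ lam ρ : ℝ} {PX : Measure (Euc (q + 1))} [IsProbabilityMeasure PX]
  {θ₀ : Euc q} {m : ℝ → Euc d} {P : Measure (Euc (q + 1) × Euc d)} [IsProbabilityMeasure P]
  {𝒳 : Set (Euc (q + 1))} {μ : Euc q → ℝ → Euc d}

/-- The expected Hessian form of the loss under the angular law. -/
noncomputable def angHess (f : ℝ → ℝ) (κ lam : ℝ) (v w a b : Euc d) : ℝ :=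
  ∫ y, eslHess lam (y - w) a b ∂(angularLaw f κ v)

theorem angHess_comm (v w a b : Euc d) : angHess f κ lam v w a b = angHess f κ lam v w b a := by
  simp only [angHess, eslHess_comm _ a b]

theorem angHess_smul_left (v w a b : Euc d) (c : ℝ) :
    angHess f κ lam v w (c • a) b = c * angHess f κ lam v w a b := by
  simp only [angHess, eslHess_smul_left, integral_const_mul]

theorem angHess_smul_right (v w a b : Euc d) (c : ℝ) :
    angHess f κ lam v w a (c • b) = c * angHess f κ lam v w a b := by
  simp only [angHess, eslHess_smul_right, integral_const_mul]

theorem angHess_add_left {v : Euc d} [IsProbabilityMeasure (angularLaw f κ v)] (w a a' b : Euc d) :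
    angHess f κ lam v w (a + a') b = angHess f κ lam v w a b + angHess f κ lam v w a' b := by
  have hi : ∀ a : Euc d, Integrable (fun y => eslHess lam (y - w) a b) (angularLaw f κ v) :=
    fun a => integrable_angularLaw (continuous_eslHess.comp
      (f := fun y : Euc d => (y - w, a, b)) (by fun_prop))
  simp only [angHess, eslHess_add_left]
  exact integral_add (hi a) (hi a')

theorem angHess_eq_zero_of_basis {v : Euc d} [IsProbabilityMeasure (angularLaw f κ v)] {w a : Euc d}
    (h : ∀ j, angHess f κ lam v w a (EuclideanSpace.single j 1) = 0) (b : Euc d) :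
    angHess f κ lam v w a b = 0 := by
  have hb : b = ∑ j, b j • EuclideanSpace.single j (1 : ℝ) := by
    ext i; simp [Finset.sum_apply, Pi.single_apply]
  let φ : Euc d →+ ℝ :=
    { toFun := fun b => angHess f κ lam v w b a
      map_zero' := by simp [angHess, eslHess]
      map_add' := fun x y => angHess_add_left w x y a }
  have h0 : φ b = 0 := by
    rw [hb, map_sum]
    refine Finset.sum_eq_zero fun j _ => ?_
    have : φ (b j • EuclideanSpace.single j (1 : ℝ)) =
      angHess f κ lam v w (b j • EuclideanSpace.single j (1 : ℝ)) a := rfl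
    rw [this, angHess_smul_left, angHess_comm, h, mul_zero]
  rw [angHess_comm]
  exact h0

/-- The conditional mean given the index `U_θ = u`. -/
noncomputable def indexMean (PX : Measure (Euc (q + 1))) [IsFiniteMeasure PX] (θ : Euc q)
    (c : Euc (q + 1) → ℝ) (u : ℝ) : ℝ :=
  ∫ x, c x ∂(condDistrib id (projIndex θ) PX u)

theorem map_index_prod_eq (PX : Measure (Euc (q + 1))) [IsFiniteMeasure PX] (θ : Euc q) :
    PX.map (projIndex θ) ⊗ₘ condDistrib id (projIndex θ) PX = PX.map fun x => (projIndex θ x, x) :=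
  compProd_map_condDistrib aemeasurable_id

theorem ae_condDistrib_of_ae (θ : Euc q) {p : Euc (q + 1) → Prop} (h : ∀ᵐ x ∂PX, p x) :
    ∀ᵐ u ∂(PX.map (projIndex θ)), ∀ᵐ x ∂(condDistrib id (projIndex θ) PX u), p x := by
  have hc := (continuous_projIndex θ).measurable
  obtain ⟨s, hs, hsm, hs0⟩ := exists_measurable_superset_of_null (ae_iff.1 h)
  have h1 : ∀ᵐ x ∂PX, x ∈ sᶜ := by
    rw [ae_iff]; simpa using hs0
  have h2 : ∀ᵐ w ∂(PX.map (projIndex θ) ⊗ₘ condDistrib id (projIndex θ) PX), w.2 ∈ sᶜ := by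
    rw [map_index_prod_eq, ae_map_iff (by fun_prop) (hsm.compl.preimage measurable_snd)]
    exact h1
  filter_upwards [Measure.ae_ae_of_ae_compProd h2] with u hu
  filter_upwards [hu] with x hx
  by_contra hp
  exact hx (hs hp)

theorem integral_index_eq (θ : Euc q) {F : ℝ × Euc (q + 1) → ℝ} (hF : Measurable F)
    (hi : Integrable (fun x => F (projIndex θ x, x)) PX) :
    Integrable (fun u => ∫ x, F (u, x) ∂(condDistrib id (projIndex θ) PX u)) (PX.map (projIndex θ)) ∧
    ∫ x, F (projIndex θ x, x) ∂PX =
      ∫ u, ∫ x, F (u, x) ∂(condDistrib id (projIndex θ) PX u) ∂(PX.map (projIndex θ)) := by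
  have hc := (continuous_projIndex θ).measurable
  have hm : AEMeasurable (fun x => (projIndex θ x, x)) PX := by fun_prop
  have h1 : Integrable F (PX.map (projIndex θ) ⊗ₘ condDistrib id (projIndex θ) PX) := by
    rw [map_index_prod_eq, integrable_map_measure hF.aestronglyMeasurable hm]
    exact hi
  refine ⟨h1.integral_compProd, ?_⟩
  rw [← Measure.integral_compProd h1, map_index_prod_eq, integral_map hm hF.aestronglyMeasurable]

theorem IsGoodModel.measurable_angHess (h : IsGoodModel PX 𝒳 θ₀ m f κ P) {w a b : ℝ → Euc d}
    (hw : Continuous w) (ha : Continuous a) (hb : Continuous b) :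
    Measurable fun u => angHess f κ lam (m u) (w u) (a u) (b u) := by
  have := isFiniteKernel_angularKernel (d := d) (κ := κ) h.nonneg h.mono
  have hc : Continuous fun p : ℝ × Euc d => eslHess lam (p.2 - w p.1) (a p.1) (b p.1) :=
    continuous_eslHess.comp (f := fun p : ℝ × Euc d => (p.2 - w p.1, a p.1, b p.1)) (by fun_prop)
  exact (StronglyMeasurable.integral_kernel_prod_right'
    (κ := (angularKernel d h.mono κ).comap m h.contDiff.continuous.measurable)
    hc.stronglyMeasurable).measurable

/-- Integrals of the Hessian form disintegrate along the index. -/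
theorem IsGoodModel.integral_eslHess (h : IsGoodModel PX 𝒳 θ₀ m f κ P) {w a b : ℝ → Euc d}
    {c : Euc (q + 1) → ℝ} (hw : Continuous w) (ha : Continuous a) (hb : Continuous b)
    (hc : Continuous c) :
    Integrable (fun u => indexMean PX θ₀ c u * angHess f κ lam (m u) (w u) (a u) (b u))
      (PX.map (projIndex θ₀)) ∧
    ∫ z, c z.1 * eslHess lam (z.2 - w (projIndex θ₀ z.1)) (a (projIndex θ₀ z.1))
      (b (projIndex θ₀ z.1)) ∂P =
      ∫ u, indexMean PX θ₀ c u * angHess f κ lam (m u) (w u) (a u) (b u)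
        ∂(PX.map (projIndex θ₀)) := by
  have := isFiniteKernel_angularKernel (d := d) (κ := κ) h.nonneg h.mono
  have hcp := continuous_projIndex θ₀
  have hcont : Continuous fun z : Euc (q + 1) × Euc d => c z.1 *
      eslHess lam (z.2 - w (projIndex θ₀ z.1)) (a (projIndex θ₀ z.1)) (b (projIndex θ₀ z.1)) :=
    (hc.comp continuous_fst).mul (continuous_eslHess.comp (f := fun z : Euc (q + 1) × Euc d =>
      (z.2 - w (projIndex θ₀ z.1), a (projIndex θ₀ z.1), b (projIndex θ₀ z.1))) (by fun_prop))
  have hg := h.integrable hcont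
  have hF : Measurable fun p : ℝ × Euc (q + 1) =>
      c p.2 * angHess f κ lam (m p.1) (w p.1) (a p.1) (b p.1) :=
    (hc.measurable.comp measurable_snd).mul ((h.measurable_angHess hw ha hb).comp measurable_fst)
  have hi : Integrable (fun x => c x * angHess f κ lam (m (projIndex θ₀ x)) (w (projIndex θ₀ x))
      (a (projIndex θ₀ x)) (b (projIndex θ₀ x))) PX := by
    have hg' := hg
    rw [h.eq_compProd] at hg'
    refine hg'.integral_compProd.congr (.of_forall fun x => ?_)
    exact integral_const_mul (c x) fun y => eslHess lam (y - w (projIndex θ₀ x))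
      (a (projIndex θ₀ x)) (b (projIndex θ₀ x))
  obtain ⟨h1, h2⟩ := integral_index_eq θ₀ hF hi
  simp only [integral_mul_const] at h1 h2
  refine ⟨h1, ?_⟩
  rw [h.integral hg]
  refine Eq.trans ?_ h2
  refine integral_congr_ae (.of_forall fun x => ?_)
  exact integral_const_mul (c x) fun y => eslHess lam (y - w (projIndex θ₀ x))
    (a (projIndex θ₀ x)) (b (projIndex θ₀ x))

end Disintegration

/-! ### The derivative of the link in the parameter. -/

section LinkDerivative

variable {q d : ℕ} {f : ℝ → ℝ} {κ lam ρ : ℝ} {PX : Measure (Euc (q + 1))} [IsProbabilityMeasure PX]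
  {θ₀ : Euc q} {m : ℝ → Euc d} {P : Measure (Euc (q + 1) × Euc d)} [IsProbabilityMeasure P]
  {𝒳 : Set (Euc (q + 1))} {μ : Euc q → ℝ → Euc d}

namespace IsGoodFit

theorem ae_index (h : IsGoodFit PX 𝒳 θ₀ m f κ P lam ρ μ) :
    ∀ᵐ u ∂(PX.map (projIndex θ₀)), u ∈ (PX.map (projIndex θ₀)).support ∧
      ∀ v : Euc d, v ≠ 0 → 0 < angHess f κ lam (m u) (μ θ₀ u) v v := by
  have hc := (continuous_projIndex θ₀).measurable
  have : IsProbabilityMeasure (PX.map (projIndex θ₀)) :=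
    Measure.isProbabilityMeasure_map hc.aemeasurable
  have h1 := h.posDef
  rw [h.indexLaw_eq] at h1
  filter_upwards [h1, h.condLawY_eq, Measure.support_mem_ae] with u h1 h2 h3
  refine ⟨h3, fun v hv => ?_⟩
  have h4 := h1 v hv
  rw [condHessian, h2] at h4
  simp only [fderiv_fderiv_eslLoss] at h4
  exact h4

/-- The derivative of the link in the parameter is, conditionally on the index, the centring of the
derivative of the index. -/
theorem ae_fderiv_link (h : IsGoodFit PX 𝒳 θ₀ m f κ P lam ρ μ) (k : Euc q) :
    ∀ᵐ u ∂(PX.map (projIndex θ₀)),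
      fderiv ℝ (fun w : Euc q × ℝ => μ w.1 w.2) (θ₀, u) (k, 0) +
        indexMean PX θ₀ (fun x => indexDeriv θ₀ x k) u • deriv (μ θ₀) u = 0 := by
  have hc := continuous_projIndex θ₀
  have hl := h.smooth.contDiff_link h.mem_param
  have hμc := hl.continuous
  set α : ℝ → Euc d := fun u => fderiv ℝ (fun w : Euc q × ℝ => μ w.1 w.2) (θ₀, u) (k, 0) with hα
  set β : ℝ → Euc d := deriv (μ θ₀) with hβ
  have hαc : Continuous α := (h.smooth.continuous_fderiv h.mem_param).clm_apply continuous_const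
  have hβc : Continuous β := hl.continuous_deriv le_rfl
  set ι : Euc (q + 1) → ℝ := fun x => indexDeriv θ₀ x k with hι
  have hιc : Continuous ι := (continuous_indexDeriv θ₀).clm_apply continuous_const
  have : IsProbabilityMeasure (PX.map (projIndex θ₀)) :=
    Measure.isProbabilityMeasure_map hc.measurable.aemeasurable
  have h1m : ∀ u, indexMean PX θ₀ (fun _ => (1 : ℝ)) u = 1 := fun u => by simp [indexMean]
  have key : ∀ v : Euc d, ∀ᵐ u ∂(PX.map (projIndex θ₀)),
      angHess f κ lam (m u) (μ θ₀ u) (α u) v +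
        indexMean PX θ₀ ι u * angHess f κ lam (m u) (μ θ₀ u) (β u) v = 0 := by
    intro v
    have i1 := (h.integral_eslHess (lam := lam) (c := fun _ => 1) hμc hαc
      (b := fun _ => v) continuous_const continuous_const).1
    have i2 := (h.integral_eslHess (lam := lam) (c := ι) hμc hβc
      (b := fun _ => v) continuous_const hιc).1
    simp only [h1m, one_mul] at i1
    -- The vanishing cross terms, tested with all smooth φ, localise to almost every index value.
    -- Positive definiteness of the conditional Hessian then kills the vector itself.
    refine ae_eq_zero_of_integral_contDiff_smul_eq_zero (i1.add i2).locallyIntegrable ?_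
    intro φ hφ _
    have hφ1 : ContDiff ℝ 1 φ := hφ.of_le (by exact_mod_cast le_top)
    have hφc := hφ1.continuous
    have j1 := h.integral_eslHess (lam := lam) (c := fun _ => 1) hμc hαc
      (b := fun u => φ u • v) (by fun_prop) continuous_const
    have j2 := h.integral_eslHess (lam := lam) (c := ι) hμc hβc
      (b := fun u => φ u • v) (by fun_prop) hιc
    simp only [h1m, one_mul] at j1
    have hct := h.cross_term hφ1 v k
    have hint : ∀ a b : Euc (q + 1) → Euc d, Continuous a → Continuous b →
        Integrable (fun z : Euc (q + 1) × Euc d => eslHess lam (z.2 - μ θ₀ (projIndex θ₀ z.1))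
          (a z.1) (b z.1)) P := fun a b ha hb =>
      h.toIsGoodModel.integrable (continuous_eslHess.comp
        (f := fun z : Euc (q + 1) × Euc d => (z.2 - μ θ₀ (projIndex θ₀ z.1), a z.1, b z.1))
        (by fun_prop))
    have e : ∫ z, eslHess lam (z.2 - μ θ₀ (projIndex θ₀ z.1)) (linkDeriv μ θ₀ z.1 k)
        (φ (projIndex θ₀ z.1) • v) ∂P =
        (∫ z, eslHess lam (z.2 - μ θ₀ (projIndex θ₀ z.1)) (α (projIndex θ₀ z.1))
          (φ (projIndex θ₀ z.1) • v) ∂P) +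
        ∫ z, ι z.1 * eslHess lam (z.2 - μ θ₀ (projIndex θ₀ z.1)) (β (projIndex θ₀ z.1))
          (φ (projIndex θ₀ z.1) • v) ∂P := by
      have k1 := hint (fun x => α (projIndex θ₀ x)) (fun x => φ (projIndex θ₀ x) • v)
        (by fun_prop) (by fun_prop)
      have k2 := hint (fun x => ι x • β (projIndex θ₀ x)) (fun x => φ (projIndex θ₀ x) • v)
        (by fun_prop) (by fun_prop)
      simp only [eslHess_smul_left] at k2
      rw [← integral_add k1 k2]
      congr 1; ext z
      rw [h.smooth.linkDeriv_apply h.mem_param, eslHess_add_left, eslHess_smul_left]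
    rw [hct, j1.2, j2.2, ← integral_add j1.1 j2.1] at e
    rw [e]
    congr 1; ext u
    simp only [smul_eq_mul, angHess_smul_right]
    ring
  have key' := (ae_all_iff (ι := Fin d)).2 fun j => key (EuclideanSpace.single j 1)
  filter_upwards [key', h.ae_index] with u h1 h2
  have hm := h.unit u h2.1
  have := h.isProb hm
  by_contra hne
  refine (h2.2 _ hne).ne' (angHess_eq_zero_of_basis (fun j => ?_) _)
  rw [angHess_add_left, angHess_smul_left]
  exact h1 j

theorem ae_linkDeriv_eq (h : IsGoodFit PX 𝒳 θ₀ m f κ P lam ρ μ) (k : Euc q) :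
    ∀ᵐ x ∂PX, linkDeriv μ θ₀ x k =
      (indexDeriv θ₀ x k - indexMean PX θ₀ (fun x => indexDeriv θ₀ x k) (projIndex θ₀ x)) •
        deriv (μ θ₀) (projIndex θ₀ x) := by
  filter_upwards [ae_of_ae_map (continuous_projIndex θ₀).measurable.aemeasurable
    (h.ae_fderiv_link k)] with x hx
  rw [h.smooth.linkDeriv_apply h.mem_param, eq_neg_of_add_eq_zero_left hx, sub_smul]
  abel

/-- The supremum in the sensitivity runs over every x ∈ 𝒳, so the almost sure identity has to be
extended. The conditional mean is only measurable, but the index values admitting some coefficient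
in [-M, M] form a closed set, as a projection along a compact interval. It has full measure and so
contains the support. The coefficient is no longer identified, only bounded. -/
theorem exists_linkDeriv_eq (h : IsGoodFit PX 𝒳 θ₀ m f κ P lam ρ μ) {M : ℝ} {k : Euc q}
    (hM : ∀ x ∈ 𝒳, |indexDeriv θ₀ x k| ≤ M) {x : Euc (q + 1)} (hx : x ∈ 𝒳) :
    ∃ c : ℝ, |c| ≤ 2 * M ∧ linkDeriv μ θ₀ x k = c • deriv (μ θ₀) (projIndex θ₀ x) := by
  have hl := h.smooth.contDiff_link h.mem_param
  set α : ℝ → Euc d := fun u => fderiv ℝ (fun w : Euc q × ℝ => μ w.1 w.2) (θ₀, u) (k, 0) with hα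
  have hαc : Continuous α := (h.smooth.continuous_fderiv h.mem_param).clm_apply continuous_const
  have hβc : Continuous (deriv (μ θ₀)) := hl.continuous_deriv le_rfl
  have hcl : IsClosed (Prod.snd '' ((Icc (-M) M ×ˢ univ) ∩
      {p : ℝ × ℝ | α p.2 + p.1 • deriv (μ θ₀) p.2 = 0})) := by
    have h1 : IsClosed {p : ℝ × ℝ | α p.2 + p.1 • deriv (μ θ₀) p.2 = 0} :=
      isClosed_eq (by fun_prop) continuous_const
    have h2 : Prod.snd '' ((Icc (-M) M ×ˢ univ) ∩
      {p : ℝ × ℝ | α p.2 + p.1 • deriv (μ θ₀) p.2 = 0}) =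
      Prod.snd '' {p : Icc (-M) M × ℝ | α p.2 + (p.1 : ℝ) • deriv (μ θ₀) p.2 = 0} := by
      ext u
      constructor
      · rintro ⟨p, ⟨⟨hp1, -⟩, hp2⟩, rfl⟩
        exact ⟨(⟨p.1, hp1⟩, p.2), hp2, rfl⟩
      · rintro ⟨p, hp, rfl⟩
        exact ⟨(p.1, p.2), ⟨⟨p.1.2, mem_univ _⟩, hp⟩, rfl⟩
    rw [h2]
    exact isClosedMap_snd_of_compactSpace _ (isClosed_eq (by fun_prop) continuous_const)
  have hae : ∀ᵐ u ∂(PX.map (projIndex θ₀)), u ∈ Prod.snd '' ((Icc (-M) M ×ˢ univ) ∩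
      {p : ℝ × ℝ | α p.2 + p.1 • deriv (μ θ₀) p.2 = 0}) := by
    filter_upwards [h.ae_fderiv_link k, ae_condDistrib_of_ae θ₀ h.mem_ae] with u h1 h2
    refine ⟨(indexMean PX θ₀ (fun x => indexDeriv θ₀ x k) u, u), ⟨⟨?_, mem_univ _⟩, h1⟩, rfl⟩
    have h3 : ‖indexMean PX θ₀ (fun x => indexDeriv θ₀ x k) u‖ ≤ M := by
      refine (norm_integral_le_of_norm_le_const (C := M) ?_).trans (by simp)
      filter_upwards [h2] with x hx using hM x hx
    exact abs_le.1 h3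
  obtain ⟨⟨c, u⟩, ⟨⟨hc, -⟩, he⟩, hu⟩ :=
    Measure.support_subset_of_isClosed hcl hae (h.mem_support x hx)
  have hu' : u = projIndex θ₀ x := hu
  subst hu'
  refine ⟨indexDeriv θ₀ x k - c, ?_, ?_⟩
  · refine (abs_sub _ _).trans ?_
    have := hM x hx
    have := abs_le.2 hc
    linarith
  · rw [h.smooth.linkDeriv_apply h.mem_param, sub_smul]
    have : α (projIndex θ₀ x) = -(c • deriv (μ θ₀) (projIndex θ₀ x)) :=
      eq_neg_of_add_eq_zero_left he
    change α _ + _ = _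
    rw [this]; abel

theorem deriv_link_eq (h : IsGoodFit PX 𝒳 θ₀ m f κ P lam ρ μ) {u : ℝ}
    (hu : u ∈ (PX.map (projIndex θ₀)).support) : deriv (μ θ₀) u = ρ • deriv m u := by
  have := h.noAtoms
  have h1 := ((h.smooth.contDiff_link h.mem_param).differentiable one_ne_zero u).hasDerivAt
  have h2 := (h.contDiff.differentiable one_ne_zero u).hasDerivAt
  have := deriv_eq_zero_of_eqOn_support (g := fun u => μ θ₀ u - ρ • m u)
    (fun u hu => by rw [h.link_eq u hu, sub_self]) hu (h1.sub (h2.const_smul ρ))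
  exact sub_eq_zero.1 this

end IsGoodFit

/-- Derivative of ‖m‖² = 1, legitimate because the support has no isolated points. -/
theorem IsGoodModel.inner_deriv_eq_zero (h : IsGoodModel PX 𝒳 θ₀ m f κ P) {u : ℝ}
    (hu : u ∈ (PX.map (projIndex θ₀)).support) : inner ℝ (m u) (deriv m u) = 0 := by
  have := h.noAtoms
  have h2 := (h.contDiff.differentiable one_ne_zero u).hasDerivAt
  have := deriv_eq_zero_of_eqOn_support (g := fun u => (inner ℝ (m u) (m u) : ℝ) - 1)
    (fun u hu => by rw [real_inner_self_eq_norm_sq, h.unit u hu]; norm_num) hu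
      ((h2.inner ℝ h2).sub_const 1)
  rw [real_inner_comm (m u)] at this
  linarith

end LinkDerivative

/-! ### The matrix W as the Hessian of the risk. -/

section Hessian

variable {q d : ℕ} {f : ℝ → ℝ} {κ lam ρ : ℝ} {PX : Measure (Euc (q + 1))} [IsProbabilityMeasure PX]
  {θ₀ : Euc q} {m : ℝ → Euc d} {P : Measure (Euc (q + 1) × Euc d)} [IsProbabilityMeasure P]
  {𝒳 : Set (Euc (q + 1))} {μ : Euc q → ℝ → Euc d}

theorem measurable_indexMean (θ : Euc q) {c : Euc (q + 1) → ℝ} (hc : Measurable c) :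
    Measurable (indexMean PX θ c) :=
  ((hc.comp measurable_snd).stronglyMeasurable.integral_kernel_prod_right'
    (κ := condDistrib id (projIndex θ) PX) (f := fun p => c p.2)).measurable

theorem indexDeriv_single (hθ₀ : θ₀ ∈ paramSpace q) (x : Euc (q + 1)) (i : Fin q) :
    indexDeriv θ₀ x (EuclideanSpace.single i 1) = ∑ a, x a * jacobianBeta θ₀ a i := by
  rw [indexDeriv_apply, PiLp.inner_apply]
  refine Finset.sum_congr rfl fun a _ => ?_
  rw [fderiv_betaVec_apply hθ₀]
  simp [Matrix.mulVec, dotProduct, mul_comm]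

theorem transpose_mul_cov_mul_apply (K : Measure (Euc (q + 1))) (e : Fin (q + 1) → ℝ)
    (J : Matrix (Fin (q + 1)) (Fin q) ℝ) (i j : Fin q)
    (hint : ∀ a b, Integrable (fun x => (x a - e a) * (x b - e b)) K) :
    (Jᵀ * Matrix.of (fun a b => ∫ x, (x a - e a) * (x b - e b) ∂K) * J) i j =
      ∫ x, (∑ a, x a * J a i - ∑ a, e a * J a i) * (∑ a, x a * J a j - ∑ a, e a * J a j) ∂K := by
  have h1 : ∀ x : Euc (q + 1), (∑ a, x a * J a i - ∑ a, e a * J a i) *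
      (∑ a, x a * J a j - ∑ a, e a * J a j) =
      ∑ b, ∑ a, J a i * J b j * ((x a - e a) * (x b - e b)) := by
    intro x
    rw [← Finset.sum_sub_distrib, ← Finset.sum_sub_distrib, Finset.sum_mul_sum, Finset.sum_comm]
    refine Finset.sum_congr rfl fun b _ => Finset.sum_congr rfl fun a _ => ?_
    ring
  simp_rw [h1]
  rw [integral_finsetSum _ fun b _ => integrable_finsetSum _ fun a _ => (hint a b).const_mul _]
  rw [Matrix.mul_apply]
  refine Finset.sum_congr rfl fun b _ => ?_
  rw [integral_finsetSum _ fun a _ => (hint a b).const_mul _, Matrix.mul_apply, Finset.sum_mul]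
  refine Finset.sum_congr rfl fun a _ => ?_
  rw [integral_const_mul]
  simp only [Matrix.transpose_apply, Matrix.of_apply]
  ring

namespace IsGoodFit

theorem integrable_eslHess (h : IsGoodFit PX 𝒳 θ₀ m f κ P lam ρ μ) (k l : Euc q) :
    Integrable (fun z => eslHess lam (z.2 - μ θ₀ (projIndex θ₀ z.1)) (linkDeriv μ θ₀ z.1 k)
      (linkDeriv μ θ₀ z.1 l)) P := by
  have hcμ := (h.smooth.contDiff_link h.mem_param).continuous
  have hcp := continuous_projIndex θ₀
  have hcd := h.smooth.continuous_linkDeriv h.mem_param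
  exact h.toIsGoodModel.integrable (continuous_eslHess.comp (f := fun z : Euc (q + 1) × Euc d =>
    (z.2 - μ θ₀ (projIndex θ₀ z.1), linkDeriv μ θ₀ z.1 k, linkDeriv μ θ₀ z.1 l)) (by fun_prop))

/-- Both link derivatives are centred index derivatives times μ'. Conditioning on the index factors
the integrand into the Hessian form at μ' and a conditional covariance of xᵀJ(θ₀), which is the
integrand defining W. -/
theorem hessianW_apply (h : IsGoodFit PX 𝒳 θ₀ m f κ P lam ρ μ) (i j : Fin q) :
    hessianW (eslLoss lam) P μ θ₀ i j =
      ∫ z, eslHess lam (z.2 - μ θ₀ (projIndex θ₀ z.1))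
        (linkDeriv μ θ₀ z.1 (EuclideanSpace.single i 1))
        (linkDeriv μ θ₀ z.1 (EuclideanSpace.single j 1)) ∂P := by
  have := isFiniteKernel_angularKernel (d := d) (κ := κ) h.nonneg h.mono
  have hl := h.smooth.contDiff_link h.mem_param
  have hβc : Continuous (deriv (μ θ₀)) := hl.continuous_deriv le_rfl
  set ei : Euc q := EuclideanSpace.single i 1 with hei
  set ej : Euc q := EuclideanSpace.single j 1 with hej
  set ξ : Euc q → ℝ → ℝ := fun k => indexMean PX θ₀ fun x => indexDeriv θ₀ x k with hξ
  have hιc : ∀ k, Continuous fun x => indexDeriv θ₀ x k := fun k =>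
    (continuous_indexDeriv θ₀).clm_apply continuous_const
  have hξm : ∀ k, Measurable (ξ k) := fun k => measurable_indexMean θ₀ (hιc k).measurable
  have hbm := h.measurable_angHess (lam := lam) hl.continuous hβc hβc
  set F : ℝ × Euc (q + 1) → ℝ := fun p =>
    angHess f κ lam (m p.1) (μ θ₀ p.1) (deriv (μ θ₀) p.1) (deriv (μ θ₀) p.1) *
      ((indexDeriv θ₀ p.2 ei - ξ ei p.1) * (indexDeriv θ₀ p.2 ej - ξ ej p.1)) with hF
  have hFm : Measurable F :=
    (hbm.comp measurable_fst).mul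
      ((((hιc ei).measurable.comp measurable_snd).sub ((hξm ei).comp measurable_fst)).mul
        (((hιc ej).measurable.comp measurable_snd).sub ((hξm ej).comp measurable_fst)))
  have hae : (fun x => ∫ y, eslHess lam (y - μ θ₀ (projIndex θ₀ x)) (linkDeriv μ θ₀ x ei)
      (linkDeriv μ θ₀ x ej) ∂(angularLaw f κ (m (projIndex θ₀ x)))) =ᵐ[PX]
      fun x => F (projIndex θ₀ x, x) := by
    filter_upwards [h.ae_linkDeriv_eq ei, h.ae_linkDeriv_eq ej] with x h1 h2
    rw [h1, h2]
    change angHess f κ lam _ _ _ _ = _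
    rw [angHess_smul_left, angHess_smul_right]
    simp only [hF]
    ring
  have hg := h.integrable_eslHess ei ej
  have hi : Integrable (fun x => F (projIndex θ₀ x, x)) PX := by
    have hg' := hg
    rw [h.eq_compProd] at hg'
    exact hg'.integral_compProd.congr hae
  rw [h.integral hg, integral_congr_ae hae, (integral_index_eq θ₀ hFm hi).2]
  simp only [hF, integral_const_mul]
  rw [hessianW, Matrix.of_apply, h.indexLaw_eq]
  refine integral_congr_ae ?_
  filter_upwards [h.condLawY_eq, h.condLawX_eq, ae_condDistrib_of_ae θ₀ h.mem_ae] with u h1 h2 h3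
  congr 1
  · rw [condHessian, h1]
    simp only [fderiv_fderiv_eslLoss]
    rfl
  · obtain ⟨R, hR⟩ := h.compact.isBounded.exists_norm_le
    have hint : ∀ g : Euc (q + 1) → ℝ, Continuous g →
        Integrable g (condDistrib id (projIndex θ₀) PX u) := fun g hg => by
      obtain ⟨C, hC⟩ := h.compact.exists_bound_of_continuousOn hg.continuousOn
      refine Integrable.of_bound hg.aestronglyMeasurable C ?_
      filter_upwards [h3] with x hx using hC x hx
    have hcov : condCovX P θ₀ u = Matrix.of fun a b =>
        ∫ x, (x a - indexMean PX θ₀ (fun x => x a) u) * (x b - indexMean PX θ₀ (fun x => x b) u)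
          ∂(condDistrib id (projIndex θ₀) PX u) := by
      rw [condCovX, h2]; rfl
    have hξe : ∀ i : Fin q, ξ (EuclideanSpace.single i 1) u =
        ∑ a, indexMean PX θ₀ (fun x => x a) u * jacobianBeta θ₀ a i := fun i => by
      simp only [hξ, indexMean, indexDeriv_single h.mem_param]
      rw [integral_finsetSum _ fun a _ => (hint _ (by fun_prop)).mul_const _]
      simp only [integral_mul_const]
    rw [hcov, transpose_mul_cov_mul_apply _ _ _ _ _ fun a b => hint _ (by fun_prop)]
    simp only [hei, hej, hξe, indexDeriv_single h.mem_param]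

/-- The Hessian quadratic form of the risk. -/
theorem dotProduct_hessianW (h : IsGoodFit PX 𝒳 θ₀ m f κ P lam ρ μ) (k : Euc q) :
    (fun i => k i) ⬝ᵥ (hessianW (eslLoss lam) P μ θ₀ *ᵥ fun i => k i) =
      ∫ z, eslHess lam (z.2 - μ θ₀ (projIndex θ₀ z.1)) (linkDeriv μ θ₀ z.1 k)
        (linkDeriv μ θ₀ z.1 k) ∂P := by
  have hk : k = ∑ j, k j • EuclideanSpace.single j (1 : ℝ) := by
    ext i; simp [Finset.sum_apply, Pi.single_apply]
  have hL : ∀ (w : Euc d) (s : Finset (Fin q)) (g : Fin q → Euc d) (b : Euc d),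
      eslHess lam w (∑ i ∈ s, g i) b = ∑ i ∈ s, eslHess lam w (g i) b := by
    intro w s g b
    induction s using Finset.cons_induction with
    | empty => simp [eslHess]
    | cons a s ha ih => rw [Finset.sum_cons, Finset.sum_cons, eslHess_add_left, ih]
  have e : ∀ z : Euc (q + 1) × Euc d,
      eslHess lam (z.2 - μ θ₀ (projIndex θ₀ z.1)) (linkDeriv μ θ₀ z.1 k) (linkDeriv μ θ₀ z.1 k) =
      ∑ i, ∑ j, k i * k j * eslHess lam (z.2 - μ θ₀ (projIndex θ₀ z.1))
        (linkDeriv μ θ₀ z.1 (EuclideanSpace.single i 1))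
        (linkDeriv μ θ₀ z.1 (EuclideanSpace.single j 1)) := by
    intro z
    conv_lhs => rw [hk]
    rw [map_sum, hL]
    refine Finset.sum_congr rfl fun i _ => ?_
    rw [eslHess_comm, hL]
    refine Finset.sum_congr rfl fun j _ => ?_
    simp only [map_smul, eslHess_smul_left, eslHess_smul_right]
    rw [eslHess_comm]; ring
  simp_rw [e]
  rw [integral_finsetSum _ fun i _ => integrable_finsetSum _ fun j _ =>
    (h.integrable_eslHess _ _).const_mul _]
  simp only [dotProduct, Matrix.mulVec, Finset.mul_sum]
  refine Finset.sum_congr rfl fun i _ => ?_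
  rw [integral_finsetSum _ fun j _ => (h.integrable_eslHess _ _).const_mul _]
  refine Finset.sum_congr rfl fun j _ => ?_
  rw [integral_const_mul, h.hessianW_apply]
  ring

/-- W integrates positive conditional forms, hence is semidefinite; the assumed invertibility
upgrades this to definiteness. -/
theorem posDef_hessianW (h : IsGoodFit PX 𝒳 θ₀ m f κ P lam ρ μ)
    (hdet : IsUnit (hessianW (eslLoss lam) P μ θ₀).det) :
    (hessianW (eslLoss lam) P μ θ₀).PosDef := by
  have hs : (hessianW (eslLoss lam) P μ θ₀).PosSemidef := by
    refine Matrix.PosSemidef.of_dotProduct_mulVec_nonneg ?_ fun k => ?_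
    · ext i j
      simp only [Matrix.conjTranspose_apply, star_trivial, h.hessianW_apply]
      simp only [eslHess_comm _ (linkDeriv μ θ₀ _ (EuclideanSpace.single i 1))]
    · have h1 := h.dotProduct_hessianW (WithLp.toLp 2 k)
      change k ⬝ᵥ (_ *ᵥ k) = _ at h1
      rw [star_trivial, h1, h.integral (h.integrable_eslHess _ _)]
      refine integral_nonneg_of_ae ?_
      filter_upwards [ae_of_ae_map (continuous_projIndex θ₀).measurable.aemeasurable
        h.ae_index] with x hx
      rcases eq_or_ne (linkDeriv μ θ₀ x (WithLp.toLp 2 k)) 0 with h0 | h0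
      · simp [h0, eslHess]
      · exact (hx.2 _ h0).le
  exact hs.posDef_iff_isUnit.2 ((Matrix.isUnit_iff_isUnit_det _).2 hdet)

/-- The second order expansion of the risk. -/
theorem risk_isLittleO (h : IsGoodFit PX 𝒳 θ₀ m f κ P lam ρ μ) :
    (fun θ => risk (eslLoss lam) μ P θ - risk (eslLoss lam) μ P θ₀ -
      ((fun i => (θ - θ₀) i) ⬝ᵥ (hessianW (eslLoss lam) P μ θ₀ *ᵥ fun i => (θ - θ₀) i)) / 2)
      =o[𝓝 θ₀] fun θ => ‖θ - θ₀‖ ^ 2 := by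
  have h1 := h.perturbed_expansion (φ := 0) contDiff_const 0
  have h2 : Tendsto (fun θ : Euc q => (θ, (0 : ℝ))) (𝓝 θ₀) (𝓝 (θ₀, 0)) :=
    Continuous.tendsto (by fun_prop) θ₀
  refine ((h1.comp_tendsto h2).congr_left fun θ => ?_).congr_right fun θ => ?_
  · simp only [h.dotProduct_hessianW, risk]
    simp [perturbedLink, perturbedDeriv]
  · simp [Prod.norm_def]

end IsGoodFit

end Hessian

/-! ### Minimisers of an abstract contaminated criterion. -/

section Contamination

variable {V : Type*} [NormedAddCommGroup V] [InnerProductSpace ℝ V]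

theorem exists_pos_mul_norm_sq_le [FiniteDimensional ℝ V] {Q : V → ℝ} (hc : Continuous Q)
    (hQ : ∀ (τ : ℝ) k, Q (τ • k) = τ ^ 2 * Q k) (hpos : ∀ k, k ≠ 0 → 0 < Q k) :
    ∃ c > 0, ∀ k, c * ‖k‖ ^ 2 ≤ Q k := by
  have : ProperSpace V := FiniteDimensional.proper_real V
  have hQ0 : Q 0 = 0 := by simpa using hQ 0 0
  -- The sphere is empty in dimension 0, which occurs for predictors of dimension p = 1.
  rcases (Metric.sphere (0 : V) 1).eq_empty_or_nonempty with he | hne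
  · refine ⟨1, one_pos, fun k => ?_⟩
    have : k = 0 := by
      by_contra hk
      have : (‖k‖⁻¹ : ℝ) • k ∈ Metric.sphere (0 : V) 1 := by
        simp [norm_smul, inv_mul_cancel₀ (norm_ne_zero_iff.2 hk)]
      rw [he] at this
      exact this
    simp [this, hQ0]
  · obtain ⟨a, ha, hmin⟩ := (isCompact_sphere (0 : V) 1).exists_isMinOn hne hc.continuousOn
    have ha0 : a ≠ 0 := by
      rintro rfl; simp at ha
    refine ⟨Q a, hpos a ha0, fun k => ?_⟩
    rcases eq_or_ne k 0 with rfl | hk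
    · simp [hQ0]
    have hn : 0 < ‖k‖ := norm_pos_iff.2 hk
    have h1 : (‖k‖⁻¹ : ℝ) • k ∈ Metric.sphere (0 : V) 1 := by
      simp [norm_smul, inv_mul_cancel₀ hn.ne']
    have h2 : Q a ≤ Q ((‖k‖⁻¹ : ℝ) • k) := hmin h1
    rw [hQ, inv_pow, inv_mul_eq_div, le_div_iff₀ (by positivity)] at h2
    exact h2

variable {R S : V → ℝ} {θ₀ s v : V} {W : V →L[ℝ] V}

/-- Zooming in at scale ε: along points within O(ε) of θ₀, the criterion divided by ε² approaches
the quadratic w ↦ ⟨w, Ww⟩/2 + ⟨s, w⟩ in the rescaled variable. -/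
theorem tendsto_contaminated_quotient
    (hR : (fun θ => R θ - R θ₀ - inner ℝ (θ - θ₀) (W (θ - θ₀)) / 2) =o[𝓝 θ₀] fun θ => ‖θ - θ₀‖ ^ 2)
    (hS : (fun θ => S θ - S θ₀ - inner ℝ s (θ - θ₀)) =o[𝓝 θ₀] fun θ => θ - θ₀)
    {T : ℝ → V} {M : ℝ} (hT : ∀ᶠ ε in 𝓝[>] (0 : ℝ), ‖T ε - θ₀‖ ≤ M * ε) :
    Tendsto (fun ε => (((1 - ε) * R (T ε) + ε * S (T ε)) - ((1 - ε) * R θ₀ + ε * S θ₀)) / ε ^ 2 -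
      (inner ℝ (ε⁻¹ • (T ε - θ₀)) (W (ε⁻¹ • (T ε - θ₀))) / 2 + inner ℝ s (ε⁻¹ • (T ε - θ₀))))
      (𝓝[>] 0) (𝓝 0) := by
  have hid : Tendsto (fun ε : ℝ => ε) (𝓝[>] 0) (𝓝 0) := tendsto_nhdsWithin_of_tendsto_nhds tendsto_id
  have hO : (fun ε => T ε - θ₀) =O[𝓝[>] 0] fun ε : ℝ => ε := by
    refine Asymptotics.IsBigO.of_bound M ?_
    filter_upwards [hT, self_mem_nhdsWithin] with ε h1 h2
    rwa [Real.norm_of_nonneg (le_of_lt h2)]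
  have hlim : Tendsto T (𝓝[>] 0) (𝓝 θ₀) := by
    have := hO.trans_tendsto hid
    simpa using this.add_const θ₀
  have h1 := ((hR.comp_tendsto hlim).trans_isBigO
    (hO.norm_left.pow 2)).tendsto_div_nhds_zero
  have h2 := ((hS.comp_tendsto hlim).trans_isBigO hO).tendsto_div_nhds_zero
  have h3 : Tendsto (fun ε : ℝ => ε * (inner ℝ (ε⁻¹ • (T ε - θ₀)) (W (ε⁻¹ • (T ε - θ₀))) / 2))
      (𝓝[>] 0) (𝓝 0) := by
    refine hid.zero_mul_isBoundedUnder_le ?_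
    refine isBoundedUnder_of_eventually_le (a := M ^ 2 * ‖W‖) ?_
    filter_upwards [hT, self_mem_nhdsWithin] with ε h1 h2
    have hε : 0 < ε := h2
    have hw : ‖ε⁻¹ • (T ε - θ₀)‖ ≤ M := by
      rw [norm_smul, Real.norm_of_nonneg (by positivity), inv_mul_le_iff₀ hε]
      linarith
    have hM : 0 ≤ M := (norm_nonneg _).trans hw
    set w := ε⁻¹ • (T ε - θ₀)
    have h4 : ‖(inner ℝ w (W w) : ℝ)‖ ≤ M * (‖W‖ * M) :=
      (norm_inner_le_norm _ _).trans (mul_le_mul hw ((W.le_opNorm w).trans (by gcongr))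
        (norm_nonneg _) hM)
    simp only [Function.comp_apply, norm_div, Real.norm_ofNat]
    nlinarith [norm_nonneg (inner ℝ w (W w) : ℝ)]
  have h4 : Tendsto (fun ε : ℝ => 1 - ε) (𝓝[>] 0) (𝓝 1) := by
    simpa using hid.const_sub 1
  have h5 := ((h4.mul h1).add h2).sub h3
  simp only [mul_zero, add_zero, sub_zero] at h5
  refine h5.congr' ?_
  filter_upwards [self_mem_nhdsWithin] with ε h2
  have hε : ε ≠ 0 := (show (0 : ℝ) < ε from h2).ne'
  simp only [Function.comp_apply, map_smul, real_inner_smul_left, real_inner_smul_right]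
  field_simp
  ring

theorem half_inner_add_eq (hsym : ∀ a b, inner ℝ a (W b) = inner ℝ (W a) b) (hv : W v = -s) (w : V) :
    inner ℝ w (W w) / 2 + inner ℝ s w =
      (inner ℝ v (W v) / 2 + inner ℝ s v) + inner ℝ (w - v) (W (w - v)) / 2 := by
  have hs : s = -W v := by rw [hv, neg_neg]
  have h1 : (inner ℝ w (W v) : ℝ) = inner ℝ (W v) w := real_inner_comm _ _
  have h2 : (inner ℝ v (W w) : ℝ) = inner ℝ (W v) w := hsym v w
  have h3 : (inner ℝ v (W v) : ℝ) = inner ℝ (W v) v := hsym v v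
  rw [hs]
  simp only [map_sub, inner_sub_left, inner_sub_right, inner_neg_left, h1, h2, h3]
  ring

/-- Completing the square, the limiting quadratic exceeds its minimum at v by at least c‖w - v‖²/2,
so any O(ε) curve doing as well as θ₀ + εv has slope v. Only this comparison is required, so the
lemma gives both existence and uniqueness of the influence function. -/
theorem tendsto_of_contaminated_le
    (hR : (fun θ => R θ - R θ₀ - inner ℝ (θ - θ₀) (W (θ - θ₀)) / 2) =o[𝓝 θ₀] fun θ => ‖θ - θ₀‖ ^ 2)
    (hS : (fun θ => S θ - S θ₀ - inner ℝ s (θ - θ₀)) =o[𝓝 θ₀] fun θ => θ - θ₀)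
    (hsym : ∀ a b, inner ℝ a (W b) = inner ℝ (W a) b) {c : ℝ} (hc : 0 < c)
    (hpos : ∀ k, c * ‖k‖ ^ 2 ≤ inner ℝ k (W k)) (hv : W v = -s)
    {T : ℝ → V} {M : ℝ} (hT : ∀ᶠ ε in 𝓝[>] (0 : ℝ), ‖T ε - θ₀‖ ≤ M * ε)
    (hmin : ∀ᶠ ε in 𝓝[>] (0 : ℝ), (1 - ε) * R (T ε) + ε * S (T ε) ≤
      (1 - ε) * R (θ₀ + ε • v) + ε * S (θ₀ + ε • v)) :
    Tendsto (fun ε => ε⁻¹ • (T ε - θ₀)) (𝓝[>] 0) (𝓝 v) := by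
  have h1 := tendsto_contaminated_quotient hR hS hT
  have h2 := tendsto_contaminated_quotient (T := fun ε => θ₀ + ε • v) (M := ‖v‖) hR hS (by
    filter_upwards [self_mem_nhdsWithin] with ε hε
    rw [add_sub_cancel_left, norm_smul, Real.norm_of_nonneg (le_of_lt hε), mul_comm])
  have h3 := (h2.sub h1).const_mul (2 / c)
  rw [sub_self, mul_zero] at h3
  rw [tendsto_iff_norm_sub_tendsto_zero]
  have h4 : Tendsto (fun ε => ‖ε⁻¹ • (T ε - θ₀) - v‖ ^ 2) (𝓝[>] 0) (𝓝 0) := by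
    refine squeeze_zero' (.of_forall fun ε => by positivity) ?_ h3
    filter_upwards [hmin, self_mem_nhdsWithin] with ε h1 h2
    have hε : 0 < ε := h2
    have e1 : ε⁻¹ • (θ₀ + ε • v - θ₀) = v := by
      rw [add_sub_cancel_left, inv_smul_smul₀ hε.ne']
    rw [e1]
    set w := ε⁻¹ • (T ε - θ₀)
    have h5 := half_inner_add_eq hsym hv w
    have h6 := hpos (w - v)
    have h7 : ((1 - ε) * R (T ε) + ε * S (T ε) - ((1 - ε) * R θ₀ + ε * S θ₀)) / ε ^ 2 ≤
      ((1 - ε) * R (θ₀ + ε • v) + ε * S (θ₀ + ε • v) - ((1 - ε) * R θ₀ + ε * S θ₀)) / ε ^ 2 := by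
      gcongr
    rw [div_mul_eq_mul_div, le_div_iff₀ hc]
    linarith
  have h5 := h4.sqrt
  simpa using h5

/-- The minimiser of a contaminated criterion is differentiable at zero contamination. -/
theorem exists_contaminated_minimiser [FiniteDimensional ℝ V] {Θ : Set V} (hΘ : Θ ∈ 𝓝 θ₀)
    (hRc : ContinuousOn R Θ) (hSc : ContinuousOn S Θ)
    (hR : (fun θ => R θ - R θ₀ - inner ℝ (θ - θ₀) (W (θ - θ₀)) / 2) =o[𝓝 θ₀] fun θ => ‖θ - θ₀‖ ^ 2)
    (hS : (fun θ => S θ - S θ₀ - inner ℝ s (θ - θ₀)) =o[𝓝 θ₀] fun θ => θ - θ₀)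
    (hsym : ∀ a b, inner ℝ a (W b) = inner ℝ (W a) b) {c : ℝ} (hc : 0 < c)
    (hpos : ∀ k, c * ‖k‖ ^ 2 ≤ inner ℝ k (W k)) (hv : W v = -s) :
    ∃ N ∈ 𝓝 θ₀, N ⊆ Θ ∧ ∃ T : ℝ → V, (∀ᶠ ε in 𝓝[>] (0 : ℝ), T ε ∈ N ∧
      IsMinOn (fun θ => (1 - ε) * R θ + ε * S θ) N (T ε)) ∧
      Tendsto (fun ε => ε⁻¹ • (T ε - θ₀)) (𝓝[>] (0 : ℝ)) (𝓝 v) := by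
  have : ProperSpace V := FiniteDimensional.proper_real V
  have h1 := hR.def (show (0 : ℝ) < c / 4 by positivity)
  have h2 := hS.def one_pos
  obtain ⟨r, hr, hball⟩ := Metric.nhds_basis_closedBall.mem_iff.1 (h1.and (h2.and hΘ))
  have hsub : Metric.closedBall θ₀ r ⊆ Θ := fun θ hθ => (hball hθ).2.2
  have hex : ∀ ε : ℝ, ∃ t ∈ Metric.closedBall θ₀ r,
      IsMinOn (fun θ => (1 - ε) * R θ + ε * S θ) (Metric.closedBall θ₀ r) t := fun ε =>
    (isCompact_closedBall θ₀ r).exists_isMinOn ⟨θ₀, Metric.mem_closedBall_self hr.le⟩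
      (((hRc.mono hsub).const_smul (1 - ε)).add ((hSc.mono hsub).const_smul ε))
  choose T hTm hTmin using hex
  refine ⟨Metric.closedBall θ₀ r, Metric.closedBall_mem_nhds θ₀ hr, hsub, T,
    .of_forall fun ε => ⟨hTm ε, hTmin ε⟩, ?_⟩
  have hlt : ∀ᶠ ε in 𝓝[>] (0 : ℝ), ε < 1 / 2 :=
    mem_nhdsWithin_of_mem_nhds (Iio_mem_nhds (by norm_num))
  -- Comparing the minimiser with θ₀ gives (1 - ε)(c/4)‖k‖² ≤ ε(‖s‖ + 1)‖k‖; with ε < 1/2 the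
  -- constant becomes 8.
  refine tendsto_of_contaminated_le hR hS hsym hc hpos hv (M := 8 * (‖s‖ + 1) / c) ?_ ?_
  · filter_upwards [self_mem_nhdsWithin, hlt] with ε hε0 hε1
    have hε : 0 < ε := hε0
    have e1 := (hball (hTm ε)).1
    have e2 := (hball (hTm ε)).2.1
    have e3 : (1 - ε) * R (T ε) + ε * S (T ε) ≤ (1 - ε) * R θ₀ + ε * S θ₀ :=
      hTmin ε (Metric.mem_closedBall_self hr.le)
    set k := T ε - θ₀ with hk
    have e4 := hpos k
    have e5 := abs_le.1 (abs_real_inner_le_norm s k)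
    rw [Real.norm_eq_abs, abs_le] at e1 e2
    rw [Real.norm_of_nonneg (by positivity)] at e1
    have e6 : c / 4 * ‖k‖ ^ 2 ≤ R (T ε) - R θ₀ := by linarith [e1.1]
    have e7 : -((‖s‖ + 1) * ‖k‖) ≤ S (T ε) - S θ₀ := by linarith [e2.1, e5.1]
    have e8 : (1 - ε) * (c / 4 * ‖k‖ ^ 2) ≤ ε * ((‖s‖ + 1) * ‖k‖) := by
      have a1 := mul_le_mul_of_nonneg_left e6 (show 0 ≤ 1 - ε by linarith)
      have a2 := mul_le_mul_of_nonneg_left e7 hε.le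
      linarith
    rcases (norm_nonneg k).eq_or_lt with h0 | h0
    · rw [← h0]; positivity
    have e9 : c / 8 * ‖k‖ * ‖k‖ ≤ ε * (‖s‖ + 1) * ‖k‖ := by
      have : 1 / 2 * (c / 4 * ‖k‖ ^ 2) ≤ (1 - ε) * (c / 4 * ‖k‖ ^ 2) := by
        gcongr; linarith
      nlinarith
    have e10 := le_of_mul_le_mul_right e9 h0
    rw [div_mul_eq_mul_div, le_div_iff₀ hc]
    linarith
  · have hc : Tendsto (fun ε : ℝ => θ₀ + ε • v) (𝓝[>] 0) (𝓝 θ₀) := by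
      have : Continuous fun τ : ℝ => θ₀ + τ • v := by fun_prop
      have h2 := (this.tendsto 0).mono_left (nhdsWithin_le_nhds (s := Ioi (0 : ℝ)))
      simpa using h2
    filter_upwards [hc (Metric.closedBall_mem_nhds θ₀ hr)] with ε hε
    exact hTmin ε hε

end Contamination

/-! ### Existence and uniqueness of the influence function. -/

section Influence

variable {q d : ℕ} {f : ℝ → ℝ} {κ lam ρ : ℝ} {PX : Measure (Euc (q + 1))} [IsProbabilityMeasure PX]
  {θ₀ : Euc q} {m : ℝ → Euc d} {P : Measure (Euc (q + 1) × Euc d)} [IsProbabilityMeasure P]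
  {𝒳 : Set (Euc (q + 1))} {μ : Euc q → ℝ → Euc d}

theorem IsSmoothFamily.continuous_link (hμ : IsSmoothFamily μ) {θ : Euc q} (hθ : θ ∈ paramSpace q) :
    Continuous fun x => μ θ (projIndex θ x) :=
  (hμ.contDiff_link hθ).continuous.comp (continuous_projIndex θ)

theorem IsSmoothFamily.continuousOn_link (hμ : IsSmoothFamily μ) (x : Euc (q + 1)) :
    ContinuousOn (fun θ => μ θ (projIndex θ x)) (paramSpace q) := by
  have h1 : ContinuousOn (fun θ : Euc q => (θ, projIndex θ x)) (paramSpace q) :=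
    continuousOn_id.prodMk (contDiffOn_projIndex.continuousOn.comp (f := fun θ => (θ, x))
      (by fun_prop) fun θ hθ => ⟨hθ, mem_univ _⟩)
  exact (ContDiffOn.continuousOn hμ).comp h1 fun θ hθ => ⟨hθ, mem_univ _⟩

theorem risk_contaminated (hl : 0 < lam) (hμ : IsSmoothFamily μ) {θ : Euc q}
    (hθ : θ ∈ paramSpace q) (z : Euc (q + 1) × Euc d) {ε : ℝ} (h0 : 0 ≤ ε) (h1 : ε ≤ 1) :
    risk (eslLoss lam) μ (contaminated P z ε) θ = (1 - ε) * risk (eslLoss lam) μ P θ +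
      ε * eslLoss lam (z.2 - μ θ (projIndex θ z.1)) := by
  have hc := hμ.continuous_link hθ
  have hcl := continuous_eslLoss (d := d) (lam := lam)
  have hcont : Continuous fun z : Euc (q + 1) × Euc d =>
    eslLoss lam (z.2 - μ θ (projIndex θ z.1)) :=
      hcl.comp (continuous_snd.sub (hc.comp continuous_fst))
  have hi : ∀ (Q : Measure (Euc (q + 1) × Euc d)) [IsFiniteMeasure Q], Integrable
      (fun z : Euc (q + 1) × Euc d => eslLoss lam (z.2 - μ θ (projIndex θ z.1))) Q := fun Q _ =>
    Integrable.of_bound hcont.aestronglyMeasurable 1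
      (.of_forall fun z => by rw [Real.norm_eq_abs]; exact abs_eslLoss_le_one hl _)
  rw [risk, contaminated, integral_add_measure ((hi _).smul_measure ENNReal.ofReal_ne_top)
    ((hi _).smul_measure ENNReal.ofReal_ne_top), integral_smul_measure, integral_smul_measure,
    integral_dirac, ENNReal.toReal_ofReal (by linarith), ENNReal.toReal_ofReal h0]
  rfl

theorem continuousOn_risk (hl : 0 < lam) (hμ : IsSmoothFamily μ) :
    ContinuousOn (risk (eslLoss lam) μ P) (paramSpace q) := by
  have hcl := continuous_eslLoss (d := d) (lam := lam)
  unfold risk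
  refine continuousOn_of_dominated (bound := fun _ => 1) (fun θ hθ => ?_) (fun θ hθ => ?_)
    (integrable_const _) (.of_forall fun z => ?_)
  · have hc := hμ.continuous_link hθ
    exact (hcl.comp (continuous_snd.sub (hc.comp continuous_fst))).aestronglyMeasurable
  · exact .of_forall fun z => by rw [Real.norm_eq_abs]; exact abs_eslLoss_le_one hl _
  · exact hcl.comp_continuousOn (continuousOn_const.sub (hμ.continuousOn_link z.1))

/-- The influence function exists and is unique, and solves the linearised estimating equation. -/
theorem IsGoodFit.exists_influence (h : IsGoodFit PX 𝒳 θ₀ m f κ P lam ρ μ)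
    (hdet : IsUnit (hessianW (eslLoss lam) P μ θ₀).det) (z : Euc (q + 1) × Euc d) :
    ∃ v : Euc q, (∀ v', HasInfluence (eslLoss lam) μ P θ₀ z v' ↔ v' = v) ∧
      ∀ k, inner ℝ v (Matrix.toEuclideanCLM (n := Fin q) (𝕜 := ℝ)
        (hessianW (eslLoss lam) P μ θ₀) k) =
        2 / lam * eslWeight lam (z.2 - μ θ₀ (projIndex θ₀ z.1)) *
          inner ℝ (z.2 - μ θ₀ (projIndex θ₀ z.1)) (linkDeriv μ θ₀ z.1 k) := by
  set Wm := hessianW (eslLoss lam) P μ θ₀ with hWm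
  have hpd := h.posDef_hessianW hdet
  set W := Matrix.toEuclideanCLM (n := Fin q) (𝕜 := ℝ) Wm with hW
  set R := risk (eslLoss lam) μ P with hRdef
  set S : Euc q → ℝ := fun θ => eslLoss lam (z.2 - μ θ (projIndex θ z.1)) with hSdef
  set w := z.2 - μ θ₀ (projIndex θ₀ z.1) with hw
  set L : Euc q →L[ℝ] ℝ := -((2 / lam * eslWeight lam w) • (innerSL ℝ w).comp (linkDeriv μ θ₀ z.1))
    with hL
  set s := (InnerProductSpace.toDual ℝ (Euc q)).symm L with hs
  have hsL : ∀ k, inner ℝ s k = L k := fun k => by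
    rw [hs, InnerProductSpace.toDual_symm_apply]
  have hSd : HasFDerivAt S L θ₀ := by
    have h1 := (h.smooth.hasFDerivAt_link h.mem_param z.1).const_sub z.2
    refine (HasFDerivAt.comp (g := eslLoss lam) θ₀ (hasFDerivAt_eslLoss w) h1).congr_fderiv ?_
    refine ContinuousLinearMap.ext fun k => ?_
    simp [hL]
  have hS : (fun θ => S θ - S θ₀ - inner ℝ s (θ - θ₀)) =o[𝓝 θ₀] fun θ => θ - θ₀ := by
    simp only [hsL]
    exact hSd.isLittleO
  have hR : (fun θ => R θ - R θ₀ - inner ℝ (θ - θ₀) (W (θ - θ₀)) / 2) =o[𝓝 θ₀]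
      fun θ => ‖θ - θ₀‖ ^ 2 := by
    simp only [hW, Matrix.inner_toEuclideanCLM]
    exact h.risk_isLittleO
  have hsym : ∀ a b, inner ℝ a (W b) = inner ℝ (W a) b := fun a b => by
    rw [real_inner_comm b (W a), hW, Matrix.inner_toEuclideanCLM, Matrix.inner_toEuclideanCLM, Matrix.dotProduct_mulVec,
      ← Matrix.mulVec_transpose, dotProduct_comm]
    congr 2
    have := hpd.isHermitian.eq
    rwa [Matrix.conjTranspose_eq_transpose_of_trivial] at this
  obtain ⟨c, hc, hpos⟩ := exists_pos_mul_norm_sq_le (Q := fun k => inner ℝ k (W k)) (by fun_prop)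
    (fun τ k => by
      simp only [map_smul, real_inner_smul_left, real_inner_smul_right]; ring) (fun k hk => by
      rw [hW, Matrix.inner_toEuclideanCLM]
      have := hpd.dotProduct_mulVec_pos (x := fun i => k i) (fun h0 => hk (by
        ext i; exact congrFun h0 i))
      simpa using this)
  set v : Euc q := -WithLp.toLp 2 (Wm⁻¹ *ᵥ fun i => s i) with hvdef
  have hv : W v = -s := by
    rw [hvdef, map_neg, hW, Matrix.toEuclideanCLM_toLp, Matrix.mulVec_mulVec,
      Matrix.mul_nonsing_inv _ hdet, Matrix.one_mulVec]
  have hΘ := isOpen_paramSpace.mem_nhds h.mem_param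
  have hlt : ∀ᶠ ε in 𝓝[>] (0 : ℝ), 0 ≤ ε ∧ ε ≤ 1 := by
    filter_upwards [self_mem_nhdsWithin, mem_nhdsWithin_of_mem_nhds (Iic_mem_nhds one_pos)] with
      ε h1 h2 using ⟨le_of_lt h1, h2⟩
  have hSc : ContinuousOn S (paramSpace q) :=
    continuous_eslLoss.comp_continuousOn (continuousOn_const.sub (h.smooth.continuousOn_link z.1))
  refine ⟨v, fun v' => ⟨?_, ?_⟩, fun k => ?_⟩
  -- Uniqueness: convergence of the quotient to v' already gives the O(ε) bound, so neither the
  -- neighbourhood N nor the selection T matters.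
  · rintro ⟨N, hN, hNΘ, T, hT, hTv⟩
    refine tendsto_nhds_unique hTv (tendsto_of_contaminated_le hR hS hsym hc hpos hv
      (M := ‖v'‖ + 1) ?_ ?_)
    · filter_upwards [hTv.norm.eventually_le_const (lt_add_one ‖v'‖), self_mem_nhdsWithin] with
        ε h1 h2
      have hε : 0 < ε := h2
      rw [norm_smul, Real.norm_of_nonneg (by positivity), inv_mul_le_iff₀ hε] at h1
      linarith
    · have hc : Tendsto (fun ε : ℝ => θ₀ + ε • v) (𝓝[>] 0) (𝓝 θ₀) := by
        have : Continuous fun τ : ℝ => θ₀ + τ • v := by fun_prop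
        have h2 := (this.tendsto 0).mono_left (nhdsWithin_le_nhds (s := Ioi (0 : ℝ)))
        simpa using h2
      filter_upwards [hT, hlt, hc hN] with ε h1 h2 h3
      have h4 := h1.2 h3
      simp only [mem_ofPred_eq] at h4
      rwa [risk_contaminated h.lam_pos h.smooth (hNΘ h1.1) z h2.1 h2.2,
        risk_contaminated h.lam_pos h.smooth (hNΘ h3) z h2.1 h2.2] at h4
  · rintro rfl
    obtain ⟨N, hN, hNΘ, T, hT, hTv⟩ := exists_contaminated_minimiser hΘ
      (continuousOn_risk h.lam_pos h.smooth) hSc hR hS hsym hc hpos hv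
    refine ⟨N, hN, hNΘ, T, ?_, hTv⟩
    filter_upwards [hT, hlt] with ε h1 h2
    refine ⟨h1.1, fun θ hθ => ?_⟩
    have h4 := h1.2 hθ
    simp only [mem_ofPred_eq] at h4 ⊢
    rwa [risk_contaminated h.lam_pos h.smooth (hNΘ h1.1) z h2.1 h2.2,
        risk_contaminated h.lam_pos h.smooth (hNΘ hθ) z h2.1 h2.2]
  · rw [hsym, hv, inner_neg_left, hsL]
    simp [hL]

end Influence

/-! ### The quadratic form of the predictor law. -/

section Gap

variable {q d : ℕ} {PX : Measure (Euc (q + 1))} [IsProbabilityMeasure PX]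
  {θ₀ : Euc q} {m : ℝ → Euc d} {𝒳 : Set (Euc (q + 1))}

/-- The derivative of the index, centred conditionally on the index. -/
noncomputable def indexGap (PX : Measure (Euc (q + 1))) [IsFiniteMeasure PX] (θ : Euc q) (k : Euc q)
    (x : Euc (q + 1)) : ℝ :=
  indexDeriv θ x k - indexMean PX θ (fun x => indexDeriv θ x k) (projIndex θ x)

/-- The quadratic form `k ↦ 𝔼[(indexGap k X)² ‖m'(U)‖²]`. -/
noncomputable def gapForm (PX : Measure (Euc (q + 1))) [IsFiniteMeasure PX] (θ : Euc q)
    (m : ℝ → Euc d) (k : Euc q) : ℝ :=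
  ∫ x, indexGap PX θ k x ^ 2 * ‖deriv m (projIndex θ x)‖ ^ 2 ∂PX

theorem measurable_indexGap (k : Euc q) : Measurable (indexGap PX θ₀ k) := by
  have hιc : Continuous fun x => indexDeriv θ₀ x k :=
    (continuous_indexDeriv θ₀).clm_apply continuous_const
  exact hιc.measurable.sub
    ((measurable_indexMean θ₀ hιc.measurable).comp (continuous_projIndex θ₀).measurable)

theorem gapForm_smul (τ : ℝ) (k : Euc q) :
    gapForm PX θ₀ m (τ • k) = τ ^ 2 * gapForm PX θ₀ m k := by
  simp only [gapForm, indexGap, indexMean, map_smul, smul_eq_mul, integral_const_mul]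
  rw [← integral_const_mul]
  congr 1; ext x; ring

theorem ae_integrable_condDistrib (h𝒳 : IsCompact 𝒳) (hPX : ∀ᵐ x ∂PX, x ∈ 𝒳) :
    ∀ᵐ x ∂PX, ∀ g : Euc (q + 1) → ℝ, Continuous g →
      Integrable g (condDistrib id (projIndex θ₀) PX (projIndex θ₀ x)) := by
  filter_upwards [ae_of_ae_map (continuous_projIndex θ₀).measurable.aemeasurable
    (ae_condDistrib_of_ae θ₀ hPX)] with x hx g hg
  obtain ⟨C, hC⟩ := h𝒳.exists_bound_of_continuousOn hg.continuousOn
  refine Integrable.of_bound hg.aestronglyMeasurable C ?_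
  filter_upwards [hx] with x hx using hC x hx

theorem ae_indexGap_eq_sum (h𝒳 : IsCompact 𝒳) (hPX : ∀ᵐ x ∂PX, x ∈ 𝒳) :
    ∀ᵐ x ∂PX, ∀ k, indexGap PX θ₀ k x =
      ∑ i, k i * indexGap PX θ₀ (EuclideanSpace.single i 1) x := by
  filter_upwards [ae_integrable_condDistrib (θ₀ := θ₀) h𝒳 hPX] with x hx k
  have hk : k = ∑ j, k j • EuclideanSpace.single j (1 : ℝ) := by
    ext i; simp [Finset.sum_apply, Pi.single_apply]
  have hs : ∀ x, indexDeriv θ₀ x k =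
      ∑ i, k i * indexDeriv θ₀ x (EuclideanSpace.single i 1) := fun x => by
    conv_lhs => rw [hk, map_sum]
    simp
  simp only [indexGap, indexMean, hs]
  rw [integral_finsetSum _ fun i _ => (hx _
    ((continuous_indexDeriv θ₀).clm_apply continuous_const)).const_mul _]
  simp only [integral_const_mul, mul_sub, Finset.sum_sub_distrib]

theorem ae_abs_indexGap_le (hPX : ∀ᵐ x ∂PX, x ∈ 𝒳) {M : ℝ} {k : Euc q}
    (hM : ∀ x ∈ 𝒳, |indexDeriv θ₀ x k| ≤ M) : ∀ᵐ x ∂PX, |indexGap PX θ₀ k x| ≤ 2 * M := by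
  filter_upwards [hPX, ae_of_ae_map (continuous_projIndex θ₀).measurable.aemeasurable
    (ae_condDistrib_of_ae θ₀ hPX)] with x hx hx'
  have h3 : ‖indexMean PX θ₀ (fun x => indexDeriv θ₀ x k) (projIndex θ₀ x)‖ ≤ M := by
    refine (norm_integral_le_of_norm_le_const (C := M) ?_).trans (by simp)
    filter_upwards [hx'] with x hx using hM x hx
  have h4 := hM x hx
  refine (abs_sub _ _).trans ?_
  rw [Real.norm_eq_abs] at h3
  linarith

/-- The conditional mean is linear in k only for almost every x, so continuity is read off after
integration, where the form is a quadratic polynomial in the coordinates of k. -/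
theorem continuous_gapForm (h𝒳 : IsCompact 𝒳) (hPX : ∀ᵐ x ∂PX, x ∈ 𝒳) (hm : ContDiff ℝ 1 m) :
    Continuous (gapForm PX θ₀ m) := by
  have hdm : Continuous fun x => ‖deriv m (projIndex θ₀ x)‖ ^ 2 :=
    (((hm.continuous_deriv le_rfl).comp (continuous_projIndex θ₀)).norm).pow 2
  have hint : ∀ k l, Integrable (fun x => indexGap PX θ₀ k x * indexGap PX θ₀ l x *
      ‖deriv m (projIndex θ₀ x)‖ ^ 2) PX := by
    intro k l
    have hb : ∀ k, ∃ M, ∀ᵐ x ∂PX, |indexGap PX θ₀ k x| ≤ M := fun k => by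
      obtain ⟨M, hM⟩ := h𝒳.exists_bound_of_continuousOn
        (f := fun x => indexDeriv θ₀ x k)
        ((continuous_indexDeriv θ₀).clm_apply continuous_const).continuousOn
      exact ⟨2 * M, ae_abs_indexGap_le hPX hM⟩
    obtain ⟨A, hA⟩ := hb k
    obtain ⟨B, hB⟩ := hb l
    obtain ⟨C, hC⟩ := h𝒳.exists_bound_of_continuousOn hdm.continuousOn
    refine Integrable.of_bound (((measurable_indexGap k).mul (measurable_indexGap l)).mul
      hdm.measurable).aestronglyMeasurable (A * B * C) ?_
    filter_upwards [hA, hB, hPX] with x h1 h2 h3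
    have h4 := hC x h3
    have h5 : 0 ≤ A := (abs_nonneg _).trans h1
    have h6 : 0 ≤ B := (abs_nonneg _).trans h2
    rw [norm_mul, norm_mul]
    exact mul_le_mul (mul_le_mul h1 h2 (abs_nonneg _) h5) h4 (norm_nonneg _) (by positivity)
  have e : gapForm PX θ₀ m = fun k => ∑ i, ∑ j, k i * k j *
      ∫ x, indexGap PX θ₀ (EuclideanSpace.single i 1) x *
        indexGap PX θ₀ (EuclideanSpace.single j 1) x * ‖deriv m (projIndex θ₀ x)‖ ^ 2 ∂PX := by
    ext k
    simp_rw [← integral_const_mul]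
    simp_rw [← integral_finsetSum _ fun j _ => (hint _ _).const_mul _]
    rw [← integral_finsetSum _ fun i _ => integrable_finsetSum _ fun j _ => (hint _ _).const_mul _]
    refine integral_congr_ae ?_
    filter_upwards [ae_indexGap_eq_sum (θ₀ := θ₀) h𝒳 hPX] with x hx
    rw [hx k, sq, Finset.sum_mul_sum, Finset.sum_mul]
    refine Finset.sum_congr rfl fun i _ => ?_
    rw [Finset.sum_mul]
    refine Finset.sum_congr rfl fun j _ => ?_
    ring
  rw [e]
  fun_prop

end Gap

/-! ### Rotational averaging over tangent directions. -/

section Symmetry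

variable {d : ℕ} {f : ℝ → ℝ} {κ lam ρ : ℝ}

/-- The angular density with the squared weight of the loss, tested against `1 - ⟨y, v⟩²`. -/
noncomputable def tangentWeight (lam ρ : ℝ) (v y : Euc d) : ℝ :=
  (1 - inner ℝ y v ^ 2) * Real.exp (-2 * ‖y - ρ • v‖ ^ 2 / lam)

theorem integral_tangentWeight_eq [NeZero d] (hf0 : ∀ x, 0 ≤ f x) (hf : Monotone f) {v w : Euc d}
    (h : ‖v‖ = ‖w‖) : ∫ y, tangentWeight lam ρ v y ∂(angularLaw f κ v) =
      ∫ y, tangentWeight lam ρ w y ∂(angularLaw f κ w) := by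
  obtain ⟨O, hO, -⟩ := exists_isometry_map h
  rw [← hO, integral_angularLaw_isometry hf0 hf]
  simp_rw [tangentWeight, ← map_smul, ← map_sub, LinearIsometryEquiv.norm_map,
    LinearIsometryEquiv.inner_map_map]

/-- Complete v to an orthonormal basis. An isometry fixing v carries ‖a‖ times any other basis
vector to a, so all d - 1 tangential moments agree; they add up to the moment of 1 - ⟨y, v⟩² by
Parseval. -/
theorem integral_inner_sq_mul_exp [NeZero d] (hf0 : ∀ x, 0 ≤ f x) (hf : Monotone f) {v : Euc d}
    (hv : ‖v‖ = 1) [IsProbabilityMeasure (angularLaw f κ v)] {a : Euc d} (ha : inner ℝ v a = (0 : ℝ)) :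
    ((d : ℝ) - 1) * ∫ y, inner ℝ y a ^ 2 * Real.exp (-2 * ‖y - ρ • v‖ ^ 2 / lam) ∂(angularLaw f κ v) =
      ‖a‖ ^ 2 * ∫ y, tangentWeight lam ρ v y ∂(angularLaw f κ v) := by
  obtain ⟨b, hb⟩ := Orthonormal.exists_orthonormalBasis_extension_of_card_eq (𝕜 := ℝ) (ι := Fin d)
    (E := Euc d) (by simp) (v := fun _ => v) (s := {0})
    ⟨fun _ => hv, fun i j hij => (hij (Subsingleton.elim i j)).elim⟩
  have hb0 : b 0 = v := hb 0 rfl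
  have h1 : ∀ i, i ≠ 0 →
      ∫ y, inner ℝ y a ^ 2 * Real.exp (-2 * ‖y - ρ • v‖ ^ 2 / lam) ∂(angularLaw f κ v) =
      ∫ y, ‖a‖ ^ 2 * (inner ℝ y (b i) ^ 2 * Real.exp (-2 * ‖y - ρ • v‖ ^ 2 / lam))
        ∂(angularLaw f κ v) := by
    intro i hi
    have hvi : inner ℝ v (b i) = (0 : ℝ) := by rw [← hb0]; exact b.orthonormal.2 hi.symm
    obtain ⟨O, hO, hfix⟩ := exists_isometry_map (v := ‖a‖ • b i) (w := a)
      (by rw [norm_smul, b.orthonormal.1 i]; simp)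
    have hOv : O v = v := hfix v (by rw [real_inner_smul_right, hvi, mul_zero]) ha
    have h2 := integral_angularLaw_isometry (κ := κ) hf0 hf O (m := v) (fun y =>
      (inner ℝ y a : ℝ) ^ 2 * Real.exp (-2 * ‖y - ρ • v‖ ^ 2 / lam))
    rw [hOv] at h2
    rw [h2]
    congr 1; ext y
    have h3 : O y - ρ • v = O (y - ρ • v) := by rw [map_sub, map_smul, hOv]
    have h4 : (inner ℝ (O y) a : ℝ) = ‖a‖ * inner ℝ y (b i) := by
      conv_lhs => rw [← hO]
      rw [LinearIsometryEquiv.inner_map_map, real_inner_smul_right]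
    rw [h3, h4, LinearIsometryEquiv.norm_map]; ring
  have hcard : ((Finset.univ.erase (0 : Fin d)).card : ℝ) = (d : ℝ) - 1 := by
    rw [Finset.card_erase_of_mem (Finset.mem_univ _), Finset.card_univ, Fintype.card_fin,
      Nat.cast_sub NeZero.one_le, Nat.cast_one]
  have h2 := Finset.sum_congr rfl fun i (hi : i ∈ Finset.univ.erase (0 : Fin d)) =>
    h1 i (Finset.ne_of_mem_erase hi)
  rw [Finset.sum_const, nsmul_eq_mul, hcard] at h2
  rw [h2, ← integral_finsetSum _ fun i _ => integrable_angularLaw (by fun_prop),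
    ← integral_const_mul]
  refine integral_congr_ae ?_
  filter_upwards [ae_angularLaw_norm] with y hy
  have h3 : ∑ i ∈ Finset.univ.erase (0 : Fin d), (inner ℝ y (b i) : ℝ) ^ 2 = 1 - inner ℝ y v ^ 2 := by
    have h4 := b.sum_sq_norm_inner_left y
    rw [hy, ← Finset.add_sum_erase _ _ (Finset.mem_univ 0), hb0] at h4
    simp only [Real.norm_eq_abs, sq_abs] at h4
    linarith
  rw [← Finset.mul_sum, ← Finset.sum_mul, h3, tangentWeight]

theorem inner_sq_le_of_orthogonal {v y a : Euc d} (hv : ‖v‖ = 1) (hy : ‖y‖ = 1)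
    (ha : inner ℝ v a = (0 : ℝ)) : (inner ℝ y a : ℝ) ^ 2 ≤ ‖a‖ ^ 2 * (1 - inner ℝ y v ^ 2) := by
  set c : ℝ := inner ℝ y v with hc
  have h1 : (inner ℝ y a : ℝ) = inner ℝ (y - c • v) a := by
    rw [inner_sub_left, real_inner_smul_left, ha]; ring
  have h2 : ‖y - c • v‖ ^ 2 = 1 - c ^ 2 := by
    rw [norm_sub_sq_real, real_inner_smul_right, norm_smul, hv, hy, ← hc, Real.norm_eq_abs, mul_one,
      sq_abs]
    ring
  rw [h1, ← h2, mul_comm, ← mul_pow, ← sq_abs]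
  exact pow_le_pow_left₀ (abs_nonneg _) (abs_real_inner_le_norm _ _) 2

end Symmetry

/-! ### From scores to the standardized sensitivity. -/

section Sensitivity

variable {q d : ℕ} {f : ℝ → ℝ} {κ lam ρ : ℝ} {PX : Measure (Euc (q + 1))} [IsProbabilityMeasure PX]
  {θ₀ : Euc q} {m : ℝ → Euc d} {P : Measure (Euc (q + 1) × Euc d)} [IsProbabilityMeasure P]
  {𝒳 : Set (Euc (q + 1))} {μ : Euc q → ℝ → Euc d}

/-- If `⟨v, l⟩² ≤ B · lᵀ Σ l` for every `l`, then `vᵀ Σ⁻¹ v ≤ B`. -/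
theorem dotProduct_inv_mulVec_le {n : Type*} [Fintype n] [DecidableEq n] {S : Matrix n n ℝ}
    (hS : IsUnit S.det) {v : n → ℝ} {B : ℝ} (hB : 0 ≤ B)
    (h : ∀ l : n → ℝ, (v ⬝ᵥ l) ^ 2 ≤ B * (l ⬝ᵥ (S *ᵥ l))) : v ⬝ᵥ (S⁻¹ *ᵥ v) ≤ B := by
  -- For this l the hypothesis reads a² ≤ B a with a = vᵀ S⁻¹ v.
  have h1 := h (S⁻¹ *ᵥ v)
  rw [Matrix.mulVec_mulVec, Matrix.mul_nonsing_inv _ hS, Matrix.one_mulVec,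
    dotProduct_comm (S⁻¹ *ᵥ v)] at h1
  by_contra hlt
  rw [not_le] at hlt
  nlinarith

theorem gapForm_nonneg {k : Euc q} : 0 ≤ gapForm PX θ₀ m k :=
  integral_nonneg fun x => by positivity

/-- The score of the fit in direction `k`, i.e. minus the derivative of the loss. -/
noncomputable def fitScore (lam : ℝ) (μ : Euc q → ℝ → Euc d) (θ₀ : Euc q) (k : Euc q)
    (z : Euc (q + 1) × Euc d) : ℝ :=
  2 / lam * eslWeight lam (z.2 - μ θ₀ (projIndex θ₀ z.1)) *
    inner ℝ (z.2 - μ θ₀ (projIndex θ₀ z.1)) (linkDeriv μ θ₀ z.1 k)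

theorem eslWeight_sq (w : Euc d) : eslWeight lam w ^ 2 = Real.exp (-2 * ‖w‖ ^ 2 / lam) := by
  rw [eslWeight, sq, ← Real.exp_add]
  congr 1; ring

namespace IsGoodFit

theorem continuous_fitScore (h : IsGoodFit PX 𝒳 θ₀ m f κ P lam ρ μ) (k : Euc q) :
    Continuous (fitScore lam μ θ₀ k) := by
  have hc := h.smooth.continuous_link h.mem_param
  have hcd := h.smooth.continuous_linkDeriv h.mem_param
  have hw : Continuous fun z : Euc (q + 1) × Euc d => z.2 - μ θ₀ (projIndex θ₀ z.1) :=
    continuous_snd.sub (hc.comp continuous_fst)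
  exact (continuous_const.mul (continuous_eslWeight.comp hw)).mul
    (hw.inner ((hcd.comp continuous_fst).clm_apply continuous_const))

theorem fitScore_sq (h : IsGoodFit PX 𝒳 θ₀ m f κ P lam ρ μ) {k : Euc q} {x : Euc (q + 1)}
    (hx : x ∈ 𝒳) {c : ℝ} (hc : linkDeriv μ θ₀ x k = c • deriv (μ θ₀) (projIndex θ₀ x)) (y : Euc d) :
    fitScore lam μ θ₀ k (x, y) ^ 2 = (2 * ρ / lam) ^ 2 * c ^ 2 *
      (inner ℝ y (deriv m (projIndex θ₀ x)) ^ 2 *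
        Real.exp (-2 * ‖y - ρ • m (projIndex θ₀ x)‖ ^ 2 / lam)) := by
  have hs := h.mem_support x hx
  have h0 := h.inner_deriv_eq_zero hs
  have h1 : (inner ℝ (y - ρ • m (projIndex θ₀ x)) (deriv m (projIndex θ₀ x)) : ℝ) =
      inner ℝ y (deriv m (projIndex θ₀ x)) := by
    rw [inner_sub_left, real_inner_smul_left, h0, mul_zero, sub_zero]
  simp only [fitScore]
  rw [hc, h.deriv_link_eq hs, h.link_eq _ hs, real_inner_smul_right, real_inner_smul_right, h1,
    ← eslWeight_sq]
  ring

/-- If the form vanished at k, the link derivative in direction k would vanish almost surely, and so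
would the quadratic form of W. Thus invertibility of W at a single concentration makes a form
depending only on the predictor law, θ₀ and m nondegenerate. -/
theorem gapForm_pos (h : IsGoodFit PX 𝒳 θ₀ m f κ P lam ρ μ)
    (hdet : IsUnit (hessianW (eslLoss lam) P μ θ₀).det) {k : Euc q} (hk : k ≠ 0) :
    0 < gapForm PX θ₀ m k := by
  refine gapForm_nonneg.lt_of_ne' fun h0 => ?_
  have hpd := h.posDef_hessianW hdet
  have h1 := hpd.dotProduct_mulVec_pos (x := fun i => k i) (fun h0 => hk (by
    ext i; exact congrFun h0 i))
  rw [star_trivial, h.dotProduct_hessianW, h.integral (h.integrable_eslHess _ _)] at h1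
  obtain ⟨M, hM⟩ := h.compact.exists_bound_of_continuousOn
    (f := fun x => indexDeriv θ₀ x k)
    ((continuous_indexDeriv θ₀).clm_apply continuous_const).continuousOn
  have hdm : Continuous fun x => ‖deriv m (projIndex θ₀ x)‖ ^ 2 :=
    (((h.contDiff.continuous_deriv le_rfl).comp (continuous_projIndex θ₀)).norm).pow 2
  obtain ⟨C, hC⟩ := h.compact.exists_bound_of_continuousOn hdm.continuousOn
  have hint : Integrable (fun x => indexGap PX θ₀ k x ^ 2 * ‖deriv m (projIndex θ₀ x)‖ ^ 2) PX := by
    refine Integrable.of_bound (((measurable_indexGap k).pow_const 2).mul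
      hdm.measurable).aestronglyMeasurable ((2 * M) ^ 2 * C) ?_
    filter_upwards [ae_abs_indexGap_le h.mem_ae hM, h.mem_ae] with x h1 h2
    rw [norm_mul, norm_pow]
    exact mul_le_mul (pow_le_pow_left₀ (norm_nonneg _) h1 2) (hC x h2) (norm_nonneg _) (by positivity)
  have h2 := (integral_eq_zero_iff_of_nonneg (fun x => by positivity) hint).1 h0
  have h3 : ∀ᵐ x ∂PX, linkDeriv μ θ₀ x k = 0 := by
    filter_upwards [h2, h.ae_linkDeriv_eq k, h.mem_ae] with x h2 h3 h4
    rw [h3, h.deriv_link_eq (h.mem_support x h4)]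
    rcases mul_eq_zero.1 h2 with h5 | h5
    · have : indexGap PX θ₀ k x = 0 := by simpa using h5
      rw [indexGap] at this
      rw [this, zero_smul]
    · have : deriv m (projIndex θ₀ x) = 0 := by simpa using h5
      rw [this, smul_zero, smul_zero]
  rw [integral_congr_ae (g := fun _ => (0 : ℝ))] at h1
  · simp at h1
  · filter_upwards [h3] with x hx
    simp [hx, eslHess]

theorem influenceFunction_spec (h : IsGoodFit PX 𝒳 θ₀ m f κ P lam ρ μ)
    (hdet : IsUnit (hessianW (eslLoss lam) P μ θ₀).det) (z : Euc (q + 1) × Euc d) (k : Fin q → ℝ) :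
    (fun i => influenceFunction (eslLoss lam) μ P θ₀ z i) ⬝ᵥ (hessianW (eslLoss lam) P μ θ₀ *ᵥ k) =
      fitScore lam μ θ₀ (WithLp.toLp 2 k) z := by
  obtain ⟨v, hv, hk⟩ := h.exists_influence hdet z
  have h1 : influenceFunction (eslLoss lam) μ P θ₀ z = v :=
    (hv _).1 (Classical.epsilon_spec (p := HasInfluence (eslLoss lam) μ P θ₀ z) ⟨v, (hv v).2 rfl⟩)
  rw [h1, fitScore, ← hk, Matrix.inner_toEuclideanCLM]

variable [NeZero d]

theorem integral_fitScore_sq (h : IsGoodFit PX 𝒳 θ₀ m f κ P lam ρ μ) (k : Euc q) {m₀ : Euc d}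
    (hm₀ : ‖m₀‖ = 1) :
    ((d : ℝ) - 1) * ∫ z, fitScore lam μ θ₀ k z ^ 2 ∂P = (2 * ρ / lam) ^ 2 * gapForm PX θ₀ m k *
      ∫ y, tangentWeight lam ρ m₀ y ∂(angularLaw f κ m₀) := by
  obtain ⟨I, hI⟩ : ∃ I, ∫ y, tangentWeight lam ρ m₀ y ∂(angularLaw f κ m₀) = I := ⟨_, rfl⟩
  rw [hI, h.integral (g := fun z => fitScore lam μ θ₀ k z ^ 2)
    (h.toIsGoodModel.integrable ((h.continuous_fitScore k).pow 2)), gapForm,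
    ← integral_const_mul, ← integral_const_mul, ← integral_mul_const]
  refine integral_congr_ae ?_
  filter_upwards [h.ae_linkDeriv_eq k, h.mem_ae] with x h1 h2
  have hu := h.unit_of_mem h2
  have := h.isProb hu
  simp only [h.fitScore_sq h2 h1, integral_const_mul]
  have h3 := integral_inner_sq_mul_exp (κ := κ) (lam := lam) (ρ := ρ) h.nonneg h.mono hu
    (h.inner_deriv_eq_zero (h.mem_support x h2))
  -- The tangential moment is the same around every unit vector, so it leaves the integral over x.
  rw [integral_tangentWeight_eq h.nonneg h.mono (hu.trans hm₀.symm), hI] at h3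
  calc _ = (2 * ρ / lam) ^ 2 * indexGap PX θ₀ k x ^ 2 * (((d : ℝ) - 1) *
        ∫ y, inner ℝ y (deriv m (projIndex θ₀ x)) ^ 2 *
          Real.exp (-2 * ‖y - ρ • m (projIndex θ₀ x)‖ ^ 2 / lam)
            ∂(angularLaw f κ (m (projIndex θ₀ x)))) := by rw [indexGap]; ring
    _ = _ := by rw [h3]; ring

/-- The factor (2ρ/λ)² appears in the pointwise square and in the mean square, and cancels. The
squared coefficient of m' is at most 4M²‖k‖², and ‖k‖² is controlled by the form in the mean square.
-/
theorem fitScore_sq_le (h : IsGoodFit PX 𝒳 θ₀ m f κ P lam ρ μ) {c M M₁ B : ℝ} (hc : 0 < c)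
    (hgap : ∀ k, c * ‖k‖ ^ 2 ≤ gapForm PX θ₀ m k)
    (hM : ∀ x ∈ 𝒳, ∀ k, |indexDeriv θ₀ x k| ≤ M * ‖k‖)
    (hM₁ : ∀ x ∈ 𝒳, ‖deriv m (projIndex θ₀ x)‖ ≤ M₁) {m₀ : Euc d} (hm₀ : ‖m₀‖ = 1)
    (hratio : ∀ y, ‖y‖ = 1 → tangentWeight lam ρ m₀ y ≤
      B * ∫ y, tangentWeight lam ρ m₀ y ∂(angularLaw f κ m₀)) (k : Euc q)
    {z : Euc (q + 1) × Euc d} (hz : z ∈ 𝒳 ×ˢ Metric.sphere (0 : Euc d) 1) :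
    fitScore lam μ θ₀ k z ^ 2 ≤
      (4 * M ^ 2 * M₁ ^ 2 * ((d : ℝ) - 1) / c * B) * ∫ z, fitScore lam μ θ₀ k z ^ 2 ∂P := by
  obtain ⟨x, y⟩ := z
  have hx : x ∈ 𝒳 := hz.1
  have hy : ‖y‖ = 1 := by simpa using hz.2
  obtain ⟨a, ha, he⟩ := h.exists_linkDeriv_eq (fun x hx => hM x hx k) hx
  have hu := h.unit_of_mem hx
  have h0 := h.inner_deriv_eq_zero (h.mem_support x hx)
  set I := ∫ y, tangentWeight lam ρ m₀ y ∂(angularLaw f κ m₀) with hI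
  obtain ⟨O, hO, -⟩ := exists_isometry_map (hu.trans hm₀.symm)
  have hw : tangentWeight lam ρ (m (projIndex θ₀ x)) y = tangentWeight lam ρ m₀ (O y) := by
    simp only [tangentWeight, ← hO, ← map_smul, ← map_sub, LinearIsometryEquiv.norm_map,
      LinearIsometryEquiv.inner_map_map]
  have h1 : tangentWeight lam ρ (m (projIndex θ₀ x)) y ≤ B * I := by
    rw [hw]; exact hratio _ (by rw [LinearIsometryEquiv.norm_map, hy])
  have ht0 : 0 ≤ tangentWeight lam ρ (m (projIndex θ₀ x)) y := by
    refine mul_nonneg ?_ (Real.exp_pos _).le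
    have := abs_real_inner_le_norm y (m (projIndex θ₀ x))
    rw [hy, hu, mul_one] at this
    have := (sq_le_one_iff_abs_le_one _).2 this
    linarith
  have h2 : inner ℝ y (deriv m (projIndex θ₀ x)) ^ 2 *
      Real.exp (-2 * ‖y - ρ • m (projIndex θ₀ x)‖ ^ 2 / lam) ≤ M₁ ^ 2 * (B * I) := by
    calc _ ≤ ‖deriv m (projIndex θ₀ x)‖ ^ 2 * (1 - inner ℝ y (m (projIndex θ₀ x)) ^ 2) *
          Real.exp (-2 * ‖y - ρ • m (projIndex θ₀ x)‖ ^ 2 / lam) := by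
          gcongr; exact inner_sq_le_of_orthogonal hu hy h0
      _ = ‖deriv m (projIndex θ₀ x)‖ ^ 2 * tangentWeight lam ρ (m (projIndex θ₀ x)) y := by
          rw [tangentWeight]; ring
      _ ≤ M₁ ^ 2 * (B * I) := by
          refine mul_le_mul (pow_le_pow_left₀ (norm_nonneg _) (hM₁ x hx) 2) h1 ht0 (by positivity)
  have h3 : a ^ 2 ≤ 4 * M ^ 2 * (gapForm PX θ₀ m k / c) := by
    have h4 : ‖k‖ ^ 2 ≤ gapForm PX θ₀ m k / c := by
      rw [le_div_iff₀ hc]; linarith [hgap k]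
    calc a ^ 2 = |a| ^ 2 := (sq_abs a).symm
      _ ≤ (2 * (M * ‖k‖)) ^ 2 := pow_le_pow_left₀ (abs_nonneg _) ha 2
      _ = 4 * M ^ 2 * ‖k‖ ^ 2 := by ring
      _ ≤ _ := by gcongr
  rw [h.fitScore_sq hx he]
  have h5 := h.integral_fitScore_sq k hm₀
  have hBI : 0 ≤ B * I := ht0.trans h1
  have hg : 0 ≤ gapForm PX θ₀ m k := gapForm_nonneg
  calc _ ≤ (2 * ρ / lam) ^ 2 * (4 * M ^ 2 * (gapForm PX θ₀ m k / c)) * (M₁ ^ 2 * (B * I)) := by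
        gcongr
    _ = 4 * M ^ 2 * M₁ ^ 2 / c * B * ((2 * ρ / lam) ^ 2 * gapForm PX θ₀ m k * I) := by
        ring
    _ = _ := by rw [← h5]; ring

theorem standardizedInfluence_le (h : IsGoodFit PX 𝒳 θ₀ m f κ P lam ρ μ) (hd : 2 ≤ d)
    (hdet : IsUnit (hessianW (eslLoss lam) P μ θ₀).det)
    (hdisp : IsUnit (dispersion (eslLoss lam) μ P θ₀).det) {c M M₁ B : ℝ} (hc : 0 < c)
    (hgap : ∀ k, c * ‖k‖ ^ 2 ≤ gapForm PX θ₀ m k)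
    (hM : ∀ x ∈ 𝒳, ∀ k, |indexDeriv θ₀ x k| ≤ M * ‖k‖)
    (hM₁ : ∀ x ∈ 𝒳, ‖deriv m (projIndex θ₀ x)‖ ≤ M₁) {m₀ : Euc d} (hm₀ : ‖m₀‖ = 1) (hB : 0 ≤ B)
    (hratio : ∀ y, ‖y‖ = 1 → tangentWeight lam ρ m₀ y ≤
      B * ∫ y, tangentWeight lam ρ m₀ y ∂(angularLaw f κ m₀))
    {z : Euc (q + 1) × Euc d} (hz : z ∈ 𝒳 ×ˢ Metric.sphere (0 : Euc d) 1) :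
    standardizedInfluence (eslLoss lam) μ P θ₀ z ≤
      √(4 * M ^ 2 * M₁ ^ 2 * ((d : ℝ) - 1) / c * B) := by
  set W := hessianW (eslLoss lam) P μ θ₀ with hW
  set IF := influenceFunction (eslLoss lam) μ P θ₀ with hIF
  -- Reparametrising the test direction as l = Wk turns inequalities for the influence function into
  -- inequalities for scores, and W disappears.
  have hspec : ∀ z l, (fun i => IF z i) ⬝ᵥ l = fitScore lam μ θ₀ (WithLp.toLp 2 (W⁻¹ *ᵥ l)) z :=
    fun z l => by
      rw [← h.influenceFunction_spec hdet, Matrix.mulVec_mulVec, Matrix.mul_nonsing_inv _ hdet,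
        Matrix.one_mulVec]
  have hd1 : (0 : ℝ) ≤ (d : ℝ) - 1 := by
    have : (2 : ℝ) ≤ d := by exact_mod_cast hd
    linarith
  refine Real.sqrt_le_sqrt (dotProduct_inv_mulVec_le hdisp (by positivity) fun l => ?_)
  have hcoord : ∀ i, (fun z => IF z i) =
      fun z => fitScore lam μ θ₀ (WithLp.toLp 2 (W⁻¹ *ᵥ Pi.single i 1)) z := fun i => by
    ext z; rw [← hspec]; simp
  have hcont : ∀ i, Continuous fun z => IF z i := fun i => by
    rw [hcoord]; exact h.continuous_fitScore _
  have e : l ⬝ᵥ (dispersion (eslLoss lam) μ P θ₀ *ᵥ l) = ∫ z, ((fun i => IF z i) ⬝ᵥ l) ^ 2 ∂P := by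
    have h1 : ∀ z, ((fun i => IF z i) ⬝ᵥ l) ^ 2 = ∑ i, ∑ j, l i * l j * (IF z i * IF z j) := by
      intro z
      rw [sq, dotProduct, Finset.sum_mul_sum]
      refine Finset.sum_congr rfl fun i _ => Finset.sum_congr rfl fun j _ => ?_
      ring
    have hint : ∀ i j, Integrable (fun z => IF z i * IF z j) P := fun i j =>
      h.toIsGoodModel.integrable ((hcont i).mul (hcont j))
    simp_rw [h1]
    rw [integral_finsetSum _ fun i _ => integrable_finsetSum _ fun j _ => (hint i j).const_mul _]
    simp only [dotProduct, Matrix.mulVec, Finset.mul_sum]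
    refine Finset.sum_congr rfl fun i _ => ?_
    rw [integral_finsetSum _ fun j _ => (hint i j).const_mul _]
    refine Finset.sum_congr rfl fun j _ => ?_
    rw [integral_const_mul, dispersion, Matrix.of_apply]
    ring
  have hz' : (fun i => influenceFunction (eslLoss lam) μ P θ₀ z i) ⬝ᵥ l = _ := hspec z l
  rw [e, hz']
  simp only [hspec]
  exact h.fitScore_sq_le hc hgap hM hM₁ hm₀ hratio _ hz

end IsGoodFit

end Sensitivity

/-! ### Transfer of the tuning equation to a single angular law. -/

section Assembly

variable {q d : ℕ} {f : ℝ → ℝ} {κ lam ρ : ℝ} {PX : Measure (Euc (q + 1))} [IsProbabilityMeasure PX]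
  {θ₀ : Euc q} {m : ℝ → Euc d} {P : Measure (Euc (q + 1) × Euc d)} [IsProbabilityMeasure P]
  {𝒳 : Set (Euc (q + 1))} {μ : Euc q → ℝ → Euc d}

theorem IsAngular.eventually_forall_integral_pos (hf : IsAngular f) (hd : 3 ≤ d) :
    ∀ᶠ κ in atTop, ∀ v : Euc d, ‖v‖ = 1 → 0 < ∫ y, f (κ * inner ℝ y v) ∂(surfaceMeasure d) := by
  have : NeZero d := ⟨by omega⟩
  have hm₀ : ‖(EuclideanSpace.single 0 1 : Euc d)‖ = 1 := by simp
  filter_upwards [hf.eventually_integral_pos hd hm₀] with κ hκ v hv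
  obtain ⟨O, hO, -⟩ := exists_isometry_map (hm₀.trans hv.symm)
  rwa [← hO, integral_comp_inner_isometry]

theorem IsGoodFit.integral_exp_eq [NeZero d] (h : IsGoodFit PX 𝒳 θ₀ m f κ P lam ρ μ) {m₀ : Euc d}
    (hm₀ : ‖m₀‖ = 1) :
    ∫ z, Real.exp (-‖z.2 - μ θ₀ (projIndex θ₀ z.1)‖ ^ 2 / lam) ∂P =
      ∫ y, Real.exp (-‖y - ρ • m₀‖ ^ 2 / lam) ∂(angularLaw f κ m₀) := by
  have hc := h.smooth.continuous_link h.mem_param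
  have hw : Continuous fun z : Euc (q + 1) × Euc d => z.2 - μ θ₀ (projIndex θ₀ z.1) :=
    continuous_snd.sub (hc.comp continuous_fst)
  rw [h.integral (h.toIsGoodModel.integrable (by fun_prop)), integral_congr_ae (g := fun _ => ∫ y, Real.exp (-‖y - ρ • m₀‖ ^ 2 / lam) ∂(angularLaw f κ m₀))]
  · simp
  filter_upwards [h.mem_ae] with x hx
  obtain ⟨O, hO, -⟩ := exists_isometry_map ((h.unit_of_mem hx).trans hm₀.symm)
  rw [← hO, integral_angularLaw_isometry h.nonneg h.mono]
  simp only [← map_smul, ← map_sub, LinearIsometryEquiv.norm_map, h.link_eq _ (h.mem_support x hx)]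

theorem IsLocationRadius.integral_exp_le (h : IsLocationRadius d f κ lam ρ) {v : Euc d} (hv : ‖v‖ = 1)
    [IsProbabilityMeasure (angularLaw f κ v)] (a : Euc d) :
    ∫ y, Real.exp (-‖y - a‖ ^ 2 / lam) ∂(angularLaw f κ v) ≤
      ∫ y, Real.exp (-‖y - ρ • v‖ ^ 2 / lam) ∂(angularLaw f κ v) := by
  have h1 := h.le hv a
  have hi : ∀ a : Euc d, Integrable (fun y => Real.exp (-‖y - a‖ ^ 2 / lam)) (angularLaw f κ v) :=
    fun a => integrable_angularLaw (by fun_prop)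
  simp only [eslLoss] at h1
  rw [integral_sub (integrable_const _) (hi _), integral_sub (integrable_const _) (hi _)] at h1
  linarith

theorem two_le_tuningK {δ : ℝ} (hd : 3 ≤ d) (hδ : δ ∈ Ioo (0 : ℝ) 1) : 2 ≤ tuningK d δ := by
  have hd' : (0 : ℝ) < d - 1 := by
    have : (3 : ℝ) ≤ d := by exact_mod_cast hd
    linarith
  have h1 : 0 < (1 - δ) ^ ((2 : ℝ) / ((d : ℝ) - 1)) := Real.rpow_pos_of_pos (by linarith [hδ.2]) _
  have h2 : (1 - δ) ^ ((2 : ℝ) / ((d : ℝ) - 1)) < 1 :=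
    Real.rpow_lt_one (by linarith [hδ.2]) (by linarith [hδ.1]) (by positivity)
  rw [tuningK, le_div_iff₀ (by linarith)]
  linarith

theorem sq_tuning_bound {δ : ℝ} (hd : 3 ≤ d) (hδ : δ ∈ Ioo (0 : ℝ) 1) :
    ((tuningK d δ - 2) ^ (-((d : ℝ) - 1) / 4) * (tuningK d δ + 2) ^ (((d : ℝ) + 1) / 4)) ^ 2 =
      (tuningK d δ - 2) ^ (-((d : ℝ) - 1) / 2) * (tuningK d δ + 2) ^ (((d : ℝ) + 1) / 2) := by
  have := two_le_tuningK hd hδ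
  rw [mul_pow, ← Real.rpow_mul_natCast (by linarith), ← Real.rpow_mul_natCast (by linarith)]
  congr 2 <;> (push_cast; ring)

end Assembly

/-! ### The main theorem. -/

theorem corollary3 {q d : ℕ} (hd : 3 ≤ d)
    -- the predictor: law, compact range and index distributions
    (PX : Measure (Euc (q + 1))) [IsProbabilityMeasure PX]
    (𝒳 : Set (Euc (q + 1))) (h𝒳 : IsCompact 𝒳) (hPX : ∀ᵐ x ∂PX, x ∈ 𝒳)
    (hdens : ∀ θ ∈ paramSpace q, PX.map (projIndex θ) ≪ volume)
    (hsupp : ∀ θ ∈ paramSpace q, ∀ x ∈ 𝒳, projIndex θ x ∈ (PX.map (projIndex θ)).support)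
    -- the true parameter and the population mean curve on the sphere
    (θ₀ : Euc q) (hθ₀ : θ₀ ∈ paramSpace q)
    (m : ℝ → Euc d) (hm : ContDiff ℝ 1 m)
    (hm_unit : ∀ u ∈ (PX.map (projIndex θ₀)).support, ‖m u‖ = 1) :
    ∃ C : ℝ, 0 < C ∧
      ∀ (f : ℝ → ℝ), IsAngular f → ∀ δ ∈ Ioo (0 : ℝ) 1,
      -- populations, tuning parameters and link functions, indexed by the concentration
      ∀ (P : ℝ → Measure (Euc (q + 1) × Euc d)) [∀ κ, IsProbabilityMeasure (P κ)]
        (lam : ℝ → ℝ) (μ : ℝ → Euc q → ℝ → Euc d),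
      (∀ᶠ κ in atTop, HasHighConcLaw PX θ₀ m f κ (P κ)) →
      (∀ᶠ κ in atTop, 0 < lam κ ∧
        1 - ∫ z, Real.exp (-‖z.2 - μ κ θ₀ (projIndex θ₀ z.1)‖ ^ 2 / lam κ) ∂(P κ) = δ) →
      (∀ᶠ κ in atTop, IsLinkFamily (eslLoss (lam κ)) (P κ) (μ κ)) →
      (∀ᶠ κ in atTop, IsSmoothFamily (μ κ)) →
      (∀ᶠ κ in atTop, ∀ᵐ u ∂(indexLaw (P κ) θ₀), ∀ v : Euc d, v ≠ 0 →
        0 < condHessian (eslLoss (lam κ)) (P κ) (μ κ) θ₀ u v) →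
      (∀ᶠ κ in atTop, IsUnit (hessianW (eslLoss (lam κ)) (P κ) (μ κ) θ₀).det) →
      (∀ᶠ κ in atTop, IsUnit (dispersion (eslLoss (lam κ)) (μ κ) (P κ) θ₀).det) →
      ∀ᶠ κ in atTop,
        (∀ z ∈ 𝒳 ×ˢ Metric.sphere (0 : Euc d) 1, ∃! v : Euc q,
          HasInfluence (eslLoss (lam κ)) (μ κ) (P κ) θ₀ z v) ∧
        sges (eslLoss (lam κ)) (μ κ) (P κ) θ₀ 𝒳 ≤
          ENNReal.ofReal (C * ((tuningK d δ - 2) ^ (-((d : ℝ) - 1) / 4) *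
            (tuningK d δ + 2) ^ (((d : ℝ) + 1) / 4))) := by
  have : NeZero d := ⟨by omega⟩
  have hd1 : (0 : ℝ) ≤ (d : ℝ) - 1 := by
    have : (3 : ℝ) ≤ d := by exact_mod_cast hd
    linarith
  -- The constant must be fixed before f, δ and the populations, but nondegeneracy of the form is
  -- known only once some W is invertible. Hence c is chosen under that condition, with an arbitrary
  -- value if it fails.
  obtain ⟨c, hc, hgap⟩ : ∃ c > 0, (∀ k, k ≠ 0 → 0 < gapForm PX θ₀ m k) →
      ∀ k, c * ‖k‖ ^ 2 ≤ gapForm PX θ₀ m k := by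
    by_cases h : ∀ k, k ≠ 0 → 0 < gapForm PX θ₀ m k
    · obtain ⟨c, hc, hk⟩ := exists_pos_mul_norm_sq_le (continuous_gapForm h𝒳 hPX hm) gapForm_smul h
      exact ⟨c, hc, fun _ => hk⟩
    · exact ⟨1, one_pos, fun h' => (h h').elim⟩
  obtain ⟨M, hM⟩ := h𝒳.exists_bound_of_continuousOn (continuous_indexDeriv θ₀).continuousOn
  have hM' : ∀ x ∈ 𝒳, ∀ k, |indexDeriv θ₀ x k| ≤ M * ‖k‖ := fun x hx k =>
    ((indexDeriv θ₀ x).le_opNorm k).trans (by gcongr; exact hM x hx)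
  obtain ⟨M₁, hM₁⟩ := h𝒳.exists_bound_of_continuousOn (f := fun x => deriv m (projIndex θ₀ x))
    ((hm.continuous_deriv le_rfl).comp (continuous_projIndex θ₀)).continuousOn
  set A : ℝ := 4 * M ^ 2 * M₁ ^ 2 * ((d : ℝ) - 1) / c * 2 ^ (d + 2) with hA
  have hA0 : 0 ≤ A := by positivity
  -- A may be 0, for instance when M₁ = 0; adding 1 keeps the constant positive.
  refine ⟨√A + 1, by positivity, fun f hf δ hδ P _ lam μ hlaw hlam hlink hsmooth hpd hW hdisp => ?_⟩
  set m₀ : Euc d := EuclideanSpace.single 0 1 with hm₀def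
  have hm₀ : ‖m₀‖ = 1 := by simp [hm₀def]
  have hna : NullSingletonClass (PX.map (projIndex θ₀)) :=
    ⟨fun u => hdens θ₀ hθ₀ (measure_singleton u)⟩
  have hfit : ∀ᶠ κ in atTop, ∃ ρ, IsGoodFit PX 𝒳 θ₀ m f κ (P κ) (lam κ) ρ (μ κ) := by
    filter_upwards [hlaw, hlam, hlink, hsmooth, hpd, hf.eventually_forall_integral_pos hd] with
      κ h1 h2 h3 h4 h5 h6
    have hmod : IsGoodModel PX 𝒳 θ₀ m f κ (P κ) :=
      ⟨hf.nonneg, hf.mono, h6, h1, hm, h𝒳, hPX, hsupp θ₀ hθ₀, hm_unit, hna⟩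
    obtain ⟨ρ, hρ, hμρ⟩ := hmod.exists_radius h3 h4 hθ₀
    exact ⟨ρ, hmod, h2.1, hρ, h3, h4, hθ₀, hμρ, h5⟩
  -- The asymptotic lemmas take the radius as a function of κ.
  obtain ⟨ρ, hρ⟩ := hfit.choice
  have hratio := hf.eventually_ratio hd hm₀ hδ (lam := lam) (ρ := ρ) (by
    filter_upwards [hρ, hlam] with κ h1 h2
    have := h1.isProb hm₀
    have e := h1.integral_exp_eq hm₀
    have e' : ∫ y, Real.exp (-‖y - ρ κ • m₀‖ ^ 2 / lam κ) ∂(angularLaw f κ m₀) = 1 - δ := by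
      rw [← e]; linarith [h2.2]
    exact ⟨h2.1, e', (h1.radius.integral_exp_le hm₀ m₀).trans e'.le⟩)
  set τ := (tuningK d δ - 2) ^ (-((d : ℝ) - 1) / 4) * (tuningK d δ + 2) ^ (((d : ℝ) + 1) / 4) with hτ
  have hK := two_le_tuningK hd hδ
  have hτ0 : 0 ≤ τ := mul_nonneg (Real.rpow_nonneg (by linarith) _) (Real.rpow_nonneg (by linarith) _)
  rw [← sq_tuning_bound hd hδ, ← hτ] at hratio
  filter_upwards [hρ, hratio, hW, hdisp] with κ h1 h2 h3 h4
  refine ⟨fun z _ => ?_, iSup₂_le fun z hz => ENNReal.ofReal_le_ofReal ?_⟩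
  · obtain ⟨v, hv, -⟩ := h1.exists_influence h3 z
    exact ⟨v, (hv v).2 rfl, fun v' h => (hv v').1 h⟩
  · refine (h1.standardizedInfluence_le (by omega) h3 h4 hc
      (hgap fun k hk => h1.gapForm_pos h3 hk) hM' hM₁ hm₀ (B := 2 ^ (d + 2) * τ ^ 2) (by positivity)
      h2.2 hz).trans ?_
    have e : 4 * M ^ 2 * M₁ ^ 2 * ((d : ℝ) - 1) / c * (2 ^ (d + 2) * τ ^ 2) = A * τ ^ 2 := by
      rw [hA]; ring
    rw [e, Real.sqrt_mul hA0, Real.sqrt_sq hτ0]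
    nlinarith
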